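/- All graphs are finite and simple. A hole is a chordless cycle with at least four vertices, an antihole is the complement of a hole, and a prism is a graph that consists of two vertex-disjoint triangles and three pairwise vertex-disjoint paths between them, with no other edges than those of the triangles and of the paths. Let $G$ be a graph that contains (as an induced subgraph) no odd hole, no antihole of length at least $5$ and no prism. A vertex sees another one if they are adjacent. For a set $X$ of vertices, $N(X)$ is the set of vertices outside $X$ that see at least one vertex of $X$, and $C(X)$ is the set of vertices outside $X$ that see every vertex of $X$; $N(u)$ is the set of neighbours of a vertex $u$. A non-empty set $T\subseteq V(G)$ is interesting if $\overline{G}[T]$ is connected and $C(T)$ is not a clique; it is maximal if it is not strictly included in another interesting set. A $T$-outer path is a chordless path with at least one interior vertex whose endvertices are in $C(T)$ and whose interior vertices are all in $V(G)\setminus(T\cup C(T))$; it is minimal if no $T$-outer path has its interior strictly contained in the interior of this one. A special even pair of $G$ is a pair $\{a,b\}$ of distinct non-adjacent vertices such that every chordless path between $a$ and $b$ has even length and the graph $G/ab$ contains no prism (as an induced subgraph), where $G/ab$ is obtained from $G$ by removing $a,b$ and adding one vertex adjacent to every remaining vertex that sees $a$ or $b$. For sets $X,Y$ of vertices, a breadth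 first search from $X$ to $Y$ in a graph is a breadth first search in which all vertices of $X$ (as far as they are in the graph) form the root level and are put in the queue at the start, and reached vertices of $Y$ are never put in the queue afterwards, so that they are not scanned. Let $T$ be a maximal interesting set of $G$ and let $P=x\,z_1\cdots z_p\,y$ be any minimal $T$-outer path; write $v=z_1$ and $w=z_p$. Put $$A=(N(v)\cap C(T))\setminus N(y),\qquad B=(N(w)\cap C(T))\setminus N(x).$$ Let $u<_A u'$ mean that $u,u'\in A$ and there is an odd chordless path from $u$ to a vertex of $B$ whose second vertex is $u'$; define $<_B$ likewise, with $A$ and $B$ exchanged. A vertex $a\in A$ is maximal for $<_A$ if there is no $u\in A$ with $a<_A u$, and likewise for $<_B$. Perform a breadth first search from $B$ to $N(A)$ in $G\setminus(T\cup A)$ and let $K$ be the set of vertices of $N(A)$ that it reaches; perform a breadth first search from $A$ to $N(B)$ in $G\setminus(T\cup B)$ and let $L$ be the set of vertices of $N(B)$ that it reaches. Algorithm Find_Even_Pair computes $A,B,K,L$, chooses a vertex $a\in A$ that sees all of $K$ and a vertex $b\in B$ that sees all of $L$, and returns $\{a,b\}$. Then: 1. $A=\{u\in C(T): u \text{ sees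 } z_1 \text{ and misses } z_2,\dots,z_p\}$ and $B=\{u\in C(T): u \text{ sees } z_p \text{ and misses } z_1,\dots,z_{p-1}\}$. 2. Both searches have complete runs. For whatever set $K$ is obtained, some vertex of $A$ sees all of $K$, and a vertex of $A$ is maximal for $<_A$ if and only if it sees all of $K$. Likewise, for whatever set $L$ is obtained, some vertex of $B$ sees all of $L$, and a vertex of $B$ is maximal for $<_B$ if and only if it sees all of $L$. 3. The algorithm returns a pair, and every pair $\{a,b\}$ that it can return is a special even pair of $G$. -/

import Mathlib

namespace ArtemisGraph

open SimpleGraph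

/-! ### Basic graph notions -/

section Basic

variable {V : Type*}

/-- A chordless path. -/
def IsChordlessPath (G : SimpleGraph V) {u v : V} (p : G.Walk u v) : Prop :=
  p.IsPath ∧ p.IsChordless

/-- `G` contains (as an induced subgraph) a hole of length `n`, that is, a chordless cycle with
`n` vertices, where `n ≥ 4`. -/
def HasHole (G : SimpleGraph V) (n : ℕ) : Prop :=
  4 ≤ n ∧ Nonempty (cycleGraph n ↪g G)

/-- `G` contains (as an induced subgraph) an antihole of length `n`, that is, the complement of a
hole of length `n`. -/
def HasAntihole (G : SimpleGraph V) (n : ℕ) : Prop :=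
  4 ≤ n ∧ Nonempty ((cycleGraph n)ᶜ ↪g G)

/-- `G` contains a prism as an induced subgraph: two vertex-disjoint triangles `a 0, a 1, a 2` and
`b 0, b 1, b 2`, three pairwise vertex-disjoint paths `P i` from `a i` to `b i`, and no edge of `G`
between vertices of the three paths other than those of the two triangles and of the paths. -/
def HasPrism (G : SimpleGraph V) : Prop :=
  ∃ (a b : Fin 3 → V) (P : ∀ i, G.Walk (a i) (b i)),
    (∀ i j, i ≠ j → G.Adj (a i) (a j)) ∧
    (∀ i j, i ≠ j → G.Adj (b i) (b j)) ∧
    (∀ i j, a i ≠ b j) ∧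
    (∀ i, (P i).IsPath) ∧
    (∀ i j, i ≠ j → ∀ u ∈ (P i).support, u ∉ (P j).support) ∧
    (∀ i j, ∀ u ∈ (P i).support, ∀ v ∈ (P j).support, G.Adj u v →
      (i = j ∧ s(u, v) ∈ (P i).edges) ∨
      (i ≠ j ∧ ((u = a i ∧ v = a j) ∨ (u = b i ∧ v = b j))))

/-- The class `𝒜` (Artemis graphs): no odd hole, no antihole of length at least `5`, no prism. -/
def ClassA (G : SimpleGraph V) : Prop :=
  (∀ n, Odd n → ¬ HasHole G n) ∧ (∀ n, 5 ≤ n → ¬ HasAntihole G n) ∧ ¬ HasPrism G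

/-- `{a, b}` is an even pair of `G`. -/
def IsEvenPair (G : SimpleGraph V) (a b : V) : Prop :=
  a ≠ b ∧ ¬ G.Adj a b ∧ ∀ p : G.Walk a b, IsChordlessPath G p → Even p.length

/-- Adjacency in `G/ab`; the vertex `none` is the new vertex. -/
def contractAdj (G : SimpleGraph V) (a b : V) :
    Option {v : V // v ≠ a ∧ v ≠ b} → Option {v : V // v ≠ a ∧ v ≠ b} → Prop
  | none, none => False
  | none, some v => G.Adj a v ∨ G.Adj b v
  | some u, none => G.Adj a u ∨ G.Adj b u
  | some u, some v => G.Adj u v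

/-- The graph `G/ab`: remove `a` and `b` and add one vertex that is adjacent to every other vertex
that sees at least one of `a`, `b`. -/
def contract (G : SimpleGraph V) (a b : V) : SimpleGraph (Option {v : V // v ≠ a ∧ v ≠ b}) where
  Adj := contractAdj G a b
  symm := ⟨by
    rintro (_ | u) (_ | v) h
    · exact h
    · exact h
    · exact h
    · exact G.adj_symm h⟩
  loopless := ⟨by
    rintro (_ | u) h
    · exact h
    · exact SimpleGraph.irrefl G h⟩

/-- `{a, b}` is a special even pair of `G`: an even pair such that `G/ab` contains no prism. -/
def IsSpecialEvenPair (G : SimpleGraph V) (a b : V) : Prop :=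
  IsEvenPair G a b ∧ ¬ HasPrism (contract G a b)

/-- `N(X)`: the vertices outside `X` that see at least one vertex of `X`. -/
def nbr (G : SimpleGraph V) (X : Set V) : Set V :=
  {v | v ∉ X ∧ ∃ x ∈ X, G.Adj x v}

/-- `C(X)`: the vertices outside `X` that see every vertex of `X`. -/
def complete (G : SimpleGraph V) (X : Set V) : Set V :=
  {v | v ∉ X ∧ ∀ x ∈ X, G.Adj x v}

end Basic

/-! ### Interesting sets, outer paths, and the two orders -/

section Interesting

variable {V : Type*}

/-- `T` is interesting: non-empty, co-connected, and `C(T)` is not a clique. -/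
def IsInteresting (G : SimpleGraph V) (T : Set V) : Prop :=
  T.Nonempty ∧ (Gᶜ.induce T).Connected ∧ ¬ G.IsClique (complete G T)

/-- `T` is an interesting set that is not strictly included in another interesting set. -/
def IsMaximalInteresting (G : SimpleGraph V) (T : Set V) : Prop :=
  IsInteresting G T ∧ ∀ T', IsInteresting G T' → ¬ T ⊂ T'

/-- The set of interior vertices of a path. -/
def interior {G : SimpleGraph V} {x y : V} (p : G.Walk x y) : Set V :=
  {z | z ∈ p.support ∧ z ≠ x ∧ z ≠ y}

/-- A `T`-outer path: a chordless path with at least one interior vertex, with both endvertices in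
`C(T)` and all interior vertices outside `T ∪ C(T)`. -/
def IsOuterPath (G : SimpleGraph V) (T : Set V) {x y : V} (p : G.Walk x y) : Prop :=
  IsChordlessPath G p ∧ 2 ≤ p.length ∧ x ∈ complete G T ∧ y ∈ complete G T ∧
    ∀ z ∈ interior p, z ∉ T ∪ complete G T

/-- A minimal `T`-outer path: no `T`-outer path has its interior strictly contained in the interior
of this one. -/
def IsMinimalOuterPath (G : SimpleGraph V) (T : Set V) {x y : V} (p : G.Walk x y) : Prop :=
  IsOuterPath G T p ∧
    ∀ (x' y' : V) (q : G.Walk x' y'), IsOuterPath G T q → ¬ interior q ⊂ interior p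

/-- For `p = x z₁ ⋯ z_p y`: the vertices of `C(T)` that see `z₁` and miss `z₂, …, z_p`. -/
def orderA (G : SimpleGraph V) (T : Set V) {x y : V} (p : G.Walk x y) : Set V :=
  {u | u ∈ complete G T ∧ G.Adj u (p.getVert 1) ∧
    ∀ i, 2 ≤ i → i ≤ p.length - 1 → ¬ G.Adj u (p.getVert i)}

/-- For `p = x z₁ ⋯ z_p y`: the vertices of `C(T)` that see `z_p` and miss `z₁, …, z_{p-1}`. -/
def orderB (G : SimpleGraph V) (T : Set V) {x y : V} (p : G.Walk x y) : Set V :=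
  {u | u ∈ complete G T ∧ G.Adj u (p.getVert (p.length - 1)) ∧
    ∀ i, 1 ≤ i → i < p.length - 1 → ¬ G.Adj u (p.getVert i)}

/-- The relation `<_X` on `X` with respect to `Y`: `u <_X u'` if and only if `u, u' ∈ X` and there
is an odd chordless path from `u` to a vertex of `Y` whose second vertex is `u'`.
The relation `<_A` is `pathLT G A B`, and `<_B` is `pathLT G B A`. -/
def pathLT (G : SimpleGraph V) (X Y : Set V) (u u' : V) : Prop :=
  u ∈ X ∧ u' ∈ X ∧ ∃ y ∈ Y, ∃ p : G.Walk u y,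
    IsChordlessPath G p ∧ Odd p.length ∧ p.getVert 1 = u'

/-- `a` is a maximal vertex of the relation `<_X`. -/
def IsMaximalVertex (G : SimpleGraph V) (X Y : Set V) (a : V) : Prop :=
  a ∈ X ∧ ∀ u ∈ X, ¬ pathLT G X Y a u

end Interesting

/-! ### Breadth first search from `X` to `Y` -/

section BFS

variable {V : Type*}

/-- The state of a breadth first search: the queue of vertices that are still to be scanned, and
the set of vertices reached so far. -/
structure BFSState (V : Type*) where
  queue : List V
  reached : Set V

/-- One step of a breadth first search in `G[S]`: the first vertex `u` of the queue is removed and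
scanned. Its neighbours in `G[S]` that have not been reached before become reached, and those of
them that are not in `Y` are appended to the queue, in any order. -/
inductive BFSStep (G : SimpleGraph V) (S Y : Set V) : BFSState V → BFSState V → Prop
  | scan (u : V) (q new : List V) (R : Set V) (hnodup : new.Nodup)
      (hnew : ∀ v, v ∈ new ↔ v ∈ S ∧ G.Adj u v ∧ v ∉ R ∧ v ∉ Y) :
      BFSStep G S Y ⟨u :: q, R⟩ ⟨q ++ new, R ∪ {v | v ∈ S ∧ G.Adj u v}⟩

/-- `R` is the set of all vertices reached by some complete run of a breadth first search from `X`
to `Y` in `G[S]`: at the start all vertices of `X` in `G[S]` are put in the queue, in any order, and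
the search ends when the queue is empty. -/
def IsBFSResult (G : SimpleGraph V) (S X Y R : Set V) : Prop :=
  ∃ q₀ : List V, q₀.Nodup ∧ (∀ v, v ∈ q₀ ↔ v ∈ X ∩ S) ∧
    Relation.ReflTransGen (BFSStep G S Y) ⟨q₀, X ∩ S⟩ ⟨[], R⟩

end BFS

/-! ### The algorithm that finds an even pair -/

section Algorithm

variable {V : Type*}

/-- Line 1, for a path `x v ⋯ w y`: the set `(N(v) ∩ C(T)) \ N(y)`. -/
def algA (G : SimpleGraph V) (T : Set V) {x y : V} (p : G.Walk x y) : Set V :=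
  (G.neighborSet (p.getVert 1) ∩ complete G T) \ G.neighborSet y

/-- Line 1, for a path `x v ⋯ w y`: the set `(N(w) ∩ C(T)) \ N(x)`. -/
def algB (G : SimpleGraph V) (T : Set V) {x y : V} (p : G.Walk x y) : Set V :=
  (G.neighborSet (p.getVert (p.length - 1)) ∩ complete G T) \ G.neighborSet x

/-- Line 2 with `X = A`, `Y = B` (and line 3 with `X = B`, `Y = A`): `K` is the set of vertices of
`N(X)` that are reached by some breadth first search from `Y` to `N(X)` in `G \ (T ∪ X)`. -/
def IsSearchOutput (G : SimpleGraph V) (T X Y K : Set V) : Prop :=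
  ∃ R, IsBFSResult G (T ∪ X)ᶜ Y (nbr G X) R ∧ K = nbr G X ∩ R

/-- Some run of the algorithm on the input `G`, `T`, `p` returns the pair `{a, b}`. -/
def Returns (G : SimpleGraph V) (T : Set V) {x y : V} (p : G.Walk x y) (a b : V) : Prop :=
  ∃ K L : Set V,
    IsSearchOutput G T (algA G T p) (algB G T p) K ∧
    IsSearchOutput G T (algB G T p) (algA G T p) L ∧
    (a ∈ algA G T p ∧ ∀ u ∈ K, G.Adj a u) ∧
    (b ∈ algB G T p ∧ ∀ u ∈ L, G.Adj b u)

end Algorithm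

end ArtemisGraph

/-! The argument takes place in the graph obtained from $G$ by collapsing $T$ to one vertex $t$
whose neighbours are the vertices of $C(T)$ (`collapse`). By a statement of Roussel–Rubio type,
`outer_path_odd`, a chordless path with both ends in $C(T)$ and with a nonempty interior that avoids
$T\cup C(T)$ has even length; hence collapsing creates no odd hole. It creates no prism either: in a
prism through $t$, any $u\in T$ can be put in the place of $t$, and this shows that $u$ sees one of
two fixed adjacent vertices of a triangle. As $T$ is co-connected, these two are joined by a long
antipath through $T$, and vertices of the prism close it to an antihole.

Maximality of $T$ makes the neighbours in $C(T)$ of an outer vertex a clique. So $A$ and $B$ are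
cliques and the interior $Z$ of the outer path has at least two vertices. Minimality of the path and
parity show that the vertices of $A$ and $B$ attach to $Z$ at one end only, and that all other
vertices of $C(T)$ that see $Z$ are complete to $A\cup B$. This is the structure `Core`, on which
two facts are proved.

`Core.odd_path`: an odd chordless path from $A$ to $B$ has its second vertex in $A$ or its
penultimate one in $B$. Without odd holes, the number of edges of the path with both ends seen by
$t$ has the parity of its length. Cut the path at the vertices that see $Z$. A segment with an odd
count closes through $Z$ to a hole on which $t$ sees just two consecutive vertices; a second way
from $t$ to the hole then yields a pyramid or a prism (`Hat`).

`Core.no_crossing`: if $M$ is connected, anticomplete to $A$, and contains $B$ and all of $Z$ but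
its first vertex, then the neighbourhoods in $A$ of the vertices outside $A$ that see $M$ are
nested. If two of them cross, $t$ and the first vertex of $Z$ form a leap over a hole, and
`Core.false_of_leap` excludes this.

The search from $B$ provides such an $M$, the reached vertices outside $N(A)$, and $K$ is the set of
vertices outside $T$ that see both $A$ and $M$ (`Frame.exists_reach`). Nestedness gives a vertex of
$A$ that sees all of $K$. If $a\in A$ misses $k\in K$, then some $a'\in A$ sees $k$, and $a,a',k$
followed by a path through $M$ to $B$ is odd by `odd_path`, so $a<_A a'$. Conversely, a chordless
path $a,a',\dots,b$ meets $K$ between $a'$ and $b$, at a vertex that $a$ misses. This characterises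
the maximal vertices, and together with `odd_path` it shows that the returned pair is even.

A prism of $G/ab$ through the new vertex yields a prism or a pyramid of $G$, an odd chordless path
from $a$ to $b$, or a prism with a broken rung whose two pieces end in $a$ and $b$ (`OpenRung`). By
the choice of $a$ and $b$, a broken prism contains no other vertex of $A\cup B$. Mending the rung
with $t$ and counting the edges seen by $t$ on three paths gives a contradiction of parity
(`Core.false_of_openRung`).

Chordless paths are lists `x :: (m ++ [y])`; such a path has even length if and only if `m.length`
is odd. -/

namespace ArtemisGraph
open SimpleGraph

/-! ### Splitting lists at a marked element -/

section ListSplit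
variable {α : Type*}

theorem exists_first_split (p : α → Prop) {l : List α} (h : ∃ x ∈ l, p x) :
    ∃ l₁ x l₂, l = l₁ ++ x :: l₂ ∧ p x ∧ ∀ y ∈ l₁, ¬ p y := by
  induction l with
  | nil => simp at h
  | cons a l ih =>
    by_cases ha : p a
    · exact ⟨[], a, l, rfl, ha, by simp⟩
    · obtain ⟨l₁, x, l₂, rfl, hx, h₁⟩ := ih (by grind)
      exact ⟨a :: l₁, x, l₂, rfl, hx, by grind⟩

theorem exists_last_split (p : α → Prop) {l : List α} (h : ∃ x ∈ l, p x) :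
    ∃ l₁ x l₂, l = l₁ ++ x :: l₂ ∧ p x ∧ ∀ y ∈ l₂, ¬ p y := by
  obtain ⟨l₁, x, l₂, hl, hx, h₁⟩ := exists_first_split p (l := l.reverse) (by simpa using h)
  refine ⟨l₂.reverse, x, l₁.reverse, ?_, hx, by simpa using h₁⟩
  have := congrArg List.reverse hl
  simpa using this

theorem concat_eq_split {l l₁ l₂ : List α} {b x : α} (h : l ++ [b] = l₁ ++ x :: l₂) :
    (x = b ∧ l₂ = [] ∧ l = l₁) ∨ ∃ l₃, l₂ = l₃ ++ [b] ∧ l = l₁ ++ x :: l₃ := by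
  rcases List.eq_nil_or_concat l₂ with rfl | ⟨l₃, c, rfl⟩
  · left
    have := List.append_inj' h rfl
    simp_all
  · right
    have h' : l ++ [b] = (l₁ ++ x :: l₃) ++ [c] := by simpa using h
    have := List.append_inj' h' rfl
    exact ⟨l₃, by simp_all, this.1⟩

theorem cons_eq_split {l l₁ l₂ : List α} {a x : α} (h : a :: l = l₁ ++ x :: l₂) :
    (x = a ∧ l₁ = [] ∧ l = l₂) ∨ ∃ l₃, l₁ = a :: l₃ ∧ l = l₃ ++ x :: l₂ := by
  cases l₁ <;> simp_all

end ListSplit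

/-! ### Anticomplete lists, and chordless paths as lists -/

variable {V : Type*} {G : SimpleGraph V}

/-- `u` and `v` are distinct and non-adjacent. -/
def Far (G : SimpleGraph V) (u v : V) : Prop := u ≠ v ∧ ¬ G.Adj u v

/-- `u` is distinct from and non-adjacent to all vertices of `l`. -/
def FarL (G : SimpleGraph V) (u : V) (l : List V) : Prop := ∀ v ∈ l, Far G u v

/-- No vertex of `l₁` is equal or adjacent to a vertex of `l₂`. -/
def Anti (G : SimpleGraph V) (l₁ l₂ : List V) : Prop := ∀ u ∈ l₁, FarL G u l₂

theorem Far.symm {u v : V} (h : Far G u v) : Far G v u := ⟨h.1.symm, fun e => h.2 e.symm⟩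

theorem far_comm {u v : V} : Far G u v ↔ Far G v u := ⟨Far.symm, Far.symm⟩

theorem Anti.symm {l₁ l₂ : List V} (h : Anti G l₁ l₂) : Anti G l₂ l₁ :=
  fun u hu v hv => (h v hv u hu).symm

theorem Anti.mono {l₁ l₂ l₃ l₄ : List V} (h : Anti G l₁ l₂) (h₁ : l₃ ⊆ l₁) (h₂ : l₄ ⊆ l₂) :
    Anti G l₃ l₄ :=
  fun u hu v hv => h u (h₁ hu) v (h₂ hv)

@[simp] theorem farL_nil (u : V) : FarL G u [] := by simp [FarL]
@[simp] theorem farL_cons {u v : V} {l : List V} : FarL G u (v :: l) ↔ Far G u v ∧ FarL G u l := by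
  simp [FarL]
@[simp] theorem farL_append {u : V} {l l' : List V} :
    FarL G u (l ++ l') ↔ FarL G u l ∧ FarL G u l' := by
  simp [FarL, or_imp, forall_and]
@[simp] theorem farL_reverse {u : V} {l : List V} : FarL G u l.reverse ↔ FarL G u l := by
  simp [FarL]
@[simp] theorem anti_nil_left (l : List V) : Anti G [] l := by simp [Anti]
@[simp] theorem anti_nil_right (l : List V) : Anti G l [] := by simp [Anti]
@[simp] theorem anti_cons_left {u : V} {l l' : List V} :
    Anti G (u :: l) l' ↔ FarL G u l' ∧ Anti G l l' := by
  simp [Anti]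
@[simp] theorem anti_append_left {l₁ l₂ l : List V} :
    Anti G (l₁ ++ l₂) l ↔ Anti G l₁ l ∧ Anti G l₂ l := by
  simp [Anti, or_imp, forall_and]
@[simp] theorem anti_reverse_left {l l' : List V} : Anti G l.reverse l' ↔ Anti G l l' := by
  simp [Anti]
theorem anti_comm {l l' : List V} : Anti G l l' ↔ Anti G l' l := ⟨Anti.symm, Anti.symm⟩
@[simp] theorem anti_cons_right {u : V} {l l' : List V} :
    Anti G l (u :: l') ↔ FarL G u l ∧ Anti G l l' := by
  rw [anti_comm, anti_cons_left, anti_comm]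
@[simp] theorem anti_append_right {l₁ l₂ l : List V} :
    Anti G l (l₁ ++ l₂) ↔ Anti G l l₁ ∧ Anti G l l₂ := by
  rw [anti_comm, anti_append_left, anti_comm, anti_comm (l := l₂)]
@[simp] theorem anti_reverse_right {l l' : List V} : Anti G l l'.reverse ↔ Anti G l l' := by
  rw [anti_comm, anti_reverse_left, anti_comm]

theorem FarL.mono {u : V} {l l' : List V} (h : FarL G u l) (hl : l' ⊆ l) : FarL G u l' :=
  fun v hv => h v (hl hv)

theorem FarL.notMem {u : V} {l : List V} (h : FarL G u l) : u ∉ l := fun hu => (h u hu).1 rfl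

attribute [grind .] farL_nil anti_nil_left anti_nil_right
attribute [grind =] farL_cons farL_append farL_reverse anti_cons_left anti_append_left anti_reverse_left anti_cons_right anti_append_right
  anti_reverse_right
attribute [grind →] Far.symm Anti.symm

/-- The vertices of `l`, in this order, form a chordless path of `G`. -/
def IndPath (G : SimpleGraph V) : List V → Prop
  | [] => True
  | [_] => True
  | a :: b :: l => G.Adj a b ∧ FarL G a l ∧ IndPath G (b :: l)

@[simp] theorem indPath_nil : IndPath G [] := trivial
@[simp] theorem indPath_singleton (a : V) : IndPath G [a] := trivial
theorem indPath_cons_cons {a b : V} {l : List V} :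
    IndPath G (a :: b :: l) ↔
      G.Adj a b ∧ FarL G a l ∧ IndPath G (b :: l) := Iff.rfl

theorem indPath_pair {a b : V} : IndPath G [a, b] ↔ G.Adj a b := by simp [indPath_cons_cons]

theorem IndPath.tail {a : V} {l : List V} (h : IndPath G (a :: l)) : IndPath G l := by
  cases l with
  | nil => trivial
  | cons b l => exact h.2.2

theorem indPath_append {l₁ l₂ : List V} {x : V} :
    IndPath G (l₁ ++ x :: l₂) ↔ IndPath G (l₁ ++ [x]) ∧ IndPath G (x :: l₂) ∧ Anti G l₁ l₂ := by
  induction l₁ with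
  | nil => simp [Anti]
  | cons a l₁ ih =>
    cases l₁ with
    | nil =>
      simp [indPath_cons_cons]
      tauto
    | cons b l₁ =>
      simp only [List.cons_append, indPath_cons_cons] at ih ⊢
      rw [ih]
      simp
      tauto

theorem IndPath.right {l₁ l₂ : List V} (h : IndPath G (l₁ ++ l₂)) : IndPath G l₂ := by
  cases l₂ with
  | nil => trivial
  | cons x l₂ => exact (indPath_append.1 h).2.1

theorem IndPath.left {l₁ l₂ : List V} (h : IndPath G (l₁ ++ l₂)) : IndPath G l₁ := by
  rcases List.eq_nil_or_concat l₁ with rfl | ⟨l₃, c, rfl⟩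
  · trivial
  · have h' : IndPath G (l₃ ++ c :: l₂) := by simpa using h
    simpa using (indPath_append.1 h').1

theorem IndPath.anti {l₁ l₂ : List V} {x : V} (h : IndPath G (l₁ ++ x :: l₂)) : Anti G l₁ l₂ :=
  (indPath_append.1 h).2.2

theorem IndPath.glue {l₁ l₂ : List V} {x : V} (h₁ : IndPath G (l₁ ++ [x]))
    (h₂ : IndPath G (x :: l₂)) (h : Anti G l₁ l₂) : IndPath G (l₁ ++ x :: l₂) :=
  indPath_append.2 ⟨h₁, h₂, h⟩

theorem IndPath.concat {l : List V} {x y : V} (h₁ : IndPath G (l ++ [x])) (h₂ : G.Adj x y)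
    (h : FarL G y l) : IndPath G (l ++ [x, y]) :=
  h₁.glue (indPath_pair.2 h₂) (by simpa using h)

theorem indPath_reverse {l : List V} : IndPath G l.reverse ↔ IndPath G l := by
  have key : ∀ l : List V, IndPath G l → IndPath G l.reverse := by
    intro l
    induction l with
    | nil => intro _; trivial
    | cons a l ih =>
      intro h
      cases l with
      | nil => trivial
      | cons b l =>
        have h' := ih h.tail
        simp only [List.reverse_cons, List.append_assoc, List.singleton_append] at h' ⊢
        exact h'.concat h.1.symm (by simpa using h.2.1)
  exact ⟨fun h => by simpa using key _ h, key l⟩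

theorem IndPath.reverse_mid {x y : V} {m : List V} (h : IndPath G (x :: (m ++ [y]))) :
    IndPath G (y :: (m.reverse ++ [x])) := by
  simpa using indPath_reverse.2 h

theorem IndPath.far_ends {x y : V} {m : List V} (h : IndPath G (x :: (m ++ [y]))) (hm : m ≠ []) :
    Far G x y := by
  obtain ⟨z, m, rfl⟩ := List.exists_cons_of_ne_nil hm
  exact h.2.1 y (by simp)

theorem IndPath.nodup {l : List V} (h : IndPath G l) : l.Nodup := by
  induction l with
  | nil => simp
  | cons a l ih =>
    refine List.nodup_cons.2 ⟨?_, ih h.tail⟩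
    cases l with
    | nil => simp
    | cons b l =>
      intro hm
      rcases List.mem_cons.1 hm with rfl | hm
      · exact G.loopless.irrefl _ h.1
      · exact (h.2.1 a hm).1 rfl

theorem IndPath.isChain {l : List V} (h : IndPath G l) : List.IsChain G.Adj l := by
  induction l with
  | nil => simp
  | cons a l ih =>
    cases l with
    | nil => simp
    | cons b l => exact List.isChain_cons_cons.2 ⟨h.1, ih h.2.2⟩

/-- A chain between two distinct vertices contains a chordless path between them. -/
theorem exists_indPath_of_isChain {w : List V} {a b : V}
    (h : List.IsChain G.Adj (a :: (w ++ [b]))) (hab : a ≠ b) :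
    ∃ g, IndPath G (a :: (g ++ [b])) ∧ ∀ x ∈ g, x ∈ w := by
  induction w generalizing a with
  | nil => exact ⟨[], by simpa [indPath_pair] using h, by simp⟩
  | cons c w ih =>
    rw [List.cons_append, List.isChain_cons_cons] at h
    by_cases hc : c = b
    · exact ⟨[], by simpa [indPath_pair] using hc ▸ h.1, by simp⟩
    obtain ⟨g, hg, hgw⟩ := ih h.2 hc
    obtain ⟨l₁, x, l₂, hl, hx, h₂⟩ :=
      exists_last_split (fun v => v = a ∨ G.Adj a v) (l := c :: (g ++ [b])) ⟨c, by simp, .inr h.1⟩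
    have hsub : ∀ v ∈ x :: l₂, v ∈ c :: (g ++ [b]) := by
      intro v hv; rw [hl]; simp at hv ⊢; tauto
    have hP : IndPath G (x :: l₂) := by rw [hl] at hg; exact hg.right
    have hmem : ∀ l₃ : List V, (∀ v ∈ l₃, v ∈ x :: l₂) → a ∉ l₃ → b ∉ l₃ → ∀ v ∈ l₃, v ∈ c :: w := by
      intro l₃ h₃ _ hb v hv
      have := hsub v (h₃ v hv)
      simp only [List.mem_cons, List.mem_append, List.not_mem_nil, or_false] at this ⊢
      rcases this with h | h | h
      · exact .inl h
      · exact .inr (hgw v h)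
      · exact absurd (h ▸ hv) hb
    have hl' : (c :: g) ++ [b] = l₁ ++ x :: l₂ := by simpa using hl
    rcases concat_eq_split hl' with ⟨rfl, rfl, -⟩ | ⟨l₃, rfl, -⟩
    · rcases hx with rfl | hx
      · exact absurd rfl hab
      · exact ⟨[], by simpa [indPath_pair] using hx, by simp⟩
    · have hb : b ∉ x :: l₃ := by
        have := hP.nodup
        rw [← List.cons_append, List.nodup_append] at this
        intro hb; exact this.2.2 b hb b (by simp) rfl
      rcases hx with rfl | hx
      · refine ⟨l₃, hP, hmem l₃ (by simp +contextual) ?_ (by simp at hb; tauto)⟩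
        have := hP.nodup; simp at this; tauto
      · have hne : FarL G a (l₃ ++ [b]) := by
          intro v hv
          have := h₂ v hv
          exact ⟨fun e => this (.inl e.symm), fun e => this (.inr e)⟩
        refine ⟨x :: l₃, ⟨hx, hne, hP⟩, hmem _ (by simp +contextual) ?_ hb⟩
        intro ha
        rcases List.mem_cons.1 ha with rfl | ha
        · exact G.loopless.irrefl _ hx
        · exact (hne a (by simp [ha])).1 rfl

/-- From a chain that starts at a vertex `t` without the property `p` and that reaches `p`, one gets
a chordless path from `t` in which only the last vertex has the property. -/
theorem exists_indPath_first {w : List V} {t : V} (p : V → Prop) (ht : ¬ p t)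
    (h : List.IsChain G.Adj (t :: w)) (hp : ∃ v ∈ w, p v) :
    ∃ g f, IndPath G (t :: (g ++ [f])) ∧ p f ∧ (∀ v ∈ g, ¬ p v) ∧ (∀ v ∈ g, v ∈ w) ∧ f ∈ w := by
  obtain ⟨l₁, f, l₂, rfl, hf, h₁⟩ := exists_first_split p hp
  have hc : List.IsChain G.Adj (t :: (l₁ ++ [f])) := by
    have : t :: (l₁ ++ f :: l₂) = (t :: (l₁ ++ [f])) ++ l₂ := by simp
    rw [this] at h
    exact h.left_of_append
  obtain ⟨g, hg, hgw⟩ := exists_indPath_of_isChain hc (fun e => ht (e ▸ hf))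
  exact ⟨g, f, hg, hf, fun v hv => h₁ v (hgw v hv), fun v hv => by simp [hgw v hv], by simp⟩

theorem exists_first_adj {f : V} {h : List V} (hf : ∃ w ∈ h, G.Adj f w) (hfh : f ∉ h) :
    ∃ l₁ q l₂, h = l₁ ++ q :: l₂ ∧ G.Adj f q ∧ FarL G f l₁ := by
  obtain ⟨l₁, q, l₂, rfl, hq, h₁⟩ := exists_first_split (fun w => G.Adj f w) hf
  exact ⟨l₁, q, l₂, rfl, hq, fun v hv => ⟨fun e => hfh (by simp [e, hv]), h₁ v hv⟩⟩

theorem exists_last_adj {f : V} {h : List V} (hf : ∃ w ∈ h, G.Adj f w) (hfh : f ∉ h) :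
    ∃ l₁ q l₂, h = l₁ ++ q :: l₂ ∧ G.Adj f q ∧ FarL G f l₂ := by
  obtain ⟨l₁, q, l₂, rfl, hq, h₁⟩ := exists_last_split (fun w => G.Adj f w) hf
  exact ⟨l₁, q, l₂, rfl, hq, fun v hv => ⟨fun e => hfh (by simp [e, hv]), h₁ v hv⟩⟩

theorem farL_or_exists_adj {f : V} {h : List V} (hfh : f ∉ h) :
    FarL G f h ∨ ∃ w ∈ h, G.Adj f w := by
  by_cases hf : ∃ w ∈ h, G.Adj f w
  · exact .inr hf
  · exact .inl fun v hv => ⟨fun e => hfh (e ▸ hv), fun e => hf ⟨v, hv, e⟩⟩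

/-! ### Holes as lists -/

/-- The vertices of `l`, in this cyclic order, form a hole. -/
def Cyc (G : SimpleGraph V) (l : List V) : Prop :=
  ∃ u x m y, l = u :: x :: (m ++ [y]) ∧ m ≠ [] ∧ IndPath G (x :: (m ++ [y])) ∧ G.Adj u x ∧
    G.Adj u y ∧ FarL G u m

theorem Cyc.rotate_one {u : V} {l : List V} (h : Cyc G (u :: l)) : Cyc G (l ++ [u]) := by
  obtain ⟨u', x, m, y, he, hm, hp, hx, hy, ha⟩ := h
  obtain ⟨rfl, rfl⟩ := List.cons.inj he
  obtain ⟨z, m', rfl⟩ := List.exists_cons_of_ne_nil hm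
  have hp' : IndPath G (z :: (m' ++ [y])) := hp.2.2
  have h₁ : IndPath G ((z :: m') ++ [y, u]) :=
    IndPath.concat (by simpa using hp') hy.symm ha
  refine ⟨x, z, m' ++ [y], u, by simp, by simp, by simpa using h₁, hp.1, hx.symm, hp.2.1⟩

theorem Cyc.rotate {l₁ l₂ : List V} (h : Cyc G (l₁ ++ l₂)) : Cyc G (l₂ ++ l₁) := by
  induction l₁ generalizing l₂ with
  | nil => simpa using h
  | cons a l₁ ih =>
    have := h.rotate_one
    simpa using ih (l₂ := l₂ ++ [a]) (by simpa using this)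

theorem Cyc.indPath {l₁ l₂ : List V} (h : Cyc G (l₁ ++ l₂)) (h₂ : l₂ ≠ []) : IndPath G l₁ := by
  obtain ⟨w, l₂, rfl⟩ := List.exists_cons_of_ne_nil h₂
  obtain ⟨u, x, m, y, he, hm, hp, -⟩ := h.rotate
  have he' : l₂ ++ l₁ = x :: (m ++ [y]) := by simpa using (List.cons.inj he).2
  rw [← he'] at hp
  exact hp.right

theorem Cyc.of_two_paths {x y : V} {m r : List V} (h₁ : IndPath G (x :: (m ++ [y])))
    (h₂ : IndPath G (y :: (r ++ [x]))) (hm : m ≠ []) (hr : r ≠ []) (h : Anti G m r) :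
    Cyc G (x :: (m ++ y :: r)) := by
  obtain ⟨z, m', rfl⟩ := List.exists_cons_of_ne_nil hm
  rcases List.eq_nil_or_concat r with rfl | ⟨r', w, rfl⟩
  · exact absurd rfl hr
  have h₂' : IndPath G ((y :: r') ++ w :: [x]) := by simpa using h₂
  have h₃ : IndPath G ((y :: r') ++ [w]) := (indPath_append.1 h₂').1
  have hwx : G.Adj w x := (indPath_append.1 h₂').2.1.1
  refine ⟨x, z, m' ++ y :: r', w, by simp, by simp, ?_, h₁.1, hwx.symm, ?_⟩
  · have := IndPath.glue (l₁ := z :: m') (x := y) (l₂ := r' ++ [w]) (by simpa using h₁.tail)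
      (by simpa using h₃) (h.mono (by simp) (by simp))
    simpa using this
  · intro v hv
    rcases List.mem_append.1 hv with hv | hv
    · exact h₁.2.1 v (by simp [hv])
    · have := h₂'.anti v hv x (by simp)
      exact ⟨this.1.symm, fun e => this.2 e.symm⟩

/-- `G` has no odd hole. -/
def OddHoleFree (G : SimpleGraph V) : Prop := ∀ l, Cyc G l → Even l.length

/-- The two paths close up to a hole with `m.length + r.length + 2` vertices. -/
theorem OddHoleFree.even {x y : V} {m r : List V} (hG : OddHoleFree G)
    (h₁ : IndPath G (x :: (m ++ [y]))) (h₂ : IndPath G (x :: (r ++ [y]))) (hm : m ≠ [])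
    (hr : r ≠ []) (h : Anti G m r) : Even (m.length + r.length) := by
  have := hG _ (Cyc.of_two_paths h₁ h₂.reverse_mid hm (by simpa using hr)
    (h.mono (fun _ h => h) (fun _ h => by simpa using h)))
  simp at this
  grind

/-- Adding `u` to the path gives a hole with `m.length + 3` vertices. -/
theorem OddHoleFree.odd {x y u : V} {m : List V} (hG : OddHoleFree G)
    (h₁ : IndPath G (x :: (m ++ [y]))) (hm : m ≠ []) (hx : G.Adj u x) (hy : G.Adj u y)
    (h : FarL G u m) : Odd m.length := by
  have := hG _ ⟨u, x, m, y, rfl, hm, h₁, hx, hy, h⟩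
  simp at this
  grind

/-! ### Counting edges inside a set along a list -/

open Classical in
/-- The number of consecutive pairs of `l` with both members in `S`. -/
noncomputable def EC (S : Set V) : List V → ℕ
  | [] => 0
  | [_] => 0
  | a :: b :: l => (if a ∈ S ∧ b ∈ S then 1 else 0) + EC S (b :: l)

@[simp] theorem EC_nil (S : Set V) : EC S [] = 0 := rfl

@[simp] theorem EC_singleton (S : Set V) (a : V) : EC S [a] = 0 := rfl

open Classical in
theorem EC_cons_cons (S : Set V) (a b : V) (l : List V) :
    EC S (a :: b :: l) = (if a ∈ S ∧ b ∈ S then 1 else 0) + EC S (b :: l) := rfl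

theorem EC_append (S : Set V) (l₁ : List V) (x : V) (l₂ : List V) :
    EC S (l₁ ++ x :: l₂) = EC S (l₁ ++ [x]) + EC S (x :: l₂) := by
  induction l₁ with
  | nil => simp
  | cons a l₁ ih =>
    cases l₁ with
    | nil => simp [EC_cons_cons]
    | cons b l₁ =>
      simp only [List.cons_append, EC_cons_cons] at ih ⊢
      rw [ih, add_assoc]

theorem EC_reverse (S : Set V) (l : List V) : EC S l.reverse = EC S l := by
  induction l with
  | nil => rfl
  | cons a l ih =>
    cases l with
    | nil => rfl
    | cons b l =>
      simp only [List.reverse_cons, List.append_assoc, List.singleton_append] at ih ⊢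
      rw [EC_append, ih]
      by_cases ha : a ∈ S <;> by_cases hb : b ∈ S <;> simp [EC_cons_cons, ha, hb, add_comm]

theorem EC_eq_zero {S : Set V} {l : List V} (h : ∀ v ∈ l, v ∉ S) : EC S l = 0 := by
  induction l with
  | nil => rfl
  | cons a l ih =>
    cases l with
    | nil => rfl
    | cons b l => rw [EC_cons_cons, ih (by grind)]; simp [h a (by simp)]

theorem EC_cons_of_notMem {S : Set V} {a : V} {l : List V} (h : a ∉ S) :
    EC S (a :: l) = EC S l := by
  cases l with
  | nil => rfl
  | cons b l => rw [EC_cons_cons]; simp [h]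

theorem EC_pos {S : Set V} {l : List V} (h : EC S l ≠ 0) :
    ∃ l₁ p q l₂, l = l₁ ++ p :: q :: l₂ ∧ p ∈ S ∧ q ∈ S := by
  induction l with
  | nil => simp at h
  | cons a l ih =>
    cases l with
    | nil => simp at h
    | cons b l =>
      by_cases hab : a ∈ S ∧ b ∈ S
      · exact ⟨[], a, b, l, rfl, hab.1, hab.2⟩
      · rw [EC_cons_cons] at h
        obtain ⟨l₁, p, q, l₂, e, h₁⟩ := ih (by simpa [hab] using h)
        exact ⟨a :: l₁, p, q, l₂, by simp [e], h₁⟩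

/-- Cut `l` at the vertices with property `P` and add up. The hypothesis records where a segment
sits inside `l`, so that chordlessness of the whole list, and whether the segment touches an end of
it, can be used for each piece. -/
theorem even_of_segments {P : V → Prop} {f : List V → ℕ}
    (hf : ∀ l₁ x l₂, f (l₁ ++ x :: l₂) = f (l₁ ++ [x]) + f (x :: l₂)) {l : List V} {y : V} (hy : P y)
    (hseg : ∀ pre p s q post, l = pre ++ p :: (s ++ q :: post) → P p → P q → (∀ v ∈ s, ¬ P v) →
      Even (f (p :: (s ++ [q])))) (n : ℕ) :
    ∀ (pre : List V) (x : V) (m : List V), m.length = n → P x → l = pre ++ x :: (m ++ [y]) →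
      Even (f (x :: (m ++ [y]))) := by
  induction n using Nat.strong_induction_on with
  | _ n ih =>
    intro pre x m hm hx hl
    by_cases h : ∃ z ∈ m, P z
    · obtain ⟨m₁, z, m₂, rfl, hz, h₁⟩ := exists_first_split P h
      have e : x :: ((m₁ ++ z :: m₂) ++ [y]) = (x :: m₁) ++ z :: (m₂ ++ [y]) := by simp
      rw [e, hf]
      refine Even.add ?_ (ih m₂.length (by simp at hm; omega) (pre ++ x :: m₁) z m₂ rfl hz
        (by simp [hl]))
      exact hseg pre x m₁ z (m₂ ++ [y]) (by simp [hl]) hx hz h₁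
    · exact hseg pre x m y [] hl hx hy (by simpa using h)

/-- If all nonempty segments between consecutive vertices of `S` have an odd number of interior
vertices, then the parity of the length of the path is that of the number of `S`-edges. -/
theorem EC_parity {S : Set V} {x y : V} {m : List V} (hx : x ∈ S) (hy : y ∈ S)
    (hseg : ∀ pre p s q post, x :: (m ++ [y]) = pre ++ p :: (s ++ q :: post) → p ∈ S → q ∈ S →
      (∀ v ∈ s, v ∉ S) → s ≠ [] → Odd s.length) :
    Even (EC S (x :: (m ++ [y])) + (m.length + 1)) := by
  have := even_of_segments (P := (· ∈ S)) (f := fun l => EC S l + (l.length - 1))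
    (l := x :: (m ++ [y])) (y := y)
    (by intro l₁ x l₂; simp only [EC_append S l₁ x l₂]; simp; omega) hy
    (by
      intro pre p s q post e hp hq hs
      by_cases h0 : s = []
      · subst h0
        simp [EC_cons_cons, hp, hq]
      · have := hseg pre p s q post e hp hq hs h0
        have h1 : EC S (p :: (s ++ [q])) = 0 := by
          obtain ⟨c, s', rfl⟩ := List.exists_cons_of_ne_nil h0
          rw [List.cons_append, EC_cons_cons, EC_cons_of_notMem (hs c (by simp))]
          rcases List.eq_nil_or_concat s' with rfl | ⟨s'', d, rfl⟩
          · simp [hs c]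
          · have : s'' ++ [d] ++ [q] = s'' ++ d :: [q] := by simp
            have hd : d ∉ S := hs d (by simp)
            simp only [List.concat_eq_append] at hs ⊢
            rw [this, EC_append, EC_eq_zero (fun v hv => hs v (by simp at hv ⊢; tauto)), EC_cons_cons]
            simp [hs c, hd]
        rw [h1]
        simp
        grind)
    m.length [] x m rfl hx rfl
  simpa using this

/-- The set of neighbours of `t` is crossed by a path with the parity of its length. -/
theorem OddHoleFree.EC_neighborSet_parity {x y t : V} {m : List V} (hG : OddHoleFree G)
    (h : IndPath G (x :: (m ++ [y]))) (hx : G.Adj t x) (hy : G.Adj t y) (ht : t ∉ m) :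
    Even (EC (G.neighborSet t) (x :: (m ++ [y])) + (m.length + 1)) := by
  refine EC_parity hx hy ?_
  intro pre p s q post e hp hq hs h0
  rw [e] at h
  have h1 : IndPath G (p :: (s ++ q :: post)) := h.right
  have h2 : IndPath G (p :: (s ++ [q])) :=
    IndPath.left (l₂ := post) (by simpa using h1)
  refine hG.odd h2 h0 hp hq fun w hw => ⟨?_, hs w hw⟩
  rintro rfl
  have hmem : t ∈ x :: (m ++ [y]) := by rw [e]; simp [hw]
  simp only [List.mem_cons, List.mem_append, List.not_mem_nil, or_false] at hmem
  rcases hmem with rfl | h' | rfl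
  · exact G.loopless.irrefl _ hx
  · exact ht h'
  · exact G.loopless.irrefl _ hy

end ArtemisGraph

/-! ### Pyramids, prisms and hats -/

namespace ArtemisGraph
open SimpleGraph

variable {V : Type*} {G : SimpleGraph V}

/-- The only edge between the two lists is that between their heads. -/
def HeadCross (G : SimpleGraph V) (b₁ : V) (n₁ : List V) (b₂ : V) (n₂ : List V) : Prop :=
  G.Adj b₁ b₂ ∧ FarL G b₁ n₂ ∧ FarL G b₂ n₁ ∧ Anti G n₁ n₂

theorem HeadCross.symm {b₁ b₂ : V} {n₁ n₂ : List V} (h : HeadCross G b₁ n₁ b₂ n₂) :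
    HeadCross G b₂ n₂ b₁ n₁ := ⟨h.1.symm, h.2.2.1, h.2.1, h.2.2.2.symm⟩

/-- The two paths and the edge `b₁ b₂` form a hole with `n₁.length + n₂.length + 3` vertices; the
last hypothesis excludes the triangle `b₁ b₂ u`. -/
theorem OddHoleFree.odd_add_of_triangle (hG : OddHoleFree G) {u b₁ b₂ : V} {n₁ n₂ : List V}
    (h₁ : IndPath G (b₁ :: (n₁ ++ [u]))) (h₂ : IndPath G (b₂ :: (n₂ ++ [u])))
    (h : HeadCross G b₁ n₁ b₂ n₂) (hn : n₁ ≠ [] ∨ n₂ ≠ []) : Odd (n₁.length + n₂.length) := by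
  have key : ∀ {b₁ b₂ : V} {n₁ n₂ : List V}, IndPath G (b₁ :: (n₁ ++ [u])) →
      IndPath G (b₂ :: (n₂ ++ [u])) → HeadCross G b₁ n₁ b₂ n₂ →
      n₂ ≠ [] → Odd (n₁.length + n₂.length) := by
    rintro b₁ b₂ n₁ n₂ h₁ h₂ ⟨hb, k₁, k₂, k₃⟩ hn
    obtain ⟨z, n₂, rfl⟩ := List.exists_cons_of_ne_nil hn
    have h₃ : IndPath G (b₂ :: ((b₁ :: n₁) ++ [u])) := by
      have := h₂.2.1
      exact ⟨hb.symm, by simp at this ⊢; tauto, h₁⟩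
    have := hG.even h₂ h₃ (by simp) (by simp) (by grind)
    simp at this ⊢
    grind
  rcases hn with hn | hn
  · have := key h₂ h₁ h.symm hn
    rwa [add_comm]
  · exact key h₁ h₂ h hn

/-- A graph without odd hole contains no pyramid. -/
theorem OddHoleFree.no_pyramid (hG : OddHoleFree G) {u b₁ b₂ b₃ : V} {n₁ n₂ n₃ : List V}
    (h₁ : IndPath G (b₁ :: (n₁ ++ [u]))) (h₂ : IndPath G (b₂ :: (n₂ ++ [u])))
    (h₃ : IndPath G (b₃ :: (n₃ ++ [u])))
    (h₁₂ : HeadCross G b₁ n₁ b₂ n₂) (h₁₃ : HeadCross G b₁ n₁ b₃ n₃) (h₂₃ : HeadCross G b₂ n₂ b₃ n₃)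
    (hn₁₂ : n₁ ≠ [] ∨ n₂ ≠ []) (hn₁₃ : n₁ ≠ [] ∨ n₃ ≠ []) (hn₂₃ : n₂ ≠ [] ∨ n₃ ≠ []) : False := by
  have e₁ := hG.odd_add_of_triangle h₁ h₂ h₁₂ hn₁₂
  have e₂ := hG.odd_add_of_triangle h₁ h₃ h₁₃ hn₁₃
  have e₃ := hG.odd_add_of_triangle h₂ h₃ h₂₃ hn₂₃
  grind

/-- The edges between the two lists `a₁ m₁ b₁` and `a₂ m₂ b₂` are `a₁ a₂` and `b₁ b₂`. -/
def Cross (G : SimpleGraph V) (a₁ : V) (m₁ : List V) (b₁ a₂ : V) (m₂ : List V) (b₂ : V) : Prop :=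
  G.Adj a₁ a₂ ∧ G.Adj b₁ b₂ ∧ Far G a₁ b₂ ∧ FarL G a₁ m₂ ∧ Far G b₁ a₂ ∧ FarL G b₁ m₂ ∧
    FarL G a₂ m₁ ∧ FarL G b₂ m₁ ∧ Anti G m₁ m₂

theorem Cross.symm {a₁ b₁ a₂ b₂ : V} {m₁ m₂ : List V} (h : Cross G a₁ m₁ b₁ a₂ m₂ b₂) :
    Cross G a₂ m₂ b₂ a₁ m₁ b₁ := by
  obtain ⟨h₁, h₂, h₃, h₄, h₅, h₆, h₇, h₈, h₉⟩ := h
  exact ⟨h₁.symm, h₂.symm, h₅.symm, h₇, h₃.symm, h₈, h₄, h₆, h₉.symm⟩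

theorem Cross.flip {a₁ b₁ a₂ b₂ : V} {m₁ m₂ : List V} (h : Cross G a₁ m₁ b₁ a₂ m₂ b₂) :
    Cross G b₁ m₁.reverse a₁ b₂ m₂.reverse a₂ := by
  obtain ⟨h₁, h₂, h₃, h₄, h₅, h₆, h₇, h₈, h₉⟩ := h
  refine ⟨h₂, h₁, h₅, ?_, h₃, ?_, ?_, ?_, ?_⟩ <;> simpa

/-- The three lists `aᵢ mᵢ bᵢ` form a prism. -/
structure PrismL (G : SimpleGraph V) (a₁ : V) (m₁ : List V) (b₁ a₂ : V) (m₂ : List V) (b₂ a₃ : V)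
    (m₃ : List V) (b₃ : V) : Prop where
  p₁ : IndPath G (a₁ :: (m₁ ++ [b₁]))
  p₂ : IndPath G (a₂ :: (m₂ ++ [b₂]))
  p₃ : IndPath G (a₃ :: (m₃ ++ [b₃]))
  h₁₂ : Cross G a₁ m₁ b₁ a₂ m₂ b₂
  h₁₃ : Cross G a₁ m₁ b₁ a₃ m₃ b₃
  h₂₃ : Cross G a₂ m₂ b₂ a₃ m₃ b₃

/-- `G` has no prism. -/
def PrismFree (G : SimpleGraph V) : Prop :=
  ∀ a₁ m₁ b₁ a₂ m₂ b₂ a₃ m₃ b₃, ¬ PrismL G a₁ m₁ b₁ a₂ m₂ b₂ a₃ m₃ b₃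

/-- `c, h, c'` is a hole whose edge `c c'` forms a triangle with `t`, and `t` has no other neighbour
on the hole. -/
structure Hat (G : SimpleGraph V) (c : V) (h : List V) (c' t : V) : Prop where
  left : IndPath G (c :: h)
  right : IndPath G (h ++ [c'])
  adj : G.Adj c c'
  len : 2 ≤ h.length
  adj_left : G.Adj t c
  adj_right : G.Adj t c'
  miss : FarL G t h

/-- The path from `t` reaches the hole at `f`, away from `c` and `c'`. If `f` has one neighbour on
`h`, that neighbour is the apex of a pyramid over the triangle `c c' t`; if it has exactly two and
they are adjacent, there is a prism; otherwise `f` itself is the apex of a pyramid. -/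
theorem Hat.false_of_path {c c' t f : V} {h g : List V} (hh : Hat G c h c' t)
    (hG : OddHoleFree G) (hP : PrismFree G) (hg : IndPath G (t :: (g ++ [f])))
    (hc : FarL G c (g ++ [f])) (hc' : FarL G c' (g ++ [f]))
    (hgh : Anti G g h) (hfh : f ∉ h) (hf : ∃ w ∈ h, G.Adj f w) :
    False := by
  obtain ⟨h₁, h₂, hcc, hlen, htc, htc', hth⟩ := hh
  obtain ⟨l₁, q, l₂, rfl, hq, hl₁⟩ := exists_first_adj hf hfh
  obtain ⟨x₁, x₂, x₃⟩ := indPath_append.1 (show IndPath G ((c :: l₁) ++ q :: l₂) from h₁)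
  obtain ⟨y₁, y₂, y₃⟩ := indPath_append.1
    (show IndPath G (l₁ ++ q :: (l₂ ++ [c'])) by simpa using h₂)
  by_cases hex : ∃ w ∈ l₂, G.Adj f w
  · obtain ⟨l₃, q', l₄, rfl, hq', hl₄⟩ := exists_last_adj hex (by simp at hfh; simp [hfh])
    obtain ⟨z₁, z₂, z₃⟩ := indPath_append.1
      (show IndPath G ((q :: l₃) ++ q' :: (l₄ ++ [c'])) by simpa using y₂)
    have z₂' := z₂.reverse_mid
    clear h₁ h₂ hlen hf hex
    by_cases h0 : l₃ = []
    · subst h0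
      have hqq : G.Adj q q' := indPath_pair.1 z₁
      refine hP c l₁ q c' l₄.reverse q' t g f ⟨by simpa using x₁, by simpa using z₂', hg, ?_, ?_, ?_⟩
      · clear hG hP; simp [Cross] at *; grind [adj_comm]
      · clear hG hP; simp [Cross] at *; grind [adj_comm]
      · clear hG hP; simp [Cross] at *; grind [adj_comm]
    · refine hG.no_pyramid (u := f) (b₁ := c) (b₂ := c') (b₃ := t) (n₁ := l₁ ++ [q])
        (n₂ := l₄.reverse ++ [q']) (n₃ := g) ?_ ?_ hg ?_ ?_ ?_ (by simp) (by simp) (by simp)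
      · have := IndPath.concat (l := c :: l₁) (by simpa using x₁) hq.symm (by grind)
        simpa using this
      · have := IndPath.concat (l := c' :: l₄.reverse) (by simpa using z₂') hq'.symm (by grind)
        simpa using this
      · have := IndPath.far_ends (by simpa using z₁) h0
        clear hG hP; simp [HeadCross] at *; grind [adj_comm]
      · clear hG hP; simp [HeadCross] at *; grind [adj_comm]
      · clear hG hP; simp [HeadCross] at *; grind [adj_comm]
  · push Not at hex
    refine hG.no_pyramid (u := q) (b₁ := c) (b₂ := c') (b₃ := t) (n₁ := l₁)
        (n₂ := l₂.reverse) (n₃ := g ++ [f]) (by simpa using x₁) (by simpa using y₂.reverse_mid) ?_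
        ?_ ?_ ?_ ?_ (by simp) (by simp)
    · have := IndPath.concat (l := t :: g) (by simpa using hg) hq (by grind)
      simpa using this
    · have : FarL G f l₂ := fun v hv => ⟨fun e => hfh (by simp [e, hv]), hex v hv⟩
      clear hG hP; simp [HeadCross] at *; grind [adj_comm]
    · have : FarL G f l₂ := fun v hv => ⟨fun e => hfh (by simp [e, hv]), hex v hv⟩
      clear hG hP; simp [HeadCross] at *; grind [adj_comm]
    · have : FarL G f l₂ := fun v hv => ⟨fun e => hfh (by simp [e, hv]), hex v hv⟩
      clear hG hP; simp [HeadCross] at *; grind [adj_comm]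
    · cases l₁ <;> cases l₂ <;> simp at hlen ⊢

theorem IndPath.exists_adj_of_mem {l : List V} (h : IndPath G l) (hl : 2 ≤ l.length) {v : V}
    (hv : v ∈ l) : ∃ w ∈ l, G.Adj v w := by
  obtain ⟨l₁, l₂, rfl⟩ := List.append_of_mem hv
  cases l₂ with
  | cons w l₂ => exact ⟨w, by simp, (indPath_append.1 h).2.1.1⟩
  | nil =>
    rcases List.eq_nil_or_concat l₁ with rfl | ⟨l₃, w, rfl⟩
    · simp at hl
    · have h' : IndPath G (l₃ ++ w :: [v]) := by simpa using h
      exact ⟨w, by simp, (indPath_append.1 h').2.1.1.symm⟩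

/-- Stop the chain at its first vertex `f` with a neighbour in `h` and shorten it. Earlier vertices
are not on `h`, since every vertex of `h` has a neighbour in `h`, and neither is `f`, since its
predecessor would have a neighbour in `h`. -/
theorem Hat.false_of_chain {c c' t : V} {h w : List V} (hh : Hat G c h c' t)
    (hG : OddHoleFree G) (hP : PrismFree G) (hw : List.IsChain G.Adj (t :: w))
    (hc : FarL G c w) (hc' : FarL G c' w) (hf : ∃ v ∈ w, ∃ x ∈ h, G.Adj v x) : False := by
  obtain ⟨g, f, hg, hpf, hgp, hgw, hfw⟩ := exists_indPath_first (fun v => ∃ x ∈ h, G.Adj v x)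
    (by rintro ⟨x, hx, hx'⟩; exact (hh.miss x hx).2 hx') hw hf
  have hgh : Anti G g h := by
    intro v hv x hx
    refine ⟨?_, fun e => hgp v hv ⟨x, hx, e⟩⟩
    rintro rfl
    obtain ⟨y, hy, hvy⟩ := hh.left.tail.exists_adj_of_mem hh.len hx
    exact hgp v hv ⟨y, hy, hvy⟩
  have hfh : f ∉ h := by
    intro hf
    rcases List.eq_nil_or_concat g with rfl | ⟨g', x, rfl⟩
    · exact (hh.miss f hf).2 (indPath_pair.1 hg)
    · have h' : IndPath G ((t :: g') ++ x :: [f]) := by simpa using hg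
      exact hgp x (by simp) ⟨f, hf, (indPath_append.1 h').2.1.1⟩
  refine hh.false_of_path hG hP hg (hc.mono ?_) (hc'.mono ?_) hgh hfh hpf
  · intro x hx; simp at hx; grind
  · intro x hx; simp at hx; grind

end ArtemisGraph

/-! ### Edge parities for a stable set, and leaps -/

namespace ArtemisGraph
open SimpleGraph

variable {V : Type*} {G : SimpleGraph V}

/-- The vertices adjacent to all members of `X`. -/
def Comp (G : SimpleGraph V) (X : Set V) : Set V := {v | ∀ t ∈ X, G.Adj t v}

theorem mem_comp {X : Set V} {v : V} : v ∈ Comp G X ↔ ∀ t ∈ X, G.Adj t v := Iff.rfl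

theorem EC_mid_eq_zero {S : Set V} {p q : V} {s : List V} (h0 : s ≠ []) (hs : ∀ v ∈ s, v ∉ S) :
    EC S (p :: (s ++ [q])) = 0 := by
  by_contra h
  obtain ⟨l₁, a, b, l₂, e, ha, hb⟩ := EC_pos h
  have hlen := congrArg List.length e
  rcases cons_eq_split e with ⟨rfl, rfl, e'⟩ | ⟨l₃, rfl, e'⟩
  · obtain ⟨c, s, rfl⟩ := List.exists_cons_of_ne_nil h0
    simp at e'
    exact hs c (by simp) (e'.1 ▸ hb)
  · rcases concat_eq_split e' with ⟨_, h, _⟩ | ⟨l₄, _, rfl⟩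
    · simp at h
    · exact hs a (by simp) ha

section Stable

-- An edge of the path with `N` as its set of common neighbours in `T` is counted in the sum once
-- for each nonempty subset of `N`, that is, `2 ^ N.card - 1` times, which is odd unless `N` is
-- empty. By hypothesis `N` is empty exactly when the edge does not count in the first term.
open Classical in
theorem EC_union_parity (T : Finset V) {l : List V}
    (h : ∀ l₁ p q l₂, l = l₁ ++ p :: q :: l₂ → (∃ t ∈ T, G.Adj t p) → (∃ t ∈ T, G.Adj t q) →
      ∃ t ∈ T, G.Adj t p ∧ G.Adj t q) :
    Even (EC {v | ∃ t ∈ T, G.Adj t v} l + ∑ X ∈ T.powerset.erase ∅, EC (Comp G (X : Set V)) l) := by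
  induction l with
  | nil => simp
  | cons a l ih =>
    cases l with
    | nil => simp
    | cons b l =>
      have ih' := ih (fun l₁ p q l₂ e => h (a :: l₁) p q l₂ (by simp [e]))
      generalize hS : {v | ∃ t ∈ T, G.Adj t v} = S at *
      have hmem : ∀ v, v ∈ S ↔ ∃ t ∈ T, G.Adj t v := by simp [← hS]
      simp only [EC_cons_cons, Finset.sum_add_distrib]
      set N := T.filter (fun t => G.Adj t a ∧ G.Adj t b) with hN
      have h1 : ∑ X ∈ T.powerset.erase ∅,
          (if a ∈ Comp G (X : Set V) ∧ b ∈ Comp G (X : Set V) then 1 else 0) = 2 ^ N.card - 1 := by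
        rw [← Finset.card_filter]
        have : (T.powerset.erase ∅).filter
            (fun X : Finset V => a ∈ Comp G (X : Set V) ∧ b ∈ Comp G (X : Set V)) = N.powerset.erase ∅ := by
          ext X
          simp only [Finset.mem_filter, Finset.mem_erase, Finset.mem_powerset, hN, mem_comp, Finset.mem_coe, Finset.subset_iff]
          grind
        rw [this, Finset.card_erase_of_mem (by simp), Finset.card_powerset]
      rw [h1]
      have h2 : (if a ∈ S ∧ b ∈ S then 1 else 0)
          = if N.card = 0 then 0 else 1 := by
        have := h [] a b l rfl
        simp only [hmem, Finset.card_eq_zero]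
        by_cases hc : ∃ t ∈ T, G.Adj t a ∧ G.Adj t b
        · obtain ⟨t, ht, hta, htb⟩ := hc
          have : N ≠ ∅ := by
            rw [← Finset.nonempty_iff_ne_empty]; exact ⟨t, by simp [hN, ht, hta, htb]⟩
          rw [if_neg this, if_pos ⟨⟨t, ht, hta⟩, ⟨t, ht, htb⟩⟩]
        · have h3 : N = ∅ := by
            rw [hN, Finset.filter_eq_empty_iff]; intro t ht h; exact hc ⟨t, ht, h⟩
          rw [if_pos h3, if_neg]
          rintro ⟨h1, h2⟩; exact hc (this h1 h2)
      rw [h2]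
      have h3 : Even ((if N.card = 0 then 0 else 1) + (2 ^ N.card - 1)) := by
        by_cases h0 : N.card = 0
        · simp [h0]
        · obtain ⟨k, hk⟩ := Nat.exists_eq_succ_of_ne_zero h0
          rw [if_neg h0, hk, pow_succ]
          have := Nat.one_le_two_pow (n := k)
          exact ⟨2 ^ k, by omega⟩
      have e : ∀ a b c d : ℕ, a + b + (c + d) = (a + c) + (b + d) := by intros; omega
      rw [e]
      exact h3.add ih'

open Classical in
/-- Two vertices `t`, `t'` of a stable set `T` form a leap: each of them sees exactly one end of the
interior of a path all of whose other interior vertices miss `T`. -/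
theorem OddHoleFree.exists_leap (hG : OddHoleFree G) {T : Finset V} (hT : 2 ≤ T.card)
    (hst : ∀ u ∈ T, ∀ v ∈ T, ¬ G.Adj u v) {x y : V} {m : List V} (h₁ : IndPath G (x :: m))
    (h₂ : IndPath G (m ++ [y])) (hm0 : m ≠ []) (hm : Even m.length) (hdisj : ∀ v ∈ m, v ∉ T)
    (hx : ∀ t ∈ T, G.Adj t x) (hy : ∀ t ∈ T, G.Adj t y) (hno : ∀ v ∈ m, ∃ t ∈ T, ¬ G.Adj t v)
    (hodd : ∀ X ⊂ T, X.Nonempty → Odd (EC (Comp G (X : Set V)) (x :: (m ++ [y])))) :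
    ∃ p s q t t', m = p :: (s ++ [q]) ∧ t ∈ T ∧ t' ∈ T ∧ G.Adj t p ∧ G.Adj t' q ∧
      (∀ u ∈ T, ¬ (G.Adj u p ∧ G.Adj u q)) ∧ ∀ u ∈ T, FarL G u s := by
  by_contra hleap
  set S : Set V := {v | ∃ t ∈ T, G.Adj t v} with hS
  obtain ⟨t₀, ht₀⟩ : T.Nonempty := by rw [← Finset.card_pos]; omega
  have hxS : x ∈ S := ⟨t₀, ht₀, hx _ ht₀⟩
  have hyS : y ∈ S := ⟨t₀, ht₀, hy _ ht₀⟩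
  have hFar : ∀ u ∈ T, ∀ s : List V, (∀ v ∈ s, v ∈ m) → (∀ v ∈ s, v ∉ S) → FarL G u s :=
    fun u hu s hsm hs v hv => ⟨fun e => hdisj v (hsm v hv) (e ▸ hu), fun e => hs v hv ⟨u, hu, e⟩⟩
  -- If both alternatives fail, take `t` seeing `p` and `t'` seeing `q`. Then `t, p, s, q, t'` is
  -- chordless with an even number of interior vertices, and an end `x` or `y` that misses `p, s, q`
  -- closes it to an odd hole. Neither end does only if `p, s, q` is all of `m`, which is a leap.
  have claim : ∀ pre p s q post, x :: (m ++ [y]) = pre ++ p :: (s ++ q :: post) → p ∈ S → q ∈ S →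
      (∀ v ∈ s, v ∉ S) → (∃ t ∈ T, G.Adj t p ∧ G.Adj t q) ∨ Odd s.length := by
    rintro pre p s q post e ⟨t, ht, htp⟩ ⟨t', ht', htq⟩ hs
    by_contra! hcon
    obtain ⟨hcon, hso⟩ := hcon
    rcases cons_eq_split e with ⟨rfl, rfl, e'⟩ | ⟨pre', rfl, e'⟩
    · exact hcon t' ht' (hx _ ht') htq
    have e'' : m ++ [y] = (pre' ++ p :: s) ++ q :: post := by simp [e']
    rcases concat_eq_split e'' with ⟨rfl, -, -⟩ | ⟨post', rfl, rfl⟩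
    · exact hcon t ht htp (hy _ ht)
    have htq' : Far G t q := ⟨fun e => hdisj q (by simp) (e ▸ ht), hcon t ht htp⟩
    have htp' : Far G t' p := ⟨fun e => hdisj p (by simp) (e ▸ ht'), fun e => hcon t' ht' e htq⟩
    have htt : Far G t t' := ⟨fun e => htp'.2 (e ▸ htp), hst t ht t' ht'⟩
    have hts := hFar t ht s (by simp +contextual) hs
    have hts' := hFar t' ht' s (by simp +contextual) hs
    have hp : IndPath G (p :: (s ++ [q])) := by
      have : IndPath G (pre' ++ (p :: (s ++ [q])) ++ post') := by simpa using h₁.tail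
      exact this.left.right
    have hP : IndPath G (t :: ((p :: (s ++ [q])) ++ [t'])) := by
      have := IndPath.concat (l := t :: p :: s) (x := q) (y := t')
        (show IndPath G (t :: p :: (s ++ [q])) from ⟨htp, by simp; tauto, hp⟩) htq.symm
        (by simp; exact ⟨htt.symm, htp', hts'⟩)
      simpa using this
    have hend : ∀ z, (∀ t ∈ T, G.Adj t z) → FarL G z (p :: (s ++ [q])) → False := by
      intro z hz hzf
      have := hG.odd hP (by simp) (hz _ ht).symm (hz _ ht').symm hzf
      simp at this
      grind
    rcases List.eq_nil_or_concat post' with rfl | ⟨post'', c, rfl⟩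
    · cases pre' with
      | nil =>
        exact hleap ⟨p, s, q, t, t', by simp, ht, ht', htp, htq, fun u hu h => hcon u hu h.1 h.2,
          fun u hu => hFar u hu s (by simp +contextual) hs⟩
      | cons c pre' =>
        refine hend x hx ?_
        have := h₁.2.1
        simp at this ⊢
        tauto
    · refine hend y hy ?_
      have : IndPath G ((pre' ++ p :: (s ++ q :: post'')) ++ c :: [y]) := by simpa using h₂
      have := this.anti
      simp at this ⊢
      tauto
  -- Every nonempty gap between consecutive vertices of `S` is odd, also when a common neighbour
  -- exists, so the number of `S`-edges has the parity of `m.length + 1`.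
  have hEC : Odd (EC S (x :: (m ++ [y]))) := by
    have := EC_parity hxS hyS (m := m) (by
      intro pre p s q post e hp hq hs hs0
      rcases claim pre p s q post e hp hq hs with ⟨t, ht, htp, htq⟩ | h
      · have hsm : (∀ v ∈ s, v ∈ m) ∧ IndPath G (p :: (s ++ [q])) := by
          rcases cons_eq_split e with ⟨rfl, rfl, e'⟩ | ⟨pre', rfl, e'⟩
          · rcases concat_eq_split e' with ⟨rfl, rfl, rfl⟩ | ⟨post', rfl, rfl⟩
            -- Here `m` misses `T`. Since `x` and `y` may be adjacent, no hole is at hand, but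
            -- `hodd` fails for `{t}`.
            · exfalso
              have := hodd {t} (Finset.ssubset_iff_subset_ne.2 ⟨by simpa using ht, by
                rintro rfl; simp at hT⟩) (by simp)
              rw [EC_mid_eq_zero hm0] at this
              · simp at this
              · intro v hv h
                exact hs v hv ⟨t, ht, by simpa [Comp] using h⟩
            · refine ⟨by simp +contextual, ?_⟩
              have : IndPath G ((p :: (s ++ [q])) ++ post') := by simpa using h₁
              exact this.left
          · have e'' : m ++ [y] = (pre' ++ p :: s) ++ q :: post := by simp [e']
            rcases concat_eq_split e'' with ⟨rfl, rfl, rfl⟩ | ⟨post', rfl, rfl⟩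
            · refine ⟨by simp +contextual, ?_⟩
              have : IndPath G (pre' ++ (p :: (s ++ [q]))) := by simpa using h₂
              exact this.right
            · refine ⟨by simp +contextual, ?_⟩
              have : IndPath G (pre' ++ (p :: (s ++ [q])) ++ post') := by simpa using h₁.tail
              exact this.left.right
        exact hG.odd hsm.2 hs0 htp htq (hFar t ht s hsm.1 hs)
      · exact h)
    grind
  have hpar := EC_union_parity (G := G) T (l := x :: (m ++ [y])) (by
    intro l₁ p q l₂ e hp hq
    rcases claim l₁ p [] q l₂ (by simpa using e) hp hq (by simp) with h | h
    · exact h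
    · simp at h)
  -- The term of `T` itself vanishes by `hno`; the other `2 ^ T.card - 2` terms are odd.
  have hsum : Even (∑ X ∈ T.powerset.erase ∅, EC (Comp G (X : Set V)) (x :: (m ++ [y]))) := by
    have hTm : T ∈ T.powerset.erase ∅ := by
      simp only [Finset.mem_erase, Finset.mem_powerset, subset_refl, and_true]
      rintro rfl; simp at hT
    rw [← Finset.add_sum_erase _ _ hTm, EC_mid_eq_zero hm0 (by
      intro v hv h
      obtain ⟨t, ht, htv⟩ := hno v hv
      exact htv (h t ht)), zero_add, Finset.even_sum_iff_even_card_odd,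
      Finset.filter_true_of_mem]
    · rw [Finset.card_erase_of_mem hTm, Finset.card_erase_of_mem (by simp), Finset.card_powerset]
      obtain ⟨k, hk⟩ : ∃ k, T.card = k + 1 := ⟨T.card - 1, by omega⟩
      rw [hk, pow_succ]
      have := Nat.one_le_two_pow (n := k)
      exact ⟨2 ^ k - 1, by omega⟩
    · intro X hX
      simp only [Finset.mem_erase, Finset.mem_powerset] at hX
      exact hodd X (Finset.ssubset_iff_subset_ne.2 ⟨hX.2.2, hX.1⟩)
        (Finset.nonempty_iff_ne_empty.2 hX.2.1)
  grind

end Stable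

end ArtemisGraph

namespace ArtemisGraph
open SimpleGraph

variable {V : Type*} {G : SimpleGraph V}

/-! ### Connectivity inside a set -/

/-- `u` and `v` are linked by a walk of `H` inside `S`. -/
def LinkIn (H : SimpleGraph V) (S : Set V) : V → V → Prop :=
  Relation.ReflTransGen (fun x y => H.Adj x y ∧ x ∈ S ∧ y ∈ S)

/-- `H[S]` is connected (or empty). -/
def ConnIn (H : SimpleGraph V) (S : Set V) : Prop := ∀ u ∈ S, ∀ v ∈ S, LinkIn H S u v

theorem LinkIn.mono {H : SimpleGraph V} {S S' : Set V} {u v : V} (h : LinkIn H S u v)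
    (hS : S ⊆ S') : LinkIn H S' u v :=
  Relation.ReflTransGen.mono (fun _ _ h => ⟨h.1, hS h.2.1, hS h.2.2⟩) _ _ h

theorem LinkIn.symm {H : SimpleGraph V} {S : Set V} {u v : V} (h : LinkIn H S u v) :
    LinkIn H S v u := by
  induction h with
  | refl => exact .refl
  | tail _ h ih => exact .head ⟨h.1.symm, h.2.2, h.2.1⟩ ih

theorem LinkIn.exists_chain {H : SimpleGraph V} {S : Set V} {u v : V} (h : LinkIn H S u v)
    (huv : u ≠ v) : ∃ w, List.IsChain H.Adj (u :: (w ++ [v])) ∧ ∀ x ∈ w, x ∈ S := by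
  induction h using Relation.ReflTransGen.head_induction_on with
  | refl => exact absurd rfl huv
  | @head a c hac hcv ih =>
    by_cases hc : c = v
    · exact ⟨[], by simpa [hc] using hac.1, by simp⟩
    · obtain ⟨w, hw, hwS⟩ := ih hc
      exact ⟨c :: w, List.isChain_cons_cons.2 ⟨hac.1, hw⟩, by simpa using ⟨hac.2.2, hwS⟩⟩

theorem LinkIn.exists_indPath {H : SimpleGraph V} {S : Set V} {u v : V} (h : LinkIn H S u v)
    (huv : u ≠ v) : ∃ g, IndPath H (u :: (g ++ [v])) ∧ ∀ x ∈ g, x ∈ S := by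
  obtain ⟨w, hw, hwS⟩ := h.exists_chain huv
  obtain ⟨g, hg, hgw⟩ := exists_indPath_of_isChain hw huv
  exact ⟨g, hg, fun x hx => hwS x (hgw x hx)⟩

theorem LinkIn.of_walk {H : SimpleGraph V} {T S : Set V} {u v : T} (p : (H.induce T).Walk u v)
    (hp : ∀ z ∈ p.support, (z : V) ∈ S) : LinkIn H S u v := by
  induction p with
  | nil => exact .refl
  | cons h p ih =>
    refine .head ⟨h, hp _ (by simp), hp _ (by simp)⟩ (ih fun z hz => hp z (by simp [hz]))

theorem connIn_of_preconnected {H : SimpleGraph V} {T : Set V} (h : (H.induce T).Preconnected) :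
    ConnIn H T := by
  intro u hu v hv
  obtain ⟨p⟩ := h ⟨u, hu⟩ ⟨v, hv⟩
  exact LinkIn.of_walk p fun z _ => z.2

theorem preconnected_of_connIn {H : SimpleGraph V} {T : Set V} (h : ConnIn H T) :
    (H.induce T).Preconnected := by
  rintro ⟨u, hu⟩ ⟨v, hv⟩
  have := h u hu v hv
  induction this using Relation.ReflTransGen.head_induction_on with
  | refl => exact .refl _
  | head hac hcv ih =>
    exact Reachable.trans (Adj.reachable (G := H.induce T) (by simpa using hac.1)) (ih hac.2.2)

/-- A finite connected set that is not a clique has two non-adjacent vertices such that the removal of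
either of them leaves a connected set. -/
theorem ConnIn.exists_far_noncut {H : SimpleGraph V} {T : Finset V} (hT : ConnIn H (T : Set V))
    (h : ∃ u ∈ T, ∃ v ∈ T, Far H u v) :
    ∃ u ∈ T, ∃ v ∈ T, Far H u v ∧ ConnIn H {w | w ∈ T ∧ w ≠ u} ∧ ConnIn H {w | w ∈ T ∧ w ≠ v} := by
  classical
  set Γ := H.induce (T : Set V)
  have hΓ : Γ.Preconnected := preconnected_of_connIn hT
  obtain ⟨u₀, hu₀, v₀, hv₀, h0⟩ := h
  have : Nonempty (T : Set V) := ⟨⟨u₀, hu₀⟩⟩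
  have hfin : Finite (T : Set V) := T.finite_toSet
  -- The ends of a diameter will do: a shortest path from any `w ≠ v` to `u` avoids `v`, because no
  -- vertex is farther from `u` than `v`.
  obtain ⟨⟨u, v⟩, huv⟩ := Finite.exists_max (fun q : ↥(T : Set V) × ↥(T : Set V) => Γ.dist q.1 q.2)
  have h2 : 1 < Γ.dist u v := by
    have h3 := huv (⟨u₀, hu₀⟩, ⟨v₀, hv₀⟩)
    refine lt_of_lt_of_le ?_ h3
    have h4 : Γ.dist ⟨u₀, hu₀⟩ ⟨v₀, hv₀⟩ ≠ 0 := by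
      intro h
      have := (hΓ ⟨u₀, hu₀⟩ ⟨v₀, hv₀⟩).dist_eq_zero_iff.1 h
      exact h0.1 (by simpa using this)
    have h5 : Γ.dist ⟨u₀, hu₀⟩ ⟨v₀, hv₀⟩ ≠ 1 := by
      intro h
      exact h0.2 (by simpa [Γ] using dist_eq_one_iff_adj.1 h)
    show 1 < Γ.dist ⟨u₀, hu₀⟩ ⟨v₀, hv₀⟩
    omega
  have key : ∀ u v : ↥(T : Set V), (∀ w, Γ.dist w u ≤ Γ.dist v u) →
      ConnIn H {w | w ∈ T ∧ w ≠ (v : V)} := by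
    intro u v hmax
    have hu : ∀ w : ↥(T : Set V), w ≠ v → LinkIn H {w | w ∈ T ∧ w ≠ (v : V)} w u := by
      intro w hw
      obtain ⟨p, hp⟩ := (hΓ w u).exists_walk_length_eq_dist
      refine LinkIn.of_walk p fun z hz => ⟨z.2, ?_⟩
      intro e
      have e : z = v := Subtype.ext e
      subst e
      have h6 := congrArg Walk.length (p.take_spec hz)
      rw [Walk.length_append] at h6
      have h7 := Γ.dist_le (p.dropUntil z hz)
      have h8 := hmax w
      have h9 : (p.takeUntil z hz).length = 0 := by omega
      exact hw (Walk.eq_of_length_eq_zero h9)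
    intro a ha b hb
    have h1 := hu ⟨a, ha.1⟩ (fun e => ha.2 (congrArg Subtype.val e))
    have h2 := hu ⟨b, hb.1⟩ (fun e => hb.2 (congrArg Subtype.val e))
    exact h1.trans h2.symm
  refine ⟨u, u.2, v, v.2, ⟨?_, ?_⟩, key v u ?_, key u v ?_⟩
  · intro e
    have e : u = v := Subtype.ext e
    subst e
    simp at h2
  · intro e
    have : Γ.dist u v = 1 := dist_eq_one_iff_adj.2 (by simpa [Γ] using e)
    omega
  · intro w; exact huv (w, v)
  · intro w; rw [Γ.dist_comm, Γ.dist_comm (u := v)]; exact huv (u, w)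

/-! ### Antiholes -/

/-- `G` has no antihole of length at least `5`. -/
def AntiholeFree (G : SimpleGraph V) : Prop := ∀ l, Cyc Gᶜ l → l.length < 5

@[simp] theorem far_compl {u v : V} : Far Gᶜ u v ↔ G.Adj u v := by
  simp only [Far, compl_adj, not_and, not_not]
  exact ⟨fun h => h.2 h.1, fun h => ⟨h.ne, fun _ => h⟩⟩

theorem compl_adj_iff_far {u v : V} : Gᶜ.Adj u v ↔ Far G u v := by simp [Far]

theorem farL_compl {u : V} {l : List V} : FarL Gᶜ u l ↔ ∀ v ∈ l, G.Adj u v := by simp [FarL]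

/-- `u` closes the antipath to an antihole with `m.length + 3` vertices. -/
theorem AntiholeFree.false (hA : AntiholeFree G) {x y u : V} {m : List V}
    (h : IndPath Gᶜ (x :: (m ++ [y]))) (hm : 2 ≤ m.length) (hx : Far G u x) (hy : Far G u y)
    (hu : ∀ v ∈ m, G.Adj u v) : False := by
  have := hA _ ⟨u, x, m, y, rfl, by rintro rfl; simp at hm, h, compl_adj_iff_far.2 hx,
    compl_adj_iff_far.2 hy, farL_compl.2 hu⟩
  simp at this
  omega

/-- If every vertex of the co-connected set `T` sees one of the adjacent vertices `p`, `q`, neither of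
which is complete to `T`, then every vertex complete to `T` sees `p` or `q`. -/
theorem AntiholeFree.exists_antipath (hA : AntiholeFree G) {T : Set V} (hT : ConnIn Gᶜ T) {p q : V}
    (hpT : p ∉ T) (hqT : q ∉ T) (hp : p ∉ Comp G T) (hq : q ∉ Comp G T) (hpq : G.Adj p q)
    (hc : ∀ t ∈ T, G.Adj t p ∨ G.Adj t q) :
    (∃ g, IndPath Gᶜ (p :: (g ++ [q])) ∧ (∀ v ∈ g, v ∈ T) ∧ 2 ≤ g.length) ∧
      ∀ w ∈ Comp G T, ¬ (Far G w p ∧ Far G w q) := by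
  have hfar : ∀ r, r ∉ T → r ∉ Comp G T → ∃ t ∈ T, Gᶜ.Adj r t := by
    intro r hr hr'
    simp only [mem_comp, not_forall] at hr'
    obtain ⟨t, ht, htr⟩ := hr'
    exact ⟨t, ht, (compl_adj_iff_far.2 (show Far G t r from ⟨by rintro rfl; exact hr ht, htr⟩)).symm⟩
  obtain ⟨t, ht, htp⟩ := hfar p hpT hp
  obtain ⟨t', ht', htq⟩ := hfar q hqT hq
  have hlink : LinkIn Gᶜ (T ∪ {p, q}) p q := by
    have h1 : LinkIn Gᶜ (T ∪ {p, q}) t t' := (hT t ht t' ht').mono Set.subset_union_left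
    exact .head (b := t) ⟨htp, by simp, by simp [ht]⟩ (.tail (b := t') h1
      ⟨htq.symm, by simp [ht'], by simp⟩)
  obtain ⟨g, hg, hgT⟩ := hlink.exists_indPath hpq.ne
  have hgT' : ∀ v ∈ g, v ∈ T := by
    intro v hv
    rcases hgT v hv with h | h
    · exact h
    · exfalso
      have := hg.nodup
      simp at this h
      grind
  have hlen : 2 ≤ g.length := by
    rcases g with _ | ⟨a, _ | ⟨b, g⟩⟩
    · simp only [List.nil_append, indPath_pair, compl_adj] at hg
      exact absurd hpq hg.2
    · have h1 := hg.1
      have h2 := hg.2.2.1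
      rw [compl_adj] at h1 h2
      rcases hc a (hgT' a (by simp)) with h | h
      · exact absurd h.symm h1.2
      · exact absurd h h2.2
    · simp
  refine ⟨⟨g, hg, hgT', hlen⟩, fun w hw h => ?_⟩
  exact hA.false hg hlen h.1 h.2 fun v hv => (hw v (hgT' v hv)).symm

end ArtemisGraph

/-! ### Chordless paths between vertices complete to a co-connected set -/

namespace ArtemisGraph
open SimpleGraph

variable {V : Type*} {G : SimpleGraph V}

theorem IndPath.split_of_adj {l : List V} (h : IndPath G l) {a b : V} (ha : a ∈ l) (hb : b ∈ l)
    (hab : G.Adj a b) : ∃ l₁ l₂, l = l₁ ++ a :: b :: l₂ ∨ l = l₁ ++ b :: a :: l₂ := by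
  induction l with
  | nil => simp at ha
  | cons c l ih =>
    have key : ∀ {a b : V}, a = c → b ∈ c :: l → G.Adj a b → ∃ l₂, c :: l = a :: b :: l₂ := by
      rintro a b rfl hb hab
      rcases List.mem_cons.1 hb with rfl | hb
      · exact absurd hab (G.loopless.irrefl _)
      · cases l with
        | nil => simp at hb
        | cons d l =>
          rcases List.mem_cons.1 hb with rfl | hb
          · exact ⟨l, rfl⟩
          · exact absurd hab (h.2.1 b hb).2
    by_cases hac : a = c
    · obtain ⟨l₂, e⟩ := key hac hb hab
      exact ⟨[], l₂, .inl e⟩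
    · by_cases hbc : b = c
      · obtain ⟨l₂, e⟩ := key hbc ha hab.symm
        exact ⟨[], l₂, .inr e⟩
      · obtain ⟨l₁, l₂, e⟩ := ih h.tail (by simpa [hac] using ha) (by simpa [hbc] using hb)
        exact ⟨c :: l₁, l₂, by rcases e with e | e <;> simp [e]⟩

/-- The two ends of a long antipath, whose interior is complete to the ends `x`, `y` of a chordless
path, are not consecutive on this path. -/
theorem AntiholeFree.false_of_consecutive (hA : AntiholeFree G) {x y a b : V} {l₁ l₂ r : List V}
    (h : IndPath G (x :: ((l₁ ++ a :: b :: l₂) ++ [y]))) (hr : IndPath Gᶜ (a :: (r ++ [b])))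
    (hlen : 2 ≤ r.length) (hx : ∀ v ∈ r, G.Adj x v) (hy : ∀ v ∈ r, G.Adj y v) : False := by
  cases l₁ with
  | cons c l₁ =>
    have := h.2.1
    simp at this
    exact hA.false hr hlen this.2.1 this.2.2.1 hx
  | nil =>
    rcases List.eq_nil_or_concat l₂ with rfl | ⟨l₂, c, rfl⟩
    -- The path is `x a b y`. Neither end misses both `a` and `b`, but the antipath can be prolonged
    -- by `y` and then closed by `x`.
    · have h1 := h.1
      have h2 := h.2.1
      have h3 := h.2.2.2.1
      have h4 := h.2.2.2.2.1
      simp at h2 h3 h4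
      have hab : G.Adj a b := h.2.2.1
      have hP : IndPath Gᶜ (y :: ((a :: r) ++ [b])) :=
        ⟨compl_adj_iff_far.2 h3.symm, farL_compl.2 (by
          intro v hv
          rcases List.mem_append.1 hv with hv | hv
          · exact hy v hv
          · simp at hv; subst hv; exact h4.symm), hr⟩
      exact hA.false hP (by simp; omega) h2.2 h2.1 (by simpa using ⟨h1, hx⟩)
    · have h' : IndPath G ((x :: [] ++ a :: b :: l₂) ++ c :: [y]) := by simpa using h
      have := h'.anti
      simp at this
      exact hA.false hr hlen this.2.1 this.2.2.1 hy

/-- For a co-connected set `T`, every chordless path with both ends complete to `T` and with no other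
vertex in `T` or complete to `T` has even length. -/
theorem outer_path_odd [Finite V] (hG : OddHoleFree G) (hP : PrismFree G) (hA : AntiholeFree G)
    (n : ℕ) : ∀ T : Finset V, T.card = n → T.Nonempty → ConnIn Gᶜ (T : Set V) →
    ∀ (x y : V) (m : List V), IndPath G (x :: (m ++ [y])) → x ∈ Comp G (T : Set V) →
      y ∈ Comp G (T : Set V) → (∀ v ∈ m, v ∉ T) → (∀ v ∈ m, v ∉ Comp G (T : Set V)) → m ≠ [] →
      Odd m.length := by
  classical
  induction n using Nat.strong_induction_on with
  | _ n ih =>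
  intro T hcard hne hT x y m hl hx hy hmT hmC hm0
  by_contra hodd
  rw [Nat.not_odd_iff_even] at hodd
  -- By induction, the gaps between consecutive vertices complete to `X` are odd, so the number of
  -- `X`-complete edges has the parity of the length of the path, which is assumed odd.
  have hec : ∀ X : Finset V, X ⊂ T → X.Nonempty → ConnIn Gᶜ (X : Set V) →
      Odd (EC (Comp G (X : Set V)) (x :: (m ++ [y]))) := by
    intro X hX hXne hXc
    have hsub := hX.subset
    have hxT : ∀ v ∈ x :: (m ++ [y]), v ∉ X := by
      intro v hv hvX
      simp only [List.mem_cons, List.mem_append, List.not_mem_nil, or_false] at hv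
      rcases hv with rfl | hv | rfl
      · exact G.loopless.irrefl _ (hx v (hsub hvX))
      · exact hmT v hv (hsub hvX)
      · exact G.loopless.irrefl _ (hy v (hsub hvX))
    have := EC_parity (S := Comp G (X : Set V)) (x := x) (y := y) (m := m)
      (fun t ht => hx t (hsub ht)) (fun t ht => hy t (hsub ht)) (by
        intro pre p s q post e hp hq hs hs0
        have h1 : IndPath G (pre ++ (p :: (s ++ [q])) ++ post) := by
          have h2 := e ▸ hl
          simpa using h2
        refine ih X.card (by rw [← hcard]; exact Finset.card_lt_card hX) X rfl hXne hXc p q s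
          h1.left.right hp hq (fun v hv => hxT v ?_) hs hs0
        rw [e]; simp [hv])
    grind
  -- If `T` is not stable, it has adjacent vertices `u`, `v` such that deleting either one keeps it
  -- co-connected. This provides `a` and `b` on the path that miss only `u`, respectively only `v`,
  -- in `T`, so an antipath of `T` from `u` to `v` extends to `a` and `b`. It leads to an antihole
  -- whether or not `a` and `b` are adjacent.
  by_cases hst : ∃ u ∈ T, ∃ v ∈ T, Far Gᶜ u v
  · obtain ⟨u, hu, v, hv, huv, hcu, hcv⟩ := hT.exists_far_noncut hst
    rw [far_compl] at huv
    have hex : ∀ {u v : V}, u ∈ T → v ∈ T → u ≠ v → ConnIn Gᶜ {w | w ∈ T ∧ w ≠ u} →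
        ∃ a ∈ m, ¬ G.Adj u a ∧ ∀ t ∈ T, t ≠ u → G.Adj t a := by
      intro u v hu hv huv hc
      have e : ((T.erase u : Finset V) : Set V) = {w | w ∈ T ∧ w ≠ u} := by
        ext w; simp [and_comm]
      have h1 := hec (T.erase u) (Finset.erase_ssubset hu) ⟨v, by simp [hv, huv.symm]⟩
        (by rw [e]; exact hc)
      have : ∃ a ∈ m, a ∈ Comp G ((T.erase u : Finset V) : Set V) := by
        by_contra! h
        rw [EC_mid_eq_zero hm0 h] at h1
        simp at h1
      obtain ⟨a, ha, hac⟩ := this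
      have hac' : ∀ t ∈ T, t ≠ u → G.Adj t a := fun t ht htu => hac t (by simp [ht, htu])
      refine ⟨a, ha, fun h => hmC a ha fun t ht => ?_, hac'⟩
      by_cases htu : t = u
      · exact htu ▸ h
      · exact hac' t ht htu
    obtain ⟨a, ha, hua, hac⟩ := hex hu hv huv.ne hcu
    obtain ⟨b, hb, hvb, hbc⟩ := hex hv hu huv.ne' hcv
    obtain ⟨g, hg, hgT⟩ := (hT u hu v hv).exists_indPath huv.ne
    have hg0 : g ≠ [] := by
      rintro rfl
      simp only [List.nil_append, indPath_pair, compl_adj] at hg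
      exact hg.2 huv
    have hgn := hg.nodup
    have hua' : Gᶜ.Adj a u := (compl_adj_iff_far.2 (show Far G u a from
      ⟨by rintro rfl; exact hmT _ ha hu, hua⟩)).symm
    have hvb' : Gᶜ.Adj v b := compl_adj_iff_far.2 (show Far G v b from
      ⟨by rintro rfl; exact hmT _ hb hv, hvb⟩)
    have hga : ∀ t ∈ g ++ [v], G.Adj a t := by
      intro t ht
      have : t ≠ u := by rintro rfl; simp at hgn ht; grind
      refine (hac t ?_ this).symm
      simp at ht
      rcases ht with ht | rfl
      · exact hgT t ht
      · exact hv
    have hgb : ∀ t ∈ u :: g, G.Adj b t := by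
      intro t ht
      have : t ≠ v := by rintro rfl; simp at hgn ht; grind
      refine (hbc t ?_ this).symm
      simp at ht
      rcases ht with rfl | ht
      · exact hu
      · exact hgT t ht
    have hab : a ≠ b := by rintro rfl; exact hua (hbc u hu huv.ne)
    have hglen : 1 ≤ g.length := List.length_pos_iff.2 hg0
    have h1 : IndPath Gᶜ (a :: (u :: g ++ [v])) := ⟨hua', farL_compl.2 hga, hg⟩
    by_cases hadj : G.Adj a b
    · have h2 : IndPath Gᶜ (a :: ((u :: g ++ [v]) ++ [b])) := by
        have := IndPath.concat (l := a :: u :: g) (x := v) (y := b) (by simpa using h1) hvb'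
          (farL_compl.2 (by simpa using ⟨hadj.symm, by simpa using hgb⟩))
        simpa using this
      have hx' : ∀ t ∈ u :: g ++ [v], t ∈ T := by
        intro t ht; simp at ht
        rcases ht with rfl | ht | rfl
        · exact hu
        · exact hgT t ht
        · exact hv
      have hm' : IndPath G m := hl.tail.left
      obtain ⟨l₁, l₂, rfl | rfl⟩ := hm'.split_of_adj ha hb hadj
      · exact hA.false_of_consecutive hl h2 (by simp)
          (fun t ht => (hx t (hx' t ht)).symm) (fun t ht => (hy t (hx' t ht)).symm)
      · exact hA.false_of_consecutive hl h2.reverse_mid (by simp)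
          (fun t ht => (hx t (hx' t (by simp at ht ⊢; tauto))).symm)
          (fun t ht => (hy t (hx' t (by simp at ht ⊢; tauto))).symm)
    · have h2 := h1
      exact hA.false (u := b) (x := a) (y := v) (m := u :: g) (by simpa using h1)
        (by simp; omega) ⟨hab.symm, fun e => hadj e.symm⟩
        (compl_adj_iff_far.1 hvb').symm hgb
  -- All subsets of a stable set are co-connected, so `exists_leap` applies as soon as `T` has two
  -- vertices. The leap forms a prism with triangles `p t x` and `q y t'`.
  · have hst' : ∀ u ∈ T, ∀ v ∈ T, ¬ G.Adj u v := by
      intro u hu v hv h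
      exact hst ⟨u, hu, v, hv, far_compl.2 h⟩
    rcases Nat.lt_or_ge T.card 2 with h2 | h2
    · have : T.card = 1 := by have := Finset.card_pos.2 hne; omega
      obtain ⟨t, rfl⟩ := Finset.card_eq_one.1 this
      have := hG.odd hl hm0 (hx t (by simp)) (hy t (by simp)) (fun v hv =>
        ⟨by rintro rfl; exact hmT _ hv (by simp), fun h => hmC v hv (by simpa [mem_comp] using h)⟩)
      grind
    · have hsc : ∀ X ⊂ T, ConnIn Gᶜ (X : Set V) := by
        intro X hX u hu v hv
        by_cases e : u = v
        · subst e; exact .refl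
        · exact .single ⟨by rw [compl_adj]; exact ⟨e, hst' u (hX.subset hu) v (hX.subset hv)⟩, hu, hv⟩
      obtain ⟨p, s, q, t, t', rfl, ht, ht', htp, htq, hcom, hs⟩ := hG.exists_leap h2 hst'
        (show IndPath G (x :: m) from IndPath.left (l₂ := [y]) (by simpa using hl)) hl.tail hm0 hodd hmT
        hx hy (fun v hv => by
          by_contra! h
          exact hmC v hv fun t ht => h t ht) (fun X hX hXne => hec X hX hXne (hsc X hX))
      have hxt := hx t ht
      have hyt := hy t ht
      have hxt' := hx t' ht'
      have hyt' := hy t' ht'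
      have htq' : Far G t q := ⟨by rintro rfl; exact hmT _ (by simp) ht, fun h => hcom t ht ⟨htp, h⟩⟩
      have htp' : Far G t' p := ⟨by rintro rfl; exact hmT _ (by simp) ht', fun h => hcom t' ht' ⟨h, htq⟩⟩
      have htt : Far G t t' := ⟨by rintro rfl; exact htp'.2 htp, hst' t ht t' ht'⟩
      have hsp := hs t ht
      have hsq := hs t' ht'
      have hmid : IndPath G (p :: (s ++ [q])) := hl.tail.left
      have hxf := hl.2.1
      have hyf : Anti G (p :: s) [y] := by
        have : IndPath G ((p :: s) ++ q :: [y]) := by simpa using hl.tail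
        exact this.anti
      have hyq : G.Adj q y := by
        have : IndPath G ((p :: s) ++ q :: [y]) := by simpa using hl.tail
        exact (indPath_append.1 this).2.1.1
      have hxp : G.Adj x p := hl.1
      refine hP p s q t [] y x [] t' ⟨hmid, by simpa [indPath_pair] using hyt,
        by simpa [indPath_pair] using hxt'.symm, ?_, ?_, ?_⟩
      · clear hP hA hG hec ih hs hmC hmT hst; simp [Cross] at *; grind [adj_comm]
      · clear hP hA hG hec ih hs hmC hmT hst; simp [Cross] at *; grind [adj_comm]
      · clear hP hA hG hec ih hs hmC hmT hst; simp [Cross] at *; grind [adj_comm]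

end ArtemisGraph

namespace ArtemisGraph
open SimpleGraph

variable {V : Type*} {G : SimpleGraph V}

/-! ### Prisms with a defective rung -/

theorem Cross.cyc {a₁ b₁ a₂ b₂ : V} {m₁ m₂ : List V} (h : Cross G a₁ m₁ b₁ a₂ m₂ b₂)
    (p₁ : IndPath G (a₁ :: (m₁ ++ [b₁]))) (p₂ : IndPath G (a₂ :: (m₂ ++ [b₂]))) :
    Cyc G (a₁ :: (m₁ ++ b₁ :: b₂ :: (m₂.reverse ++ [a₂]))) := by
  have h2 : IndPath G (b₁ :: b₂ :: (m₂.reverse ++ [a₂])) := by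
    have := p₂.reverse_mid
    refine ⟨h.2.1, ?_, this⟩
    simp [Cross] at h; grind
  have h1 : IndPath G (m₁ ++ b₁ :: b₂ :: (m₂.reverse ++ [a₂])) := by
    refine indPath_append.2 ⟨p₁.tail, h2, ?_⟩
    simp [Cross] at h; grind [adj_comm]
  cases m₁ with
  | nil =>
    refine ⟨a₁, b₁, b₂ :: m₂.reverse, a₂, by simp, by simp, by simpa using h1, ?_, h.1, ?_⟩
    · exact indPath_pair.1 (by simpa using p₁)
    · simp [Cross] at h; simp; grind
  | cons c m =>
    refine ⟨a₁, c, m ++ b₁ :: b₂ :: m₂.reverse, a₂, by simp, by simp, by simpa using h1, p₁.1, h.1, ?_⟩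
    have := p₁.2.1
    simp [Cross] at h this; simp; grind

/-- Two rungs `a₁ m₁ b₁`, `a₂ m₂ b₂` of a prism and a third rung `a₃ p t q b₃` whose vertex `t` may
have further neighbours on the first two rungs. -/
structure DefectRung (G : SimpleGraph V) (a₁ : V) (m₁ : List V) (b₁ a₂ : V) (m₂ : List V) (b₂ a₃ : V)
    (p : List V) (t : V) (q : List V) (b₃ : V) : Prop where
  p₁ : IndPath G (a₁ :: (m₁ ++ [b₁]))
  p₂ : IndPath G (a₂ :: (m₂ ++ [b₂]))
  p₃ : IndPath G (a₃ :: (p ++ t :: (q ++ [b₃])))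
  h₁₂ : Cross G a₁ m₁ b₁ a₂ m₂ b₂
  a₁₃ : G.Adj a₁ a₃
  a₂₃ : G.Adj a₂ a₃
  b₁₃ : G.Adj b₁ b₃
  b₂₃ : G.Adj b₂ b₃
  far_a₁ : FarL G a₃ (m₁ ++ [b₁])
  far_a₂ : FarL G a₃ (m₂ ++ [b₂])
  far_b₁ : FarL G b₃ (a₁ :: m₁)
  far_b₂ : FarL G b₃ (a₂ :: m₂)
  anti₁ : Anti G (p ++ q) (a₁ :: (m₁ ++ [b₁]))
  anti₂ : Anti G (p ++ q) (a₂ :: (m₂ ++ [b₂]))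
  notMem₁ : t ∉ a₁ :: (m₁ ++ [b₁])
  notMem₂ : t ∉ a₂ :: (m₂ ++ [b₂])

section DefectRung

variable {a₁ b₁ a₂ b₂ a₃ b₃ t : V} {m₁ m₂ p q : List V}

theorem DefectRung.swap (h : DefectRung G a₁ m₁ b₁ a₂ m₂ b₂ a₃ p t q b₃) :
    DefectRung G a₂ m₂ b₂ a₁ m₁ b₁ a₃ p t q b₃ :=
  ⟨h.p₂, h.p₁, h.p₃, h.h₁₂.symm, h.a₂₃, h.a₁₃, h.b₂₃, h.b₁₃, h.far_a₂, h.far_a₁, h.far_b₂, h.far_b₁,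
    h.anti₂, h.anti₁, h.notMem₂, h.notMem₁⟩

theorem DefectRung.flip (h : DefectRung G a₁ m₁ b₁ a₂ m₂ b₂ a₃ p t q b₃) :
    DefectRung G b₁ m₁.reverse a₁ b₂ m₂.reverse a₂ b₃ q.reverse t p.reverse a₃ := by
  obtain ⟨h1, h2, h3, h4, h5, h6, h7, h8, h9, h10, h11, h12, h13, h14, h15, h16⟩ := h
  refine ⟨h1.reverse_mid, h2.reverse_mid, ?_, h4.flip, h7, h8, h5, h6, ?_, ?_, ?_, ?_, ?_, ?_, ?_, ?_⟩
  · have := indPath_reverse.2 h3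
    simpa using this
  all_goals simp at *; grind

/-- If `t` sees the hole through the first two rungs, the piece `p` leads from `a₃` to it and there
is a hat on `a₁ a₂ a₃`; otherwise the three rungs form a genuine prism. -/
theorem DefectRung.adj_of_far (h : DefectRung G a₁ m₁ b₁ a₂ m₂ b₂ a₃ p t q b₃) (hG : OddHoleFree G)
    (hP : PrismFree G) (h₁ : ¬ G.Adj t a₁) (h₂ : ¬ G.Adj t a₂) : False := by
  obtain ⟨p1, p2, p3, h12, h13, h23, k13, k23, fa1, fa2, fb1, fb2, an1, an2, nm1, nm2⟩ := h
  have hc := h12.cyc p1 p2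
  obtain ⟨x1, x2, x3⟩ := indPath_append.1
    (show IndPath G ((a₃ :: p) ++ t :: (q ++ [b₃])) from p3)
  by_cases hf : ∃ x ∈ m₁ ++ b₁ :: b₂ :: m₂.reverse, G.Adj t x
  · have hat : Hat G a₁ (m₁ ++ b₁ :: b₂ :: m₂.reverse) a₂ a₃ := by
      refine ⟨Cyc.indPath (l₂ := [a₂]) (by simpa using hc) (by simp), ?_, h12.1, by simp; omega,
        h13.symm, h23.symm, ?_⟩
      · refine Cyc.indPath (l₂ := [a₁]) ?_ (by simp)
        simpa using hc.rotate_one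
      · simp at *; grind
    refine hat.false_of_chain hG hP (w := p ++ [t]) x1.isChain ?_ ?_ ⟨t, by simp, hf⟩
    · simp at *; grind [Far, adj_comm]
    · simp at *; grind [Far, adj_comm]
  · refine hP a₁ m₁ b₁ a₂ m₂ b₂ a₃ (p ++ t :: q) b₃ ⟨p1, p2, by simpa using p3, h12, ?_, ?_⟩
    · clear hG hP hc p1 p2 p3 x1 x2; simp [Cross, FarL, Anti, Far] at *; grind [adj_comm]
    · clear hG hP hc p1 p2 p3 x1 x2; simp [Cross, FarL, Anti, Far] at *; grind [adj_comm]

/-- Suppose `t` misses `a₂` and `a₃`. On the hole through the first two rungs, `t` then sees at most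
`a₁` and the neighbour of `a₁` other than `a₂`, since otherwise `t` is the apex of a pyramid over
`a₁ a₂ a₃`. As `t` sees `b₁` or `b₂`, that neighbour is `b₁` and `m₁` is empty; the holes through
the third rung then have conflicting parities. -/
theorem DefectRung.adj_of_adj (h : DefectRung G a₁ m₁ b₁ a₂ m₂ b₂ a₃ p t q b₃) (hG : OddHoleFree G)
    (hP : PrismFree G) (h₁ : G.Adj t a₁) (h₂ : ¬ G.Adj t a₂) : G.Adj t a₃ := by
  by_contra h₃
  have hb : G.Adj t b₁ ∨ G.Adj t b₂ := by
    by_contra! hb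
    exact h.flip.adj_of_far hG hP hb.1 hb.2
  obtain ⟨p1, p2, p3, h12, h13, h23, k13, k23, fa1, fa2, fb1, fb2, an1, an2, nm1, nm2⟩ := h
  have hc := h12.cyc p1 p2
  obtain ⟨x1, x2, x3⟩ := indPath_append.1
    (show IndPath G ((a₃ :: p) ++ t :: (q ++ [b₃])) from p3)
  have hp : p ≠ [] := by
    rintro rfl
    exact h₃ (indPath_pair.1 (by simpa using x1)).symm
  have pyr : ∀ l n, a₂ :: (m₂ ++ b₂ :: b₁ :: m₁.reverse) = a₂ :: (l ++ [n]) →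
      ∀ x ∈ l, ¬ G.Adj t x := by
    intro l n e x hx htx
    have e : m₂ ++ b₂ :: b₁ :: m₁.reverse = l ++ [n] := by simpa using e
    have hpath : IndPath G (a₂ :: (l ++ [n])) := by
      rw [← e]
      have := (h12.symm.cyc p2 p1)
      exact Cyc.indPath (l₂ := [a₁]) (by simpa using this) (by simp)
    have hfar : FarL G a₁ l := by
      have := h12.cyc p1 p2
      have h5 : IndPath G (n :: (l.reverse ++ [a₂])) := by
        have := indPath_reverse.2 hpath
        simpa using this
      have h6 : Cyc G (a₁ :: n :: (l.reverse ++ [a₂])) := by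
        have e' := congrArg List.reverse e
        simp at e'
        have : a₁ :: (m₁ ++ b₁ :: b₂ :: (m₂.reverse ++ [a₂])) = a₁ :: n :: (l.reverse ++ [a₂]) := by
          rw [show n :: (l.reverse ++ [a₂]) = (n :: l.reverse) ++ [a₂] by simp, ← e']
          simp
        rwa [this] at hc
      have h7 : IndPath G (a₁ :: n :: l.reverse) :=
        Cyc.indPath (l₂ := [a₂]) (by simpa using h6) (by simp)
      simpa using h7.2.1
    have hsub : ∀ v ∈ l, v ∈ m₂ ++ b₂ :: b₁ :: m₁.reverse := by
      intro v hv; rw [e]; simp [hv]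
    have htl : t ∉ l := fun h => by have := hsub t h; simp at this nm1 nm2; grind
    obtain ⟨l₁, f, l₂, rfl, hf, hl₁⟩ := exists_first_adj ⟨x, hx, htx⟩ htl
    have y1 : IndPath G ((a₂ :: l₁) ++ [f]) := IndPath.left (l₂ := l₂ ++ [n]) (by simpa using hpath)
    have y2 := IndPath.concat y1 hf.symm (show FarL G t (a₂ :: l₁) by
      simp [hl₁, Far, h₂] ; simp at nm2; grind)
    have z1 := IndPath.left (l₂ := q ++ [b₃]) (show IndPath G ((a₃ :: (p ++ [t])) ++ (q ++ [b₃])) by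
      simpa using p3)
    refine hG.no_pyramid (u := t) (b₁ := a₁) (b₂ := a₂) (b₃ := a₃) (n₁ := []) (n₂ := l₁ ++ [f])
      (n₃ := p) (indPath_pair.2 h₁.symm) (by simpa using y2) z1 ?_ ?_ ?_ (by simp) (.inr hp) (by simp)
    · have := h12.1
      clear hsub; simp [HeadCross] at *; grind
    · clear hsub; simp [HeadCross] at *; grind [far_comm]
    · have hA : Anti G (l₁ ++ [f]) (a₃ :: p) := by
        intro v hv
        have := hsub v (by simp at hv ⊢; grind)
        clear hsub
        simp [FarL, Anti] at *; grind [far_comm]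
      simp [HeadCross, FarL, Anti] at *; grind [far_comm]
  have hm₁ : m₁ = [] := by
    cases m₁ with
    | nil => rfl
    | cons n m =>
      have := pyr (m₂ ++ b₂ :: b₁ :: m.reverse) n (by simp)
      simp at this
      grind
  subst hm₁
  have h2 := pyr (m₂ ++ [b₂]) b₁ (by simp)
  have htb : G.Adj t b₁ := by
    simp at h2; grind
  have htm₂ : FarL G t (m₂ ++ [b₂]) := fun v hv => ⟨by rintro rfl; simp at hv nm2; grind, h2 v hv⟩
  -- The parities come from the holes `a₁ b₁ b₂ m₂ a₂`, `a₁ a₃ p t` and `b₁ b₃ q t`. The path `t q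
  -- b₃ b₂ m₂ a₂` then closes to an odd hole, through `a₁` if `q` is empty and through `a₃` and `p`
  -- otherwise.
  have c1 : Even m₂.length := by
    have := hG _ hc
    simpa [Nat.even_add_one] using this
  have c2 : Odd p.length := by
    refine hG.odd (u := a₁) (m := p) x1 hp h13 h₁.symm ?_
    simp at an1; grind
  have q1 : IndPath G (t :: (q ++ b₃ :: b₂ :: (m₂.reverse ++ [a₂]))) := by
    rw [← List.cons_append]
    refine indPath_append.2 ⟨x2, ⟨k23.symm, ?_, p2.reverse_mid⟩, ?_⟩
    · simp at *; grind
    · clear pyr; simp at *; grind [adj_comm, Far]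
  by_cases hq : q = []
  · subst hq
    have := hG.odd (u := a₁) (x := t) (y := a₂) (m := b₃ :: b₂ :: m₂.reverse) (by simpa using q1) (by simp)
      h₁.symm h12.1 (by simp [Cross] at *; grind [far_comm])
    simp [Nat.odd_add_one] at this
    grind
  · have c3 : Odd q.length := by
      refine hG.odd (u := b₁) (m := q) x2 hq htb.symm k13 ?_
      simp at an1; grind
    have c4 := hG.even (x := t) (y := a₂) (m := q ++ b₃ :: b₂ :: m₂.reverse) (r := p.reverse ++ [a₃])
      (by simpa using q1) ?_ (by simp) (by simp) ?_
    · simp at c4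
      grind
    · have := IndPath.concat (l := t :: p.reverse) (by simpa using x1.reverse_mid) h23.symm (by
        clear pyr; simp at *; grind [Far])
      simpa using this
    · clear pyr; simp at *; grind [far_comm]

/-- The defect vertex sees two vertices of each triangle. -/
theorem DefectRung.two_of_three (h : DefectRung G a₁ m₁ b₁ a₂ m₂ b₂ a₃ p t q b₃) (hG : OddHoleFree G)
    (hP : PrismFree G) : (G.Adj t a₁ ∨ G.Adj t a₂) ∧ (G.Adj t a₁ ∨ G.Adj t a₃) ∧
      (G.Adj t a₂ ∨ G.Adj t a₃) := by
  have h1 := h.adj_of_far hG hP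
  have h2 := h.adj_of_adj hG hP
  have h3 := h.swap.adj_of_adj hG hP
  tauto

/-- Two rungs `a₁ m₁ b₁`, `a₂ m₂ b₂` of a prism and a third rung `t g b₃` whose end `t` may have
further neighbours on the first two rungs. -/
structure DefectCorner (G : SimpleGraph V) (a₁ : V) (m₁ : List V) (b₁ a₂ : V) (m₂ : List V) (b₂ t : V)
    (g : List V) (b₃ : V) : Prop where
  p₁ : IndPath G (a₁ :: (m₁ ++ [b₁]))
  p₂ : IndPath G (a₂ :: (m₂ ++ [b₂]))
  p₃ : IndPath G (t :: (g ++ [b₃]))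
  h₁₂ : Cross G a₁ m₁ b₁ a₂ m₂ b₂
  t₁ : G.Adj t a₁
  t₂ : G.Adj t a₂
  b₁₃ : G.Adj b₁ b₃
  b₂₃ : G.Adj b₂ b₃
  far_b₁ : FarL G b₃ (a₁ :: m₁)
  far_b₂ : FarL G b₃ (a₂ :: m₂)
  anti₁ : Anti G g (a₁ :: (m₁ ++ [b₁]))
  anti₂ : Anti G g (a₂ :: (m₂ ++ [b₂]))
  notMem₁ : t ∉ a₁ :: (m₁ ++ [b₁])
  notMem₂ : t ∉ a₂ :: (m₂ ++ [b₂])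

theorem DefectCorner.swap {g : List V} (h : DefectCorner G a₁ m₁ b₁ a₂ m₂ b₂ t g b₃) :
    DefectCorner G a₂ m₂ b₂ a₁ m₁ b₁ t g b₃ :=
  ⟨h.p₂, h.p₁, h.p₃, h.h₁₂.symm, h.t₂, h.t₁, h.b₂₃, h.b₁₃, h.far_b₂, h.far_b₁,
    h.anti₂, h.anti₁, h.notMem₂, h.notMem₁⟩

/-- `b₃` forms a hat with the edge `b₁ b₂` of the hole through the first two rungs, and `g` followed
by `t` leads from it to `a₁`. -/
theorem DefectCorner.adj_of_far {g : List V} (h : DefectCorner G a₁ m₁ b₁ a₂ m₂ b₂ t g b₃)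
    (hG : OddHoleFree G) (hP : PrismFree G) (h₁ : ¬ G.Adj t b₁) (h₂ : ¬ G.Adj t b₂) : False := by
  obtain ⟨p1, p2, p3, h12, t1, t2, k13, k23, fb1, fb2, an1, an2, nm1, nm2⟩ := h
  have hc := h12.cyc p1 p2
  have hat : Hat G b₁ (m₁.reverse ++ a₁ :: a₂ :: m₂) b₂ b₃ := by
    have hc' := h12.flip.cyc p1.reverse_mid p2.reverse_mid
    refine ⟨Cyc.indPath (l₂ := [b₂]) (by simpa using hc') (by simp), ?_, h12.2.1, by simp; omega,
        k13.symm, k23.symm, ?_⟩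
    · refine Cyc.indPath (l₂ := [b₁]) ?_ (by simp)
      simpa using hc'.rotate_one
    · simp at *; grind
  refine hat.false_of_chain hG hP (w := g.reverse ++ [t]) p3.reverse_mid.isChain ?_ ?_
    ⟨t, by simp, a₁, by simp, t1⟩
  · simp at *; grind [Far, adj_comm]
  · simp at *; grind [Far, adj_comm]

/-- If `t` missed `b₃`, then `g` would be nonempty, and `t` would be the apex of a pyramid over `b₁
b₂ b₃`: the three paths are the edge `b₁ t`, a part of the second rung, and `g`. -/
theorem DefectCorner.adj_of_adj {g : List V} (h : DefectCorner G a₁ m₁ b₁ a₂ m₂ b₂ t g b₃)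
    (hG : OddHoleFree G) (h₁ : G.Adj t b₁) (h₂ : ¬ G.Adj t b₂) : G.Adj t b₃ := by
  by_contra h₃
  obtain ⟨p1, p2, p3, h12, t1, t2, k13, k23, fb1, fb2, an1, an2, nm1, nm2⟩ := h
  have hg : g ≠ [] := by rintro rfl; exact h₃ (indPath_pair.1 (by simpa using p3))
  have p2' : IndPath G (b₂ :: (m₂.reverse ++ [a₂])) := p2.reverse_mid
  obtain ⟨l₁, f, l₂, e, hf, hl₁⟩ := exists_first_adj (f := t) (h := m₂.reverse ++ [a₂])
    ⟨a₂, by simp, t2⟩ (by simp at *; grind)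
  have hsub : ∀ v ∈ l₁ ++ [f], v ∈ m₂.reverse ++ [a₂] := by
    intro v hv; rw [e]; simp at hv ⊢; grind
  rw [e] at p2'
  have y1 : IndPath G ((b₂ :: l₁) ++ [f]) := IndPath.left (l₂ := l₂) (by simpa using p2')
  have y2 := IndPath.concat y1 hf.symm (show FarL G t (b₂ :: l₁) by
      simp [hl₁, Far, h₂]; simp at nm2; grind)
  refine hG.no_pyramid (u := t) (b₁ := b₁) (b₂ := b₂) (b₃ := b₃) (n₁ := []) (n₂ := l₁ ++ [f])
      (n₃ := g.reverse) (indPath_pair.2 h₁.symm) (by simpa using y2) p3.reverse_mid ?_ ?_ ?_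
      (by simp) (by simp [hg]) (by simp)
  · refine ⟨h12.2.1, ?_, by simp, by simp⟩
    intro v hv
    have := hsub v hv
    simp [Cross, FarL] at h12 this; grind
  · clear hsub; simp [HeadCross] at *; grind [far_comm]
  · refine ⟨k23, by simp at *; grind, ?_, ?_⟩
    · intro v hv
      have := hsub v hv
      simp [FarL] at fb2 this; grind
    · intro v hv
      have := hsub v hv
      simp [FarL, Anti] at an2 this ⊢; grind [far_comm]

theorem DefectCorner.two_of_three {g : List V} (h : DefectCorner G a₁ m₁ b₁ a₂ m₂ b₂ t g b₃)
    (hG : OddHoleFree G) (hP : PrismFree G) : (G.Adj t b₁ ∨ G.Adj t b₂) ∧ (G.Adj t b₁ ∨ G.Adj t b₃) ∧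
      (G.Adj t b₂ ∨ G.Adj t b₃) := by
  have h1 := h.adj_of_far hG hP
  have h2 := h.adj_of_adj hG
  have h3 := h.swap.adj_of_adj hG
  tauto

end DefectRung
end ArtemisGraph

namespace ArtemisGraph
open SimpleGraph

variable {V : Type*} {G : SimpleGraph V}

/-! ### Transfer between graphs that agree outside a set -/

section Transfer

variable {H : SimpleGraph V} {T : Set V}

theorem FarL.transfer (hGH : ∀ u v, u ∉ T → v ∉ T → (G.Adj u v ↔ H.Adj u v)) {u : V} {l : List V}
    (h : FarL G u l) (hu : u ∉ T) (hl : ∀ v ∈ l, v ∉ T) : FarL H u l := fun v hv =>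
  ⟨(h v hv).1, fun e => (h v hv).2 ((hGH u v hu (hl v hv)).2 e)⟩

theorem Anti.transfer (hGH : ∀ u v, u ∉ T → v ∉ T → (G.Adj u v ↔ H.Adj u v)) {l l' : List V}
    (h : Anti G l l') (hl : ∀ v ∈ l, v ∉ T) (hl' : ∀ v ∈ l', v ∉ T) : Anti H l l' := fun v hv =>
  FarL.transfer hGH (h v hv) (hl v hv) hl'

theorem IndPath.transfer (hGH : ∀ u v, u ∉ T → v ∉ T → (G.Adj u v ↔ H.Adj u v)) {l : List V}
    (h : IndPath G l) (hl : ∀ v ∈ l, v ∉ T) : IndPath H l := by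
  induction l with
  | nil => trivial
  | cons a l ih =>
    cases l with
    | nil => trivial
    | cons b l =>
      refine ⟨(hGH a b (hl a (by simp)) (hl b (by simp))).1 h.1,
        FarL.transfer hGH h.2.1 (hl a (by simp)) fun v hv => hl v (by simp [hv]),
        ih h.2.2 fun v hv => hl v (List.mem_cons_of_mem _ hv)⟩

theorem Cross.transfer (hGH : ∀ u v, u ∉ T → v ∉ T → (G.Adj u v ↔ H.Adj u v)) {a₁ b₁ a₂ b₂ : V}
    {m₁ m₂ : List V} (h : Cross G a₁ m₁ b₁ a₂ m₂ b₂) (h₁ : ∀ v ∈ a₁ :: (m₁ ++ [b₁]), v ∉ T)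
    (h₂ : ∀ v ∈ a₂ :: (m₂ ++ [b₂]), v ∉ T) : Cross H a₁ m₁ b₁ a₂ m₂ b₂ := by
  simp at h₁ h₂
  obtain ⟨k1, k2, k3, k4, k5, k6, k7, k8, k9⟩ := h
  refine ⟨(hGH _ _ ?_ ?_).1 k1, (hGH _ _ ?_ ?_).1 k2, ⟨k3.1, fun e => k3.2 ((hGH _ _ ?_ ?_).2 e)⟩,
    k4.transfer hGH ?_ ?_, ⟨k5.1, fun e => k5.2 ((hGH _ _ ?_ ?_).2 e)⟩, k6.transfer hGH ?_ ?_,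
    k7.transfer hGH ?_ ?_, k8.transfer hGH ?_ ?_, k9.transfer hGH ?_ ?_⟩ <;> grind

end Transfer

/-! ### Collapsing a co-connected set creates no odd hole and no prism -/

theorem PrismL.swap {a₁ b₁ a₂ b₂ a₃ b₃ : V} {m₁ m₂ m₃ : List V}
    (h : PrismL G a₁ m₁ b₁ a₂ m₂ b₂ a₃ m₃ b₃) : PrismL G a₂ m₂ b₂ a₁ m₁ b₁ a₃ m₃ b₃ :=
  ⟨h.p₂, h.p₁, h.p₃, h.h₁₂.symm, h.h₂₃, h.h₁₃⟩

theorem PrismL.rotate {a₁ b₁ a₂ b₂ a₃ b₃ : V} {m₁ m₂ m₃ : List V}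
    (h : PrismL G a₁ m₁ b₁ a₂ m₂ b₂ a₃ m₃ b₃) : PrismL G a₂ m₂ b₂ a₃ m₃ b₃ a₁ m₁ b₁ :=
  ⟨h.p₂, h.p₃, h.p₁, h.h₂₃, h.h₁₂.symm, h.h₁₃.symm⟩

theorem PrismL.flip {a₁ b₁ a₂ b₂ a₃ b₃ : V} {m₁ m₂ m₃ : List V}
    (h : PrismL G a₁ m₁ b₁ a₂ m₂ b₂ a₃ m₃ b₃) :
    PrismL G b₁ m₁.reverse a₁ b₂ m₂.reverse a₂ b₃ m₃.reverse a₃ :=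
  ⟨h.p₁.reverse_mid, h.p₂.reverse_mid, h.p₃.reverse_mid, h.h₁₂.flip, h.h₁₃.flip, h.h₂₃.flip⟩

/-- The graph in which the set `T` is replaced by one of its vertices `t`, adjacent exactly to the
vertices complete to `T`; the other vertices of `T` become isolated. -/
def collapse (G : SimpleGraph V) (T : Set V) (t : V) : SimpleGraph V :=
  SimpleGraph.fromRel fun u v => (u ∉ T ∧ v ∉ T ∧ G.Adj u v) ∨ (u = t ∧ v ∈ Comp G T)

section collapse

variable {T : Set V} {t : V}

theorem notMem_of_mem_comp {v : V} (h : v ∈ Comp G T) : v ∉ T := fun hv => (h v hv).ne rfl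

theorem collapse_adj_iff (ht : t ∈ T) {u v : V} (hu : u ∉ T) (hv : v ∉ T) :
    (collapse G T t).Adj u v ↔ G.Adj u v := by
  have hu' : u ≠ t := by rintro rfl; exact hu ht
  have hv' : v ≠ t := by rintro rfl; exact hv ht
  simp only [collapse, fromRel_adj, hu, hv, not_false_eq_true, true_and, hu', hv', false_and, or_false]
  exact ⟨fun h => h.2.elim id Adj.symm, fun h => ⟨h.ne, .inl h⟩⟩

theorem collapse_adj_left (ht : t ∈ T) {v : V} : (collapse G T t).Adj t v ↔ v ∈ Comp G T := by
  simp only [collapse, fromRel_adj, ht, not_true_eq_false, false_and, true_and, false_or, and_false]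
  constructor
  · rintro ⟨h, h1 | ⟨rfl, h1⟩⟩
    · exact h1
    · exact absurd rfl h
  · intro h
    exact ⟨by rintro rfl; exact notMem_of_mem_comp h ht, .inl h⟩

theorem collapse_mem {u v : V} (h : (collapse G T t).Adj u v) (hu : u ∈ T) : u = t := by
  simp only [collapse, fromRel_adj, hu, not_true_eq_false, false_and, and_false, false_or] at h
  rcases h.2 with h | ⟨_, h⟩
  · exact h.1
  · exact absurd hu (notMem_of_mem_comp h)

theorem IndPath.notMem_of_collapse {l : List V} (h : IndPath (collapse G T t) l) (hl : 2 ≤ l.length)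
    (ht : t ∉ l) : ∀ v ∈ l, v ∉ T := by
  intro v hv hvT
  obtain ⟨w, -, hw⟩ := h.exists_adj_of_mem hl hv
  exact ht (collapse_mem hw hvT ▸ hv)

/-- A hole through `t` consists of `t` and a chordless path of `G` whose ends are complete to `T`
and whose interior vertices are not; `outer_path_odd` gives its parity. -/
theorem collapse_oddHoleFree [Finite V] (hG : OddHoleFree G) (hP : PrismFree G)
    (hA : AntiholeFree G) (ht : t ∈ T) (hT : ConnIn Gᶜ T) : OddHoleFree (collapse G T t) := by
  have key : ∀ u v, u ∉ T → v ∉ T → ((collapse G T t).Adj u v ↔ G.Adj u v) := fun u v hu hv =>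
    collapse_adj_iff ht hu hv
  intro l hl
  by_cases htl : t ∈ l
  · obtain ⟨l₁, l₂, rfl⟩ := List.append_of_mem htl
    have h := hl.rotate
    obtain ⟨u, x, m, y, e, hm, hp, hx, hy, hf⟩ := h
    simp only [List.cons_append, List.cons.injEq] at e
    obtain ⟨rfl, e⟩ := e
    have hlen := congrArg List.length e
    have hT' := hp.notMem_of_collapse (by simp) (by
      have := hf.notMem
      have := hx.ne
      have := hy.ne
      simp; grind)
    have := outer_path_odd hG hP hA _ T.toFinite.toFinset rfl ⟨t, by simpa using ht⟩ (by simpa using hT)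
      x y m (hp.transfer key hT') (by simpa [collapse_adj_left ht] using hx)
      (by simpa [collapse_adj_left ht] using hy) (by simp at hT' ⊢; grind)
      (by
        intro v hv hv'
        refine (hf v hv).2 ((collapse_adj_left ht).2 (by simpa using hv')))
      hm
    simp at hlen ⊢
    grind
  · obtain ⟨u, x, m, y, rfl, hm, hp, hx, hy, hf⟩ := hl
    have hT' := hp.notMem_of_collapse (by simp) (by simp at htl ⊢; grind)
    have hu : u ∉ T := fun hu => htl (by simp [collapse_mem hx hu])
    exact hG _ ⟨u, x, m, y, rfl, hm, hp.transfer key hT', (key _ _ hu (hT' x (by simp))).1 hx,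
      (key _ _ hu (hT' y (by simp))).1 hy, hf.transfer key hu fun v hv => hT' v (by simp [hv])⟩

theorem IndPath.exists_shortcut {a u : V} {p : List V} (h : IndPath G (a :: p)) (hu : u ∉ a :: p)
    (hau : ∃ w ∈ a :: p, G.Adj u w) : ∃ p', p' ⊆ p ∧ IndPath G (a :: (p' ++ [u])) := by
  obtain ⟨l₁, s, l₂, e, hs, hl₁⟩ := exists_first_adj hau hu
  rw [e] at h
  have h1 := IndPath.concat (l := l₁) (x := s) (IndPath.left (l₂ := l₂) (by simpa using h)) hs.symm hl₁
  rcases cons_eq_split e with ⟨rfl, rfl, rfl⟩ | ⟨l₃, rfl, rfl⟩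
  · exact ⟨[], by simp, by simpa using h1⟩
  · exact ⟨l₃ ++ [s], by intro v; simp; grind, by simpa using h1⟩

variable {a₁ b₁ a₂ b₂ a₃ b₃ : V} {m₁ m₂ m₃ : List V}

theorem PrismL.notMem_rung₁ (h : PrismL G a₁ m₁ b₁ a₂ m₂ b₂ a₃ m₃ b₃) {v : V}
    (hv : v ∈ a₃ :: (m₃ ++ [b₃])) : v ∉ a₁ :: (m₁ ++ [b₁]) := by
  have := h.h₁₃
  have n1 := this.1.ne
  have n2 := this.2.1.ne
  simp [Cross, FarL, Anti, Far] at *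
  grind

/-- Every `u ∈ T` sees the two neighbours of `t` on the rung, so it can take the place of `t`, at
the price of extra neighbours on the other rungs; by `DefectRung.two_of_three` it sees `a₁` or `a₂`.
By `exists_antipath`, every vertex complete to `T` then sees `a₁` or `a₂`, but the neighbour of `t`
towards `b₃` sees neither. -/
theorem collapse_no_prism_middle (hG : OddHoleFree G) (hP : PrismFree G) (hA : AntiholeFree G)
    (ht : t ∈ T) (hT : ConnIn Gᶜ T)
    (h : PrismL (collapse G T t) a₁ m₁ b₁ a₂ m₂ b₂ a₃ m₃ b₃) (htm : t ∈ m₃) : False := by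
  have key : ∀ u v, u ∉ T → v ∉ T → ((collapse G T t).Adj u v ↔ G.Adj u v) := fun u v hu hv =>
    collapse_adj_iff ht hu hv
  have n1 := h.p₁.notMem_of_collapse (by simp) (h.notMem_rung₁ (by simp [htm]))
  have n2 := h.p₂.notMem_of_collapse (by simp) (h.swap.notMem_rung₁ (by simp [htm]))
  obtain ⟨p, q, rfl⟩ := List.append_of_mem htm
  obtain ⟨p1, p2, p3, h12, h13, h23⟩ := h
  have h12' := h12.transfer key n1 n2
  have p1' := p1.transfer key n1
  have p2' := p2.transfer key n2
  obtain ⟨x1, x2, x3⟩ := indPath_append.1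
    (show IndPath (collapse G T t) ((a₃ :: p) ++ t :: (q ++ [b₃])) by simpa using p3)
  have hnd := p3.nodup
  have n3 : ∀ v ∈ a₃ :: p, v ∉ T := fun v hv hvT => by
    obtain ⟨w, -, hw⟩ := p3.exists_adj_of_mem (by simp; omega) (show v ∈ _ by simp at hv ⊢; grind)
    have := collapse_mem hw hvT
    simp at hnd hv; grind
  have n4 : ∀ v ∈ q ++ [b₃], v ∉ T := fun v hv hvT => by
    obtain ⟨w, -, hw⟩ := p3.exists_adj_of_mem (by simp; omega) (show v ∈ _ by simp at hv ⊢; grind)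
    have := collapse_mem hw hvT
    simp at hnd hv; grind
  obtain ⟨e, he, hte⟩ : ∃ e ∈ a₃ :: p, (collapse G T t).Adj t e := by
    rcases List.eq_nil_or_concat (a₃ :: p) with h | ⟨l, e, h⟩
    · simp at h
    · rw [h] at x1
      exact ⟨e, by rw [h]; simp, (indPath_pair.1 (IndPath.right (l₁ := l) (by simpa using x1))).symm⟩
  obtain ⟨e', he', hte'⟩ : ∃ e ∈ q ++ [b₃], (collapse G T t).Adj t e := by
    cases q with
    | nil => exact ⟨b₃, by simp, x2.1⟩
    | cons c q => exact ⟨c, by simp, x2.1⟩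
  rw [collapse_adj_left ht] at hte hte'
  have hdef : ∀ u ∈ T, G.Adj u a₁ ∨ G.Adj u a₂ := by
    intro u hu
    obtain ⟨p', hp', hpu⟩ := (IndPath.left (l₂ := [t]) x1 |>.transfer key n3).exists_shortcut
      (u := u) (fun h => n3 u h hu) ⟨e, he, hte u hu⟩
    have hq : IndPath G (b₃ :: q.reverse) := by
      have := indPath_reverse.2 (x2.tail.transfer key n4)
      simpa using this
    obtain ⟨q', hq', hqu⟩ := hq.exists_shortcut
      (u := u) (fun h => n4 u (by simpa [or_comm] using h) hu)
      ⟨e', by simpa [or_comm] using he', hte' u hu⟩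
    have x3' := x3.transfer key n3 n4
    have hd : DefectRung G a₁ m₁ b₁ a₂ m₂ b₂ a₃ p' u q'.reverse b₃ := by
      refine ⟨p1', p2', ?_, h12', ?_, ?_, ?_, ?_, ?_, ?_, ?_, ?_, ?_, ?_, fun h => n1 u h hu,
        fun h => n2 u h hu⟩
      · rw [← List.cons_append]
        refine indPath_append.2 ⟨hpu, hqu.reverse_mid, x3'.mono ?_ ?_⟩
        · intro v; simp; grind
        · intro v; simp; have := @hq' v; grind
      · exact (key _ _ (n1 _ (by simp)) (n3 _ (by simp))).1 h13.1
      · exact (key _ _ (n2 _ (by simp)) (n3 _ (by simp))).1 h23.1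
      · exact (key _ _ (n1 _ (by simp)) (n4 _ (by simp))).1 h13.2.1
      · exact (key _ _ (n2 _ (by simp)) (n4 _ (by simp))).1 h23.2.1
      · refine FarL.transfer key ?_ (n3 _ (by simp)) fun v hv => n1 v (by simp at hv ⊢; grind)
        simp [Cross] at *; grind [far_comm]
      · refine FarL.transfer key ?_ (n3 _ (by simp)) fun v hv => n2 v (by simp at hv ⊢; grind)
        simp [Cross] at *; grind [far_comm]
      · refine FarL.transfer key ?_ (n4 _ (by simp)) fun v hv => n1 v (by simp at hv ⊢; grind)
        simp [Cross] at *; grind [far_comm]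
      · refine FarL.transfer key ?_ (n4 _ (by simp)) fun v hv => n2 v (by simp at hv ⊢; grind)
        simp [Cross] at *; grind [far_comm]
      · refine (Anti.transfer (l := p ++ q) key ?_ ?_ n1).mono ?_ (by simp)
        · simp [Cross] at *; grind [far_comm, anti_comm]
        · simp at n3 n4 ⊢; grind
        · intro v; have := @hq' v; have := @hp' v; simp at *; grind
      · refine (Anti.transfer (l := p ++ q) key ?_ ?_ n2).mono ?_ (by simp)
        · simp [Cross] at *; grind [far_comm, anti_comm]
        · simp at n3 n4 ⊢; grind
        · intro v; have := @hq' v; have := @hp' v; simp at *; grind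
    exact (hd.two_of_three hG hP).1
  refine (hA.exists_antipath hT (n1 a₁ (by simp)) (n2 a₂ (by simp)) ?_ ?_ h12'.1 hdef).2 e' hte' ⟨?_, ?_⟩
  · rw [← collapse_adj_left ht]
    simp [Cross, Far] at h13; grind [adj_comm]
  · rw [← collapse_adj_left ht]
    simp [Cross, Far] at h23; grind [adj_comm]
  · have : Far (collapse G T t) e' a₁ := by
      simp [Cross, FarL] at h13 he'; grind [far_comm]
    exact ⟨this.1, fun h => this.2 ((key _ _ (n4 _ he') (n1 _ (by simp))).2 h)⟩
  · have : Far (collapse G T t) e' a₂ := by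
      simp [Cross, FarL] at h23 he'; grind [far_comm]
    exact ⟨this.1, fun h => this.2 ((key _ _ (n4 _ he') (n2 _ (by simp))).2 h)⟩

/-- Putting any `u ∈ T` in the place of `t` shows that it sees `b₁` or `b₂`, and so does every
vertex complete to `T`. This forces all three rungs to be single edges. The antipath through `T`
from `b₁` to `b₂`, prolonged by `a₂` at `b₁` and by `a₁` at `b₂`, is then closed by `b₃` to an
antihole. -/
theorem collapse_no_prism_corner (hG : OddHoleFree G) (hP : PrismFree G) (hA : AntiholeFree G)
    (ht : t ∈ T) (hT : ConnIn Gᶜ T)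
    (h : PrismL (collapse G T t) a₁ m₁ b₁ a₂ m₂ b₂ t m₃ b₃) : False := by
  have key : ∀ u v, u ∉ T → v ∉ T → ((collapse G T t).Adj u v ↔ G.Adj u v) := fun u v hu hv =>
    collapse_adj_iff ht hu hv
  have n1 := h.p₁.notMem_of_collapse (by simp) (h.notMem_rung₁ (by simp))
  have n2 := h.p₂.notMem_of_collapse (by simp) (h.swap.notMem_rung₁ (by simp))
  obtain ⟨p1, p2, p3, h12, h13, h23⟩ := h
  have h12' := h12.transfer key n1 n2
  have p1' := p1.transfer key n1
  have p2' := p2.transfer key n2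
  have hnd := p3.nodup
  have n3 : ∀ v ∈ m₃ ++ [b₃], v ∉ T := fun v hv hvT => by
    obtain ⟨w, -, hw⟩ := p3.exists_adj_of_mem (by simp) (show v ∈ _ by simp at hv ⊢; grind)
    have := collapse_mem hw hvT
    simp at hnd hv; grind
  have p3' := p3.tail.transfer key n3
  have ha₁ : a₁ ∈ Comp G T := (collapse_adj_left ht).1 h13.1.symm
  have ha₂ : a₂ ∈ Comp G T := (collapse_adj_left ht).1 h23.1.symm
  have hb₁ : b₁ ∉ Comp G T := fun h => by
    have := h13.2.2.2.2.1.2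
    exact this ((collapse_adj_left ht).2 h).symm
  have hb₂ : b₂ ∉ Comp G T := fun h => by
    have := h23.2.2.2.2.1.2
    exact this ((collapse_adj_left ht).2 h).symm
  obtain ⟨e, he, hte⟩ : ∃ e ∈ m₃ ++ [b₃], (collapse G T t).Adj t e := by
    cases m₃ with
    | nil => exact ⟨b₃, by simp, p3.1⟩
    | cons c q => exact ⟨c, by simp, p3.1⟩
  rw [collapse_adj_left ht] at hte
  have hb13 := (key _ _ (n1 b₁ (by simp)) (n3 b₃ (by simp))).1 h13.2.1
  have hb23 := (key _ _ (n2 b₂ (by simp)) (n3 b₃ (by simp))).1 h23.2.1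
  have hf1 : FarL G b₃ (a₁ :: m₁) := by
    refine FarL.transfer key ?_ (n3 _ (by simp)) fun v hv => n1 v (by simp at hv ⊢; grind)
    simp [Cross] at *; grind [far_comm]
  have hf2 : FarL G b₃ (a₂ :: m₂) := by
    refine FarL.transfer key ?_ (n3 _ (by simp)) fun v hv => n2 v (by simp at hv ⊢; grind)
    simp [Cross] at *; grind [far_comm]
  have han1 : Anti G m₃ (a₁ :: (m₁ ++ [b₁])) := by
    refine Anti.transfer key ?_ (fun v hv => n3 v (by simp [hv])) n1
    simp [Cross] at *; grind [far_comm, anti_comm]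
  have han2 : Anti G m₃ (a₂ :: (m₂ ++ [b₂])) := by
    refine Anti.transfer key ?_ (fun v hv => n3 v (by simp [hv])) n2
    simp [Cross] at *; grind [far_comm, anti_comm]
  have hdef : ∀ u ∈ T, G.Adj u b₁ ∨ G.Adj u b₂ := by
    intro u hu
    have hq : IndPath G (b₃ :: m₃.reverse) := by
      have := indPath_reverse.2 p3'
      simpa using this
    obtain ⟨q', hq', hqu⟩ := hq.exists_shortcut
      (u := u) (fun h => n3 u (by simpa [or_comm] using h) hu)
      ⟨e, by simpa [or_comm] using he, hte u hu⟩
    have hd : DefectCorner G a₁ m₁ b₁ a₂ m₂ b₂ u q'.reverse b₃ := by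
      refine ⟨p1', p2', hqu.reverse_mid, h12', ha₁ u hu, ha₂ u hu, hb13, hb23, hf1, hf2, han1.mono ?_ ?_,
        han2.mono ?_ ?_, fun h => n1 u h hu, fun h => n2 u h hu⟩
      · intro v; have := @hq' v; simp at *; grind
      · simp
      · intro v; have := @hq' v; simp at *; grind
      · simp
    exact (hd.two_of_three hG hP).1
  obtain ⟨⟨r, hr, hrT, hlen⟩, hw⟩ :=
    hA.exists_antipath hT (n1 b₁ (by simp)) (n2 b₂ (by simp)) hb₁ hb₂ h12'.2.1 hdef
  by_cases hm : e ∈ m₃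
  · exact hw e hte ⟨han1 e hm b₁ (by simp), han2 e hm b₂ (by simp)⟩
  obtain rfl : e = b₃ := by simp at he; grind
  have hab1 : G.Adj a₁ b₁ := by
    by_contra h
    exact hw a₁ ha₁ ⟨⟨by have := p1'.nodup; simp at this; grind, h⟩, h12'.2.2.1⟩
  have hab2 : G.Adj a₂ b₂ := by
    by_contra h
    exact hw a₂ ha₂ ⟨h12'.2.2.2.2.1.symm, ⟨by have := p2'.nodup; simp at this; grind, h⟩⟩
  have h1 : IndPath Gᶜ (b₁ :: (r ++ [b₂, a₁])) := by
    have := IndPath.concat (l := b₁ :: r) hr (compl_adj_iff_far.2 h12'.2.2.1.symm) (farL_compl.2 (by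
      simpa [hab1] using fun v hv => (ha₁ v (hrT v hv)).symm))
    simpa using this
  have h2 : IndPath Gᶜ (a₂ :: ((b₁ :: (r ++ [b₂])) ++ [a₁])) := by
    refine ⟨compl_adj_iff_far.2 h12'.2.2.2.2.1.symm, farL_compl.2 ?_, by simpa using h1⟩
    have := fun v hv => (ha₂ v (hrT v hv)).symm
    have := h12'.1.symm
    simp; grind
  refine hA.false h2 (by simp) (u := e) (hf2 _ (by simp)) (hf1 _ (by simp)) ?_
  have := fun v hv => (hte v (hrT v hv)).symm
  have := hb13.symm
  have := hb23.symm
  simp; grind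

theorem collapse_prismFree (hG : OddHoleFree G) (hP : PrismFree G) (hA : AntiholeFree G)
    (ht : t ∈ T) (hT : ConnIn Gᶜ T) : PrismFree (collapse G T t) := by
  have key : ∀ u v, u ∉ T → v ∉ T → ((collapse G T t).Adj u v ↔ G.Adj u v) := fun u v hu hv =>
    collapse_adj_iff ht hu hv
  have aux : ∀ {a₁ m₁ b₁ a₂ m₂ b₂ a₃ m₃ b₃}, PrismL (collapse G T t) a₁ m₁ b₁ a₂ m₂ b₂ a₃ m₃ b₃ →
      t ∉ a₃ :: (m₃ ++ [b₃]) := by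
    intro a₁ m₁ b₁ a₂ m₂ b₂ a₃ m₃ b₃ h htm
    simp only [List.mem_cons, List.mem_append, List.not_mem_nil, or_false] at htm
    rcases htm with rfl | htm | rfl
    · exact collapse_no_prism_corner hG hP hA ht hT h
    · exact collapse_no_prism_middle hG hP hA ht hT h htm
    · exact collapse_no_prism_corner hG hP hA ht hT h.flip
  intro a₁ m₁ b₁ a₂ m₂ b₂ a₃ m₃ b₃ h
  have n3 := h.p₃.notMem_of_collapse (by simp) (aux h)
  have n1 := h.p₁.notMem_of_collapse (by simp) (aux h.rotate)
  have n2 := h.p₂.notMem_of_collapse (by simp) (aux h.rotate.rotate)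
  obtain ⟨p1, p2, p3, h12, h13, h23⟩ := h
  exact hP _ _ _ _ _ _ _ _ _ ⟨p1.transfer key n1, p2.transfer key n2, p3.transfer key n3,
    h12.transfer key n1 n2, h13.transfer key n1 n3, h23.transfer key n2 n3⟩

end collapse
end ArtemisGraph

/-! ### Vertices that see one edge of a hole, and paths through connected sets -/

namespace ArtemisGraph
open SimpleGraph

variable {V : Type*} {G : SimpleGraph V}

theorem EC_cons_eq_zero {S : Set V} {c : V} {l : List V} (h : ∀ v ∈ l, v ∉ S) : EC S (c :: l) = 0 := by
  cases l with
  | nil => rfl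
  | cons b l => rw [EC_cons_cons, EC_eq_zero h]; simp [h b (by simp)]

theorem EC_concat_eq_zero {S : Set V} {c : V} {l : List V} (h : ∀ v ∈ l, v ∉ S) :
    EC S (l ++ [c]) = 0 := by
  rw [← EC_reverse]
  simpa using EC_cons_eq_zero (c := c) (l := l.reverse) (by simpa using h)

/-- A vertex with an odd number of neighbouring edges on a hole sees exactly two consecutive vertices
of the hole. -/
theorem OddHoleFree.exists_pair_of_odd_EC (hG : OddHoleFree G) {d d' t : V} {s R : List V}
    (h₁ : IndPath G (d :: (s ++ [d']))) (h₂ : IndPath G (d' :: (R ++ [d]))) (hs : s ≠ []) (hR : R ≠ [])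
    (hsR : Anti G s R) (htR : FarL G t R) (ht : t ∉ d :: (s ++ [d']))
    (hodd : Odd (EC (G.neighborSet t) (d :: (s ++ [d'])))) :
    ∃ D₁ c c' D₂, d :: (s ++ [d']) = D₁ ++ c :: c' :: D₂ ∧ G.Adj t c ∧ G.Adj t c' ∧ FarL G t D₁ ∧
      FarL G t D₂ := by
  have hcyc : Cyc G ((d :: (s ++ [d'])) ++ R) := by
    simpa using Cyc.of_two_paths h₁ h₂ hs hR hsR
  generalize hD : d :: (s ++ [d']) = D at *
  have hnd := h₁.nodup
  obtain ⟨l₁, p, q, l₂, e, hp, hq⟩ := EC_pos (by rintro h; rw [h] at hodd; simp at hodd)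
  obtain ⟨D₁, c, E, e₁, hc, hD₁⟩ := exists_first_split (fun v => G.Adj t v) (l := D)
    ⟨p, by simp [e], hp⟩
  obtain ⟨m, c', D₂, e₂, hc', hD₂⟩ := exists_last_split (fun v => G.Adj t v) (l := E) (by
    by_contra! h
    have hall : ∀ v ∈ D, G.Adj t v → v = c := by
      intro v hv hv'
      rw [e₁] at hv
      simp at hv
      grind
    have h1 := hall p (by simp [e]) hp
    have h2 := hall q (by simp [e]) hq
    rw [e, h1, h2] at hnd
    have := (List.nodup_append.1 hnd).2.1
    simp at this)
  subst e₂
  have hF₁ : FarL G t D₁ := fun v hv => ⟨by rintro rfl; exact ht (by simp [e₁, hv]), hD₁ v hv⟩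
  have hF₂ : FarL G t D₂ := fun v hv => ⟨by rintro rfl; exact ht (by simp [e₁, hv]), hD₂ v hv⟩
  by_cases hm : m = []
  · exact ⟨D₁, c, c', D₂, by simpa [hm] using e₁, hc, hc', hF₁, hF₂⟩
  -- Inside the way from `c'` back to `c` that avoids `m`, nothing is seen by `t`; so this interior
  -- is odd, and `m` is odd since the hole is even. The edges seen by `t` all lie between `c` and
  -- `c'`, and their number comes out even.
  · exfalso
    subst e₁
    have hcyc' : Cyc G ((c' :: (D₂ ++ R ++ D₁ ++ [c])) ++ m) := by
      have := Cyc.rotate (l₁ := D₁ ++ c :: m) (l₂ := c' :: D₂ ++ R) (by simpa using hcyc)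
      simpa using this
    have ho := hG.odd (hcyc'.indPath hm) (by simp [hR]) hc' hc (by simp [hF₁, hF₂, htR])
    have hev := hG _ hcyc
    have hpath : IndPath G (c :: (m ++ [c'])) := by
      have h3 : IndPath G (c :: (m ++ c' :: D₂)) := h₁.right
      exact IndPath.left (l₂ := D₂) (by simpa using h3)
    have hpar := hG.EC_neighborSet_parity hpath hc hc' (fun h => ht (by simp [h]))
    have e4 : EC (G.neighborSet t) (D₁ ++ c :: (m ++ c' :: D₂)) =
        EC (G.neighborSet t) (c :: (m ++ [c'])) := by
      rw [EC_append, EC_concat_eq_zero (show ∀ v ∈ D₁, v ∉ G.neighborSet t from hD₁), ← List.cons_append, EC_append, EC_cons_eq_zero (show ∀ v ∈ D₂, v ∉ G.neighborSet t from hD₂)]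
      simp
    rw [e4] at hodd
    simp at hev ho
    grind

theorem IndPath.connIn {l : List V} (h : IndPath G l) : ConnIn G {v | v ∈ l} := by
  have key : ∀ l : List V, IndPath G l → ∀ a ∈ l.head?, ∀ v ∈ l, LinkIn G {v | v ∈ l} a v := by
    intro l
    induction l with
    | nil => simp
    | cons a l ih =>
      intro h a' ha' v hv
      obtain rfl : a = a' := by simpa using ha'
      cases l with
      | nil => obtain rfl : v = a := by simpa using hv
               exact .refl
      | cons b l =>
        rcases List.mem_cons.1 hv with rfl | hv
        · exact .refl
        · refine .head (b := b) ⟨h.1, by simp, by simp⟩ ((ih h.2.2 b (by simp) v hv).mono ?_)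
          intro x hx; exact List.mem_cons_of_mem _ hx
  intro u hu v hv
  cases l with
  | nil => simp at hu
  | cons a l => exact ((key _ h a (by simp) u hu).symm).trans (key _ h a (by simp) v hv)

theorem ConnIn.exists_indPath {M : Set V} (hM : ConnIn G M) {d d' : V} (hne : d ≠ d') (h : ∃ z ∈ M, G.Adj z d) (h' : ∃ z ∈ M, G.Adj z d') :
    ∃ R, IndPath G (d :: (R ++ [d'])) ∧ ∀ v ∈ R, v ∈ M := by
  obtain ⟨z, hz, hzd⟩ := h
  obtain ⟨z', hz', hzd'⟩ := h'
  have hlink : LinkIn G (M ∪ {d, d'}) d d' :=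
    .head (b := z) ⟨hzd.symm, by simp, by simp [hz]⟩ (.tail (b := z')
      ((hM z hz z' hz').mono Set.subset_union_left) ⟨hzd', by simp [hz'], by simp⟩)
  obtain ⟨R, hR, hRM⟩ := hlink.exists_indPath hne
  refine ⟨R, hR, fun v hv => ?_⟩
  have h1 := hRM v hv
  have := hR.nodup
  simp at this h1
  grind

/-! ### The two cliques at the ends of an outer path -/

/-- `t` sees the cliques `A`, `B` and misses the list `Z`, and `a, Z, b` is a chordless path
for all `a ∈ A` and `b ∈ B`; the other neighbours of `t` that see a vertex of `Z` are complete to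
`A` and to `B`. -/
structure Core (G : SimpleGraph V) (t : V) (Z : List V) (A B : Set V) : Prop where
  ohf : OddHoleFree G
  pf : PrismFree G
  path : ∀ a ∈ A, ∀ b ∈ B, IndPath G (a :: (Z ++ [b]))
  odd : Odd Z.length
  two_le : 2 ≤ Z.length
  nonempty_left : A.Nonempty
  nonempty_right : B.Nonempty
  adj_left : ∀ a ∈ A, G.Adj t a
  adj_right : ∀ b ∈ B, G.Adj t b
  clique_left : G.IsClique A
  clique_right : G.IsClique B
  anti : FarL G t Z
  touch : ∀ u, G.Adj t u → (∃ z ∈ Z, G.Adj z u) →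
    u ∈ A ∨ u ∈ B ∨ ((∀ a ∈ A, G.Adj u a) ∧ ∀ b ∈ B, G.Adj u b)

namespace Core

variable {t : V} {Z : List V} {A B : Set V}

theorem swap (h : Core G t Z A B) : Core G t Z.reverse B A := by
  obtain ⟨h1, h2, h3, h4, h5, h6, h7, h8, h9, h10, h11, h12, h13⟩ := h
  refine ⟨h1, h2, fun b hb a ha => (h3 a ha b hb).reverse_mid, by simpa, by simpa, h7, h6, h9, h8, h11,
    h10, by simpa, fun u hu hz => ?_⟩
  have := h13 u hu (by simpa using hz)
  tauto

theorem ne_nil (h : Core G t Z A B) : Z ≠ [] := by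
  have := h.two_le; rintro rfl; simp at this

theorem far (h : Core G t Z A B) {a b : V} (ha : a ∈ A) (hb : b ∈ B) : Far G a b :=
  (h.path a ha b hb).far_ends h.ne_nil

theorem indPath (h : Core G t Z A B) : IndPath G Z := by
  obtain ⟨a, ha⟩ := h.nonempty_left
  obtain ⟨b, hb⟩ := h.nonempty_right
  exact (h.path a ha b hb).tail.left

theorem notMem_of_adj (h : Core G t Z A B) {v : V} (hv : G.Adj t v) : v ∉ Z := fun hz =>
  (h.anti v hz).2 hv

theorem touch_left (h : Core G t Z A B) {a : V} (ha : a ∈ A) : ∃ z ∈ Z, G.Adj z a := by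
  obtain ⟨b, hb⟩ := h.nonempty_right
  have := h.path a ha b hb
  obtain ⟨z, Z', rfl⟩ := List.exists_cons_of_ne_nil h.ne_nil
  exact ⟨z, by simp, this.1.symm⟩

theorem touch_right (h : Core G t Z A B) {b : V} (hb : b ∈ B) : ∃ z ∈ Z, G.Adj z b := by
  simpa using h.swap.touch_left hb

theorem touch_mem (h : Core G t Z A B) {z : V} (hz : z ∈ Z) : ∃ z' ∈ Z, G.Adj z' z := by
  obtain ⟨w, hw, h'⟩ := h.indPath.exists_adj_of_mem h.two_le hz
  exact ⟨w, hw, h'.symm⟩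

/-- A hole through `Z` with two consecutive neighbours of `t` and no other one. -/
theorem false_of_hat (h : Core G t Z A B) {c c' b : V} {l : List V} (hb : b ∈ B)
    (hcyc : Cyc G (c :: c' :: l)) (hc : G.Adj t c) (hc' : G.Adj t c') (hl : FarL G t l)
    (hbc : Far G b c) (hbc' : Far G b c') (hA : (∃ z ∈ Z, G.Adj z c) → c ∈ A)
    (hA' : (∃ z ∈ Z, G.Adj z c') → c' ∈ A) (hlZ : ∃ r ∈ l, r ∈ Z) : False := by
  obtain ⟨u, x, m, y, e, hm, -⟩ := id hcyc
  have hlen : 2 ≤ l.length := by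
    have := congrArg List.length e
    cases m <;> simp at hm this ⊢
    omega
  have hat : Hat G c' l c t := by
    refine ⟨?_, ?_, ?_, hlen, hc', hc, hl⟩
    · exact Cyc.indPath (l₂ := [c]) (by simpa using hcyc.rotate_one) (by simp)
    · exact Cyc.indPath (l₂ := [c']) (by simpa using hcyc.rotate_one.rotate_one) (by simp)
    · have := hcyc.indPath (l₁ := [c, c']) (l₂ := l) (by rintro rfl; simp at hlen)
      exact (indPath_pair.1 this).symm
  obtain ⟨a, ha⟩ := h.nonempty_left
  obtain ⟨z, Z', hZ⟩ := List.exists_cons_of_ne_nil h.ne_nil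
  have hp := h.path a ha b hb
  -- A vertex of `A` sees only the first vertex `z` of `Z`, and if `c` is not in `A` it sees none.
  -- So `t`, `b` and `Z'` reversed lead to the hole without touching the neighbourhoods of `c` and
  -- `c'`.
  have key : ∀ c, G.Adj t c → Far G b c → ((∃ z ∈ Z, G.Adj z c) → c ∈ A) →
      FarL G c (b :: Z'.reverse) := by
    intro c hc hbc hA
    by_cases hz : ∃ z ∈ Z, G.Adj z c
    · have := h.path c (hA hz) b hb
      rw [hZ] at this
      have := this.2.1
      simp at this ⊢
      grind
    · push Not at hz
      have := h.notMem_of_adj hc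
      simp only [farL_cons, farL_reverse]
      refine ⟨hbc.symm, fun v hv => ⟨?_, fun hv' => hz v (by simp [hZ, hv]) hv'.symm⟩⟩
      rintro rfl
      exact this (by simp [hZ, hv])
  refine hat.false_of_chain h.ohf h.pf (w := b :: Z'.reverse) ?_ (key _ hc' hbc' hA') (key _ hc hbc hA) ?_
  · have h2 : List.IsChain G.Adj (b :: Z'.reverse) := by
      have : IndPath G (z :: (Z' ++ [b])) := by rw [hZ] at hp; exact hp.tail
      have := (indPath_reverse.2 this.tail).isChain
      simpa using this
    exact List.isChain_cons_cons.2 ⟨h.adj_right b hb, h2⟩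
  · obtain ⟨r, hr, hrZ⟩ := hlZ
    obtain ⟨l₁, l₂, e⟩ := List.append_of_mem hrZ
    have hp' : IndPath G (l₁ ++ r :: (l₂ ++ [b])) := by
      have := hp.tail; rw [e] at this; simpa using this
    cases l₂ with
    | nil =>
      exact ⟨b, by simp, r, hr, (indPath_append.1 hp').2.1.1.symm⟩
    | cons r' l₂ =>
      refine ⟨r', ?_, r, hr, (indPath_append.1 hp').2.1.1.symm⟩
      rw [hZ] at e
      cases l₁ with
      | nil => simp at e; simp [e.2]
      | cons _ l₁ => simp at e; simp [e.2]

/-- A path between two vertices that see `Z`, with interior away from `Z`, and with an odd number of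
edges seen by `t`. -/
theorem exists_pair (h : Core G t Z A B) {d d' : V} {s : List V} (hD : IndPath G (d :: (s ++ [d'])))
    (hs : s ≠ [])
    (hdt : ∃ z ∈ Z, G.Adj z d) (hdt' : ∃ z ∈ Z, G.Adj z d')
    (hsZ : Anti G s Z) (ht : t ∉ d :: (s ++ [d']))
    (hodd : Odd (EC (G.neighborSet t) (d :: (s ++ [d'])))) :
    ∃ D₁ c c' D₂, d :: (s ++ [d']) = D₁ ++ c :: c' :: D₂ ∧ G.Adj t c ∧ G.Adj t c' ∧ FarL G t D₁ ∧
      FarL G t D₂ ∧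
      (∀ b ∈ B, Far G b c → Far G b c' → ((∃ z ∈ Z, G.Adj z c) → c ∈ A) →
        ((∃ z ∈ Z, G.Adj z c') → c' ∈ A) → False) ∧
      (∀ a ∈ A, Far G a c → Far G a c' → ((∃ z ∈ Z, G.Adj z c) → c ∈ B) →
        ((∃ z ∈ Z, G.Adj z c') → c' ∈ B) → False) := by
  have hfar := hD.far_ends hs
  -- The path is closed to a hole by a path `R` through `Z`, which `t` misses.
  obtain ⟨R, hR, hRZ⟩ := h.indPath.connIn.exists_indPath (d := d') (d' := d) hfar.1.symm hdt' hdt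
  have hR0 : R ≠ [] := by
    rintro rfl
    exact hfar.2 (indPath_pair.1 hR).symm
  have hsR : Anti G s R := hsZ.mono (by simp) hRZ
  have htR : FarL G t R := h.anti.mono hRZ
  obtain ⟨D₁, c, c', D₂, e, hc, hc', h₁, h₂⟩ :=
    h.ohf.exists_pair_of_odd_EC hD hR hs hR0 hsR htR ht hodd
  have hcyc : Cyc G (c :: c' :: (D₂ ++ R ++ D₁)) := by
    have h0 : Cyc G (D₁ ++ (c :: c' :: D₂ ++ R)) := by
      have := Cyc.of_two_paths hD hR hs hR0 hsR
      have e' : d :: (s ++ d' :: R) = D₁ ++ (c :: c' :: D₂ ++ R) := by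
        rw [← List.append_assoc, ← e]; simp
      rwa [e'] at this
    simpa using h0.rotate
  obtain ⟨r, hr⟩ := List.exists_mem_of_ne_nil R hR0
  have hl : FarL G t (D₂ ++ R ++ D₁) := by simp [h₁, h₂, htR]
  refine ⟨D₁, c, c', D₂, e, hc, hc', h₁, h₂, fun b hb f f' k k' => ?_, fun a ha f f' k k' => ?_⟩
  · exact h.false_of_hat hb hcyc hc hc' hl f f' k k' ⟨r, by simp [hr], hRZ r hr⟩
  · exact h.swap.false_of_hat ha hcyc hc hc' hl f f' (by simpa using k) (by simpa using k')
      ⟨r, by simp [hr], by simpa using hRZ r hr⟩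

end Core
end ArtemisGraph

/-! ### Odd paths between the two cliques -/

namespace ArtemisGraph
open SimpleGraph

variable {V : Type*} {G : SimpleGraph V}

theorem IndPath.eq_cons_of_adj {x y u : V} {m : List V} (h : IndPath G (x :: (m ++ [y]))) (hu : u ∈ m)
    (hxu : G.Adj x u) : ∃ m', m = u :: m' := by
  obtain ⟨c, m', rfl⟩ := List.exists_cons_of_ne_nil (List.ne_nil_of_mem hu)
  rcases List.mem_cons.1 hu with rfl | hu
  · exact ⟨m', rfl⟩
  · exact absurd hxu (h.2.1 u (by simp [hu])).2

theorem IndPath.eq_concat_of_adj {x y u : V} {m : List V} (h : IndPath G (x :: (m ++ [y]))) (hu : u ∈ m)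
    (hyu : G.Adj y u) : ∃ m', m = m' ++ [u] := by
  obtain ⟨m', e⟩ := h.reverse_mid.eq_cons_of_adj (by simpa using hu) hyu
  exact ⟨m'.reverse, by rw [← List.reverse_reverse m, e]; simp⟩

theorem IndPath.eq_singleton_of_adj {x y u : V} {m : List V} (h : IndPath G (x :: (m ++ [y])))
    (hu : u ∈ m) (hxu : G.Adj x u) (hyu : G.Adj y u) : m = [u] := by
  obtain ⟨m', rfl⟩ := h.eq_cons_of_adj hu hxu
  obtain ⟨m'', e⟩ := h.eq_concat_of_adj hu hyu
  cases m'' with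
  | nil => simpa using e
  | cons c m'' =>
    have hnd := h.nodup
    rw [e] at hnd
    simp only [List.cons_append, List.cons.injEq] at e
    simp [← e.1] at hnd

namespace Core

variable {t : V} {Z : List V} {A B : Set V}

/-- An odd count would give a hole through `Z` on which `t` sees only two consecutive vertices. The
vertex `b` lies beyond the segment and misses both of them, and neither of them sees `Z` unless it
is `a`; this is what `false_of_hat` excludes. -/
theorem even_segment (h : Core G t Z A B) {a b : V} {m : List V} (ha : a ∈ A) (hb : b ∈ B)
    (hp : IndPath G (a :: (m ++ [b]))) (hC : ∀ u ∈ m, G.Adj t u → ∀ z ∈ Z, ¬ G.Adj z u) (ht : t ∉ m)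
    {pre s post : List V} {p q : V} (e : a :: (m ++ [b]) = pre ++ p :: (s ++ q :: post))
    (hpZ : ∃ z ∈ Z, G.Adj z p) (hqZ : ∃ z ∈ Z, G.Adj z q) (hs : ∀ v ∈ s, ¬ ∃ z ∈ Z, G.Adj z v)
    (hs0 : s ≠ []) (hpost : post ≠ []) : Even (EC (G.neighborSet t) (p :: (s ++ [q]))) := by
  by_contra hodd
  rw [Nat.not_even_iff_odd] at hodd
  rcases List.eq_nil_or_concat post with rfl | ⟨post, b', rfl⟩
  · exact hpost rfl
  rw [List.concat_eq_append] at *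
  have hbb : b = b' := by
    have := congrArg List.reverse e
    simp at this
    exact this.1
  subst hbb
  have hnd := hp.nodup
  have hmem : ∀ v ∈ p :: (s ++ [q]), v ∈ a :: (m ++ [b]) := by
    intro v hv; rw [e]; simp at hv ⊢; grind
  have htp : t ∉ p :: (s ++ [q]) := fun h1 => by
    have h2 := hmem t h1
    have := (h.adj_left a ha).ne
    have := (h.adj_right b hb).ne
    simp at h2; grind
  have hbD : b ∉ p :: (s ++ [q]) := fun h1 => by
    rw [e] at hnd; simp at hnd h1; grind
  have hqa : q ≠ a := by
    rintro rfl
    rw [e] at hnd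
    cases pre <;> simp at e hnd <;> grind
  rw [e] at hp
  have hD : IndPath G (p :: (s ++ [q])) := by
    refine IndPath.left (l₂ := post ++ [b]) ?_
    simpa using hp.right
  have hsZ : Anti G s Z := fun v hv z hz => by
    refine ⟨?_, fun h1 => hs v hv ⟨z, hz, h1.symm⟩⟩
    rintro rfl
    exact hs v hv (h.touch_mem hz)
  have htouch : ∀ v ∈ p :: (s ++ [q]), G.Adj t v → (∃ z ∈ Z, G.Adj z v) → v = a := by
    intro v hv htv hz
    have h1 := hmem v hv
    obtain ⟨z, hz, hzv⟩ := hz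
    simp only [List.mem_cons, List.mem_append, List.not_mem_nil, or_false] at h1
    rcases h1 with h1 | h1 | rfl
    · exact h1
    · exact absurd hzv (hC v h1 htv z hz)
    · exact absurd hv hbD
  obtain ⟨D₁, c, c', D₂, e', hc, hc', -, -, hfalse, -⟩ := h.exists_pair hD hs0 hpZ hqZ hsZ htp hodd
  have hanti : Anti G (pre ++ p :: s) (post ++ [b]) := by
    refine IndPath.anti (x := q) ?_
    simpa using hp
  have hcc : ∀ c ∈ p :: (s ++ [q]), G.Adj t c → Far G b c := by
    intro c hcD hc
    by_cases hcq : c = q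
    · subst hcq
      exact absurd (htouch c hcD hc hqZ) hqa
    · have : c ∈ pre ++ p :: s := by simp at hcD ⊢; grind
      exact (hanti c this b (by simp)).symm
  have hcD : c ∈ p :: (s ++ [q]) := by rw [e']; simp
  have hcD' : c' ∈ p :: (s ++ [q]) := by rw [e']; simp
  exact hfalse b hb (hcc c hcD hc) (hcc c' hcD' hc') (fun hz => htouch c hcD hc hz ▸ ha)
    fun hz => htouch c' hcD' hc' hz ▸ ha

/-- An odd chordless path from `A` to `B` has a second vertex in `A` or a penultimate vertex in
`B`. -/
theorem odd_path (h : Core G t Z A B) {a b : V} {m : List V} (ha : a ∈ A) (hb : b ∈ B)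
    (hp : IndPath G (a :: (m ++ [b]))) (hm : Even m.length) :
    (∃ a' ∈ A, ∃ m', m = a' :: m') ∨ ∃ b' ∈ B, ∃ m', m = m' ++ [b'] := by
  by_contra! hcon
  obtain ⟨hA, hB⟩ := hcon
  have hnd := hp.nodup
  have hta := h.adj_left a ha
  have htb := h.adj_right b hb
  have hab := h.far ha hb
  have ht : t ∉ m := fun ht => by
    rw [hp.eq_singleton_of_adj ht hta.symm htb.symm] at hm
    simp at hm
  -- A neighbour of `t` in `m` that sees `Z` would lie in `A` or in `B`, and hence be next to `a` or
  -- `b`, or it would see both ends and `m` would be a single vertex.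
  have hC : ∀ u ∈ m, G.Adj t u → ∀ z ∈ Z, ¬ G.Adj z u := by
    intro u hu htu z hz hzu
    have hua : a ≠ u := by rintro rfl; simp [hu] at hnd
    have hub : b ≠ u := by rintro rfl; simp at hnd; grind
    rcases h.touch u htu ⟨z, hz, hzu⟩ with h1 | h1 | h1
    · obtain ⟨m', e⟩ := hp.eq_cons_of_adj hu (h.clique_left ha h1 hua)
      exact hA u h1 m' e
    · obtain ⟨m', e⟩ := hp.eq_concat_of_adj hu (h.clique_right hb h1 hub)
      exact hB u h1 m' e
    · rw [hp.eq_singleton_of_adj hu (h1.1 a ha).symm (h1.2 b hb).symm] at hm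
      simp at hm
  have hpar := h.ohf.EC_neighborSet_parity hp hta htb ht
  have hm0 : m ≠ [] := by
    rintro rfl
    exact hab.2 (indPath_pair.1 hp)
  -- Cut at the vertices that see `Z`. A segment that is an edge seen by `t` would be `a b`. A
  -- longer segment that avoids `b` or `a` is settled by `even_segment` from the appropriate side.
  -- On the whole path `t` sees both ends, which are not consecutive.
  have := even_of_segments (P := fun v => ∃ z ∈ Z, G.Adj z v) (f := EC (G.neighborSet t))
    (l := a :: (m ++ [b])) (y := b) (EC_append _) (h.touch_right hb) (fun pre p s q post e hpZ hqZ hs => by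
      have hmem : ∀ v ∈ p :: (s ++ [q]), v ∈ a :: (m ++ [b]) := by
        intro v hv; rw [e]; simp at hv ⊢; grind
      by_cases hs0 : s = []
      · subst hs0
        have hpq : p ≠ q := by
          rw [e] at hnd; simp at hnd; grind
        have hadj : G.Adj p q := by
          rw [e] at hp
          exact hp.right.1
        rw [List.nil_append, EC_cons_cons, EC_singleton]
        have aux : ∀ v ∈ [p, q], G.Adj t v → (∃ z ∈ Z, G.Adj z v) → v = a ∨ v = b := by
          rintro v hv htv ⟨z, hz, hzv⟩
          have h1 := hmem v hv
          have h2 := hC v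
          simp at h1
          grind
        by_cases hpq' : p ∈ G.neighborSet t ∧ q ∈ G.neighborSet t
        · exfalso
          have h1 := aux p (by simp) hpq'.1 hpZ
          have h2 := aux q (by simp) hpq'.2 hqZ
          have := hab.2
          grind [adj_comm]
        · rw [if_neg hpq']; simp
      · by_cases hpost : post = []
        · by_cases hpre : pre = []
          · subst hpost hpre
            simp only [List.nil_append, List.cons.injEq] at e
            obtain ⟨rfl, e⟩ := e
            obtain ⟨rfl, e⟩ := List.append_inj' e rfl
            obtain rfl : b = q := by simpa using e
            by_contra hodd
            rw [Nat.not_even_iff_odd] at hodd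
            have hmZ : Anti G m Z := fun v hv z hz => by
              refine ⟨?_, fun h1 => hs v hv ⟨z, hz, h1.symm⟩⟩
              rintro rfl
              exact hs v hv (h.touch_mem hz)
            obtain ⟨D₁, c, c', D₂, e', hc, hc', h1, h2, -⟩ := h.exists_pair hp hs0 hpZ hqZ hmZ
              (by simp [ht, hta.ne, htb.ne]) hodd
            have e1 : D₁ = [] := by
              cases D₁ with
              | nil => rfl
              | cons x D₁ => simp at e' h1; rw [← e'.1] at h1; exact absurd hta h1.1.2
            have e2 : D₂ = [] := by
              rcases List.eq_nil_or_concat D₂ with h | ⟨D₂, x, rfl⟩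
              · exact h
              · have := congrArg List.reverse e'
                simp at this h2
                rw [← this.1] at h2
                exact absurd htb h2.2.2
            subst e1 e2
            have := congrArg List.length e'
            simp at this
            exact hm0 this
          · have e' : b :: (m.reverse ++ [a]) = post.reverse ++ q :: (s.reverse ++ p :: pre.reverse) := by
              have := congrArg List.reverse e
              simpa using this
            have := h.swap.even_segment hb ha hp.reverse_mid (by simpa using hC) (by simpa using ht) e'
              (by simpa using hqZ) (by simpa using hpZ) (by simpa using hs) (by simpa using hs0)
              (by simpa using hpre)
            rw [← EC_reverse]
            simpa using this
        · exact h.even_segment ha hb hp hC ht e hpZ hqZ hs hs0 hpost)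
      m.length [] a m rfl (h.touch_left ha) rfl
  grind

end Core
end ArtemisGraph

/-! ### A leap of `t` and the first vertex of `Z` over a hole -/

namespace ArtemisGraph
open SimpleGraph

variable {V : Type*} {G : SimpleGraph V}

namespace Core

variable {t : V} {Z : List V} {A B : Set V}

/-- The hole is `a' k σ k' a`; on `k σ k'`, `t` sees only `k` and `z` only `k'`. For `b ∈ B`, hats
and parities force in turn that `b` sees `k`, that the first neighbour `s` of `b` on the way from
`k'` to `k` comes just before `k`, and that `s` sees `Z`. Paths along `Z` to its first neighbour of
`s` then give the contradiction. -/
theorem false_of_leap (h : Core G t Z A B) {a a' k k' z : V} {Z' σ : List V} (hZ : Z = z :: Z')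
    (ha : a ∈ A) (ha' : a' ∈ A) (hk : k ∉ A) (hk' : k' ∉ A) (hS : IndPath G (k :: (σ ++ [k'])))
    (hak' : G.Adj a k') (hak : ¬ G.Adj a k) (ha'k : G.Adj a' k) (ha'k' : ¬ G.Adj a' k')
    (haσ : FarL G a σ) (ha'σ : FarL G a' σ) (htk : G.Adj t k) (htk' : Far G t k') (htσ : FarL G t σ)
    (hzk' : G.Adj z k') (hzk : Far G z k) (hzσ : FarL G z σ) : False := by
  have haa : G.Adj a a' := h.clique_left ha ha' (by rintro rfl; exact hak ha'k)
  have fak : Far G a k := ⟨by rintro rfl; exact hk ha, hak⟩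
  have fa'k' : Far G a' k' := ⟨by rintro rfl; exact hk' ha', ha'k'⟩
  obtain ⟨b, hb⟩ := h.nonempty_right
  have fab := h.far ha hb
  have fa'b := h.far ha' hb
  have hta := h.adj_left a ha
  have hta' := h.adj_left a' ha'
  have htb := h.adj_right b hb
  have hpZ : IndPath G (a :: (z :: (Z' ++ [b]))) := by simpa [hZ] using h.path a ha b hb
  have hpZ' : IndPath G (a' :: (z :: (Z' ++ [b]))) := by simpa [hZ] using h.path a' ha' b hb
  have htZ : FarL G t (z :: Z') := hZ ▸ h.anti
  have hZ'0 : Z' ≠ [] := by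
    have := h.two_le
    rintro rfl; simp [hZ] at this
  have hkZ : FarL G k Z := by
    intro v hv
    refine ⟨by rintro rfl; exact (h.anti _ hv).2 htk, fun hv' => ?_⟩
    rcases h.touch k htk ⟨v, hv, hv'.symm⟩ with h1 | h1 | h1
    · exact hk h1
    · exact (h.far ha' h1).2 ha'k
    · exact hak (h1.1 a ha).symm
  have fkk' : σ ≠ [] → Far G k k' := fun h => hS.far_ends h
  have hbσ : b ∉ σ := fun h => (htσ b h).2 htb
  have hbk' : b ≠ k' := by rintro rfl; exact htk'.2 htb
  have hbk : b ≠ k := by rintro rfl; exact fa'b.2 ha'k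
  have hSr : IndPath G (k' :: (σ.reverse ++ [k])) := hS.reverse_mid
  have hchain : List.IsChain G.Adj (b :: (Z'.reverse ++ [z])) := by
    have := (indPath_reverse.2 hpZ.tail).isChain
    simpa using this
  -- Otherwise `t` forms a hat with the edge `a' k` of the hole `a' z k' σ k`, which is reached
  -- through `b` and `Z'`.
  have hbk_adj : G.Adj b k := by
    by_contra hbk_adj
    have hat : Hat G a' (z :: k' :: σ.reverse) k t := by
      refine ⟨?_, ?_, ha'k, by simp, hta', htk, ?_⟩
      · refine ⟨hpZ'.1, by simp [fa'k', ha'σ], hzk', by simp [hzσ], ?_⟩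
        exact IndPath.left (l₂ := [k]) (by simpa using hSr)
      · exact ⟨hzk', by simp [hzσ, hzk], hSr⟩
      · simp at htZ; simp [htk', htσ, htZ]
    have hmem : Z'.head hZ'0 ∈ b :: Z'.reverse := by simp
    refine hat.false_of_chain h.ohf h.pf (w := b :: Z'.reverse) ?_ ?_ ?_
      ⟨Z'.head hZ'0, hmem, z, by simp, ?_⟩
    · refine List.isChain_cons_cons.2 ⟨htb, ?_⟩
      rw [← List.cons_append] at hchain
      exact hchain.left_of_append
    · have := hpZ'.2.1
      simp at this ⊢
      exact ⟨fa'b, this.1⟩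
    · simp [hZ] at hkZ
      simp [hkZ]
      exact ⟨hbk.symm, fun e => hbk_adj e.symm⟩
    · obtain ⟨c, Z', rfl⟩ := List.exists_cons_of_ne_nil hZ'0
      exact hpZ.tail.1.symm
  -- Otherwise `b` forms a hat with the edge `t k` of the hole `t a k' σ k`, which is reached
  -- through `Z` at `a`.
  have hbS : ∃ w ∈ k' :: σ.reverse, G.Adj b w := by
    by_contra hbS
    have hbF : FarL G b (k' :: σ.reverse) := by
      rcases farL_or_exists_adj (G := G) (f := b) (h := k' :: σ.reverse) (by simp [hbk', hbσ]) with h | h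
      · exact h
      · exact absurd h hbS
    have hat : Hat G t (a :: k' :: σ.reverse) k b := by
      refine ⟨?_, ?_, htk, by simp, htb.symm, hbk_adj, ?_⟩
      · refine ⟨hta, by simp [htk', htσ], hak', by simp [haσ], ?_⟩
        exact IndPath.left (l₂ := [k]) (by simpa using hSr)
      · exact ⟨hak', by simp [fak, haσ], hSr⟩
      · simp at hbF; simp [hbF, fab.symm]
    refine hat.false_of_chain h.ohf h.pf hchain ?_ ?_ ⟨z, by simp, a, by simp, hpZ.1.symm⟩
    · simp at htZ ⊢; exact htZ.symm
    · simp [hZ] at hkZ; simp [hkZ]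
  obtain ⟨l₁, s, l₂, e, hbs, hl₁⟩ := exists_first_adj hbS (by simp [hbk', hbσ])
  have hmem : ∀ v ∈ k' :: σ.reverse, Far G t v := by
    intro v hv; simp at hv; rcases hv with rfl | hv
    · exact htk'
    · exact htσ v hv
  have hsmem : s ∈ k' :: σ.reverse := by rw [e]; simp
  have hts := hmem s hsmem
  have hS1 : IndPath G (l₁ ++ s :: (l₂ ++ [k])) := by
    have := hSr
    rw [← List.cons_append, e] at this
    simpa using this
  have hhead : ∃ l, l₁ ++ [s] = k' :: l := by
    cases l₁ with
    | nil => simp at e; exact ⟨[], by simp [e.1]⟩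
    | cons x l₁ => simp at e; exact ⟨l₁ ++ [s], by simp [e.1]⟩
  obtain ⟨l, hl⟩ := hhead
  have hσ : σ.reverse = l ++ l₂ := by
    rw [List.append_cons, hl] at e
    simpa using e
  have hlσ : ∀ v ∈ l, v ∈ σ := by
    intro v hv
    rw [← List.mem_reverse, hσ]
    simp [hv]
  have hW : ∀ v ∈ l₁ ++ [s], v = k' ∨ v ∈ σ := by
    intro v hv
    rw [hl] at hv
    rcases List.mem_cons.1 hv with rfl | hv
    · exact .inl rfl
    · exact .inr (hlσ v hv)
  have ha'W : FarL G a' (l₁ ++ [s]) := by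
    intro v hv
    rcases hW v hv with rfl | hv
    · exact fa'k'
    · exact ha'σ v hv
  have hapath : IndPath G (a :: (l₁ ++ [s])) := by
    have h1 : IndPath G (l₁ ++ [s]) := IndPath.left (l₂ := l₂ ++ [k]) (by simpa using hS1)
    rw [hl] at h1 ⊢
    exact ⟨hak', haσ.mono hlσ, h1⟩
  have hab_path : IndPath G (a :: ((l₁ ++ [s]) ++ [b])) := by
    have := IndPath.concat (l := a :: l₁) (by simpa using hapath) hbs.symm (by simp [hl₁, fab.symm])
    simpa using this
  -- The second vertex of the path from `a` through `l₁` and `s` to `b` is not in `A` and the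
  -- penultimate one is not in `B`, so the path is even.
  have hl₁even : Even l₁.length := by
    by_contra hodd
    rcases h.odd_path ha hb hab_path (by simp; grind) with ⟨a'', ha'', m', e'⟩ | ⟨b', hb', m', e'⟩
    · rw [hl] at e'
      simp at e'
      exact hk' (e'.1 ▸ ha'')
    · have : s = b' := by
        have := congrArg List.reverse e'
        simp at this
        exact this.1
      exact hts.2 (this ▸ h.adj_right b' hb')
  -- If `s` and `k` are not consecutive, `b` closes the path `s, l₁, a, a', k` to an odd hole.
  have hl₂ : l₂ = [] := by
    by_contra hl₂
    have h1 : IndPath G (s :: (l₁.reverse ++ [a])) := by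
      have := indPath_reverse.2 hapath
      simpa using this
    have h2 := IndPath.concat (l := s :: l₁.reverse) (by simpa using h1) haa (by
      simp at ha'W ⊢; exact ha'W.symm)
    have h3 := IndPath.concat (l := s :: l₁.reverse ++ [a]) (by simpa using h2) ha'k (by
      obtain ⟨c, l₂, rfl⟩ := List.exists_cons_of_ne_nil hl₂
      have h4 : IndPath G ((l₁ ++ [s]) ++ c :: (l₂ ++ [k])) := by simpa using hS1
      have := h4.anti
      simp at this ⊢
      grind [far_comm])
    have := h.ohf.odd (u := b) (x := s) (y := k) (m := l₁.reverse ++ [a, a']) (by simpa using h3)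
      (by simp) hbs hbk_adj (by simp [hl₁, fab.symm, fa'b.symm])
    simp at this
    grind
  subst hl₂
  have hsk : G.Adj s k := hS1.right.1
  have hkl₁ : FarL G k l₁ := by
    have := hS1.anti
    simp at this
    exact this
  have hsZ' : s ∉ Z := fun hs => (hkZ s hs).2 hsk.symm
  -- Otherwise `b` forms a hat with the edge `k s` of the hole `k a' a l₁ s`, which is reached
  -- through `Z`.
  have hsZ : ∃ v ∈ Z, G.Adj s v := by
    by_contra hsZ
    have hsF : FarL G s Z := by
      rcases farL_or_exists_adj (G := G) hsZ' with h | h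
      · exact h
      · exact absurd h hsZ
    have hat : Hat G k (a' :: a :: l₁) s b := by
      refine ⟨⟨ha'k.symm, by simp [fak.symm, hkl₁], haa.symm, ?_, ?_⟩, ⟨haa.symm, ha'W, hapath⟩, hsk.symm,
        by simp, hbk_adj, hbs, by simp [fab.symm, fa'b.symm, hl₁]⟩
      · simp at ha'W; exact ha'W.1
      · exact IndPath.left (l₂ := [s]) (by simpa using hapath)
    refine hat.false_of_chain h.ohf h.pf hchain ?_ ?_ ⟨z, by simp, a, by simp, hpZ.1.symm⟩
    · simp [hZ] at hkZ; simp [hkZ]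
    · simp [hZ] at hsF; simp [hsF]
  obtain ⟨Z₁, zi, Z₂, eZ, hszi, hsZ₁⟩ := exists_first_adj hsZ hsZ'
  have hpi : ∀ a ∈ A, IndPath G ((a :: Z₁) ++ [zi]) := by
    intro a ha
    have := h.path a ha b hb
    rw [eZ] at this
    exact IndPath.left (l₂ := Z₂ ++ [b]) (by simpa using this)
  have hsW := hW s (by simp)
  -- If the first neighbour of `s` is `z`, then `a' z k' b` is an odd path forbidden by `odd_path`.
  -- Otherwise the path from `a'` along `Z` to `s` is closed by `k`, and the one from `a` along `Z`
  -- to `s` and on to `k` is closed by `t`; the two holes differ in length by one.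
  cases Z₁ with
  | nil =>
    obtain rfl : z = zi := by rw [hZ] at eZ; simp at eZ; exact eZ.1
    obtain rfl : s = k' := by
      rcases hsW with h | h
      · exact h
      · exact absurd hszi.symm (hzσ s h).2
    have hp : IndPath G (a' :: ([z, s] ++ [b])) := by
      have hzb : Far G z b := hpZ.tail.far_ends hZ'0
      refine ⟨hpZ'.1, by simp [fa'k', fa'b], hzk', by simp [hzb], indPath_pair.2 hbs.symm⟩
    rcases h.odd_path ha' hb hp (by simp) with ⟨a'', ha'', m', e'⟩ | ⟨b', hb', m', e'⟩
    · simp at e'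
      have := h.adj_left a'' ha''
      rw [← e'.1] at this
      simp at htZ
      exact htZ.1.2 this
    · have : s = b' := by
        have := congrArg List.reverse e'
        simp at this
        exact this.1
      exact hts.2 (this ▸ h.adj_right b' hb')
  | cons z₁ Z₁ =>
    obtain rfl : z = z₁ := by rw [hZ] at eZ; simp at eZ; exact eZ.1
    have hsσ : s ∈ σ := by
      rcases hsW with rfl | h
      · exact absurd hzk'.symm (hsZ₁ z (by simp)).2
      · exact h
    have hkZ₁ := hkZ
    rw [eZ] at hkZ₁
    have htZ₁ := h.anti
    rw [eZ] at htZ₁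
    simp at hkZ₁ htZ₁ hsZ₁
    have c1 := IndPath.concat (hpi a' ha') hszi.symm (by simp [hsZ₁, (ha'σ s hsσ).symm])
    have c2 := IndPath.concat (hpi a ha) hszi.symm (by simp [hsZ₁, (haσ s hsσ).symm])
    have c3 := IndPath.concat (l := (a :: z :: Z₁) ++ [zi]) (by simpa using c2) hsk
      (by simp [hkZ₁, fak.symm])
    have o1 := h.ohf.odd (u := k) (x := a') (y := s) (m := z :: (Z₁ ++ [zi])) (by simpa using c1) (by simp)
      ha'k.symm hsk.symm (by simp [hkZ₁])
    have o2 := h.ohf.odd (u := t) (x := a) (y := k) (m := z :: (Z₁ ++ [zi, s])) (by simpa using c3) (by simp)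
      hta htk (by simp [htZ₁, hts])
    simp at o1 o2
    grind

end Core
end ArtemisGraph

/-! ### Nested neighbourhoods in `A` -/

namespace ArtemisGraph
open SimpleGraph

variable {V : Type*} {G : SimpleGraph V}

/-- The same count as for a path, except that `x` and `y` may be adjacent. A neighbour of `u` in `m`
ensures that no gap is all of `m`, so every gap is still a chordless path. -/
theorem OddHoleFree.odd_EC_of_hole (hG : OddHoleFree G) {x y u : V} {m : List V}
    (h₁ : IndPath G (x :: m)) (h₂ : IndPath G (m ++ [y])) (hx : G.Adj u x) (hy : G.Adj u y) (hu : u ∉ m)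
    (hm : ∃ v ∈ m, G.Adj u v) (hev : Even m.length) :
    Odd (EC (G.neighborSet u) (x :: (m ++ [y]))) := by
  have : Even (EC (G.neighborSet u) (x :: (m ++ [y])) + (m.length + 1)) := by
    refine EC_parity hx hy ?_
    intro pre p s q post e hp hq hs h0
    have hpath : IndPath G (p :: (s ++ [q])) := by
      by_cases hpost : post = []
      · have hpre : pre ≠ [] := by
          rintro rfl
          subst hpost
          simp only [List.nil_append, List.cons.injEq] at e
          obtain ⟨rfl, e⟩ := List.append_inj' e.2 rfl
          obtain ⟨v, hv, huv⟩ := hm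
          exact hs v hv huv
        obtain ⟨c, pre, rfl⟩ := List.exists_cons_of_ne_nil hpre
        simp only [List.cons_append, List.cons.injEq] at e
        rw [e.2] at h₂
        subst hpost
        exact h₂.right
      · obtain ⟨post', c, rfl⟩ : ∃ post' c, post = post' ++ [c] := by
          rcases List.eq_nil_or_concat post with h | ⟨post', c, h⟩
          · exact absurd h hpost
          · exact ⟨post', c, by simpa using h⟩
        have e' : x :: m = pre ++ p :: (s ++ q :: post') := by
          have : (x :: m) ++ [y] = (pre ++ p :: (s ++ q :: post')) ++ [c] := by simpa using e
          exact (List.append_inj' this rfl).1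
        rw [e'] at h₁
        exact IndPath.left (l₂ := post') (by simpa using h₁.right)
    refine hG.odd hpath h0 hp hq fun w hw => ⟨?_, hs w hw⟩
    rintro rfl
    have hmem : u ∈ x :: (m ++ [y]) := by rw [e]; simp [hw]
    simp only [List.mem_cons, List.mem_append, List.not_mem_nil, or_false] at hmem
    rcases hmem with rfl | h' | rfl
    · exact G.loopless.irrefl _ hx
    · exact hu h'
    · exact G.loopless.irrefl _ hy
  grind

theorem LinkIn.exists_chain_mem {H : SimpleGraph V} {S : Set V} {u v : V} (h : LinkIn H S u v) :
    ∃ w, List.IsChain H.Adj (u :: w) ∧ (∀ x ∈ w, x ∈ S) ∧ v ∈ u :: w := by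
  induction h using Relation.ReflTransGen.head_induction_on with
  | refl => exact ⟨[], by simp, by simp, by simp⟩
  | @head a c hac hcv ih =>
    obtain ⟨w, hw, hwS, hv⟩ := ih
    exact ⟨c :: w, List.isChain_cons_cons.2 ⟨hac.1, hw⟩, by simpa using ⟨hac.2.2, hwS⟩,
      List.mem_cons_of_mem _ hv⟩

namespace Core

variable {t : V} {Z : List V} {A B : Set V}

/-- The neighbourhoods in `A` of the vertices that see a connected set `M` which is anticomplete
to `A` and contains `B` and `Z` without its first vertex are linearly ordered by inclusion. -/
theorem no_crossing (h : Core G t Z A B) {M : Set V} (hM : ConnIn G M) (hBM : B ⊆ M)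
    (hZM : ∀ v ∈ Z.tail, v ∈ M) (hAM : ∀ a ∈ A, ∀ v ∈ M, Far G a v) {a a' k k' : V} (ha : a ∈ A)
    (ha' : a' ∈ A) (hk : k ∉ A) (hk' : k' ∉ A) (hkM : ∃ v ∈ M, G.Adj v k) (hkM' : ∃ v ∈ M, G.Adj v k')
    (hak' : G.Adj a k') (hak : ¬ G.Adj a k) (ha'k : G.Adj a' k) (ha'k' : ¬ G.Adj a' k') : False := by
  classical
  have haa : G.Adj a a' := h.clique_left ha ha' (by rintro rfl; exact hak ha'k)
  have fak : Far G a k := ⟨by rintro rfl; exact hk ha, hak⟩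
  have fa'k' : Far G a' k' := ⟨by rintro rfl; exact hk' ha', ha'k'⟩
  have hkk : k ≠ k' := by rintro rfl; exact hak hak'
  obtain ⟨σ, hσ, hσM⟩ := hM.exists_indPath hkk hkM hkM'
  have haσ : FarL G a σ := fun v hv => hAM a ha v (hσM v hv)
  have ha'σ : FarL G a' σ := fun v hv => hAM a' ha' v (hσM v hv)
  obtain ⟨z, Z', hZ⟩ := List.exists_cons_of_ne_nil h.ne_nil
  have hZ'0 : Z' ≠ [] := by
    have := h.two_le
    rintro rfl; simp [hZ] at this
  obtain ⟨z₂, Z₂, rfl⟩ := List.exists_cons_of_ne_nil hZ'0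
  obtain ⟨b, hb⟩ := h.nonempty_right
  have hpZ : ∀ a ∈ A, IndPath G (a :: (z :: ((z₂ :: Z₂) ++ [b]))) := fun a ha => by
    simpa [hZ] using h.path a ha b hb
  have h₁ : IndPath G (a' :: (k :: (σ ++ [k']))) := ⟨ha'k, by simp [ha'σ, fa'k'], hσ⟩
  have h₂ : IndPath G ((k :: (σ ++ [k'])) ++ [a]) := by
    have := IndPath.concat (l := k :: σ) (by simpa using hσ) hak'.symm (by simp [fak, haσ])
    simpa using this
  have hσeven : Even σ.length := by
    by_cases h0 : σ = []
    · simp [h0]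
    have hfar := hσ.far_ends h0
    have hp : IndPath G (k :: ([a', a] ++ [k'])) :=
      ⟨ha'k.symm, by simp [fak.symm, hfar], haa.symm, by simp [fa'k'], indPath_pair.2 hak'⟩
    have := h.ohf.even hσ hp h0 (by simp) (by simp [haσ, ha'σ])
    simpa [Nat.even_add] using this
  have notMem : ∀ u, (∀ a ∈ A, G.Adj u a) → u ∉ k :: (σ ++ [k']) := by
    intro u hu hmem
    simp only [List.mem_cons, List.mem_append, List.not_mem_nil, or_false] at hmem
    rcases hmem with rfl | hmem | rfl
    · exact hak (hu a ha).symm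
    · exact (haσ u hmem).2 (hu a ha).symm
    · exact ha'k' (hu a' ha').symm
  -- A vertex complete to `A` that misses the rest of the hole forms a hat with the edge `a a'`. If
  -- it also sees the connected set `M`, a chain through `M` leads from it to a neighbour of `k`.
  have htouch : ∀ u v, (∀ a ∈ A, G.Adj u a) → v ∈ M → G.Adj u v → ∃ w ∈ k :: (σ ++ [k']), G.Adj u w := by
    intro u v hu hv huv
    by_contra hcon
    have hF : FarL G u (k :: (σ ++ [k'])) := by
      rcases farL_or_exists_adj (G := G) (notMem u hu) with h | h
      · exact h
      · exact absurd h hcon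
    have hat : Hat G a' (k :: (σ ++ [k'])) a u := ⟨h₁, h₂, haa.symm, by simp, hu a' ha', hu a ha, hF⟩
    obtain ⟨n, hn, hnk⟩ := hkM
    obtain ⟨w, hw, hwM, hnw⟩ := (hM v hv n hn).exists_chain_mem
    have hwM' : ∀ x ∈ v :: w, x ∈ M := by simpa using ⟨hv, hwM⟩
    exact hat.false_of_chain h.ohf h.pf (w := v :: w) (List.isChain_cons_cons.2 ⟨huv, hw⟩)
      (fun x hx => hAM a' ha' x (hwM' x hx)) (fun x hx => hAM a ha x (hwM' x hx))
      ⟨n, hnw, k, by simp, hnk⟩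
  have htA := h.adj_left
  have hzA : ∀ a ∈ A, G.Adj z a := fun a ha => (hpZ a ha).1.symm
  have htz : ¬ G.Adj t z := (h.anti z (by simp [hZ])).2
  have htne : t ≠ z := (h.anti z (by simp [hZ])).1
  have ht_touch := htouch t b htA (hBM hb) (h.adj_right b hb)
  have hz_touch := htouch z z₂ hzA (hZM z₂ (by simp [hZ])) (hpZ a ha).tail.1
  have hzb : Far G z b := (hpZ a ha).tail.far_ends (by simp)
  have hodd : ∀ u, u = t ∨ u = z →
      Odd (EC (G.neighborSet u) (a' :: ((k :: (σ ++ [k'])) ++ [a]))) := by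
    rintro u (rfl | rfl)
    · exact h.ohf.odd_EC_of_hole h₁ h₂ (htA a' ha') (htA a ha) (notMem u htA) ht_touch
        (by simp; grind)
    · exact h.ohf.odd_EC_of_hole h₁ h₂ (hzA a' ha') (hzA a ha) (notMem u hzA) hz_touch
        (by simp; grind)
  -- Both `t` and `z` are complete to `A` and see `M`, so each of them sees an odd number of edges
  -- of `a' k σ k' a`. By `touch`, no vertex of `k σ k'` sees both, so there is a leap.
  obtain ⟨p, s, q, t₁, t₂, e, ht₁, ht₂, hp, hq, hpq, hs⟩ := h.ohf.exists_leap (T := {t, z})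
    (by rw [Finset.card_pair htne]) (by simp; exact ⟨htz, fun h => htz h.symm⟩)
    h₁ h₂ (by simp) (by simp; grind) (by
      intro v hv hvT
      simp only [Finset.mem_insert, Finset.mem_singleton] at hvT
      rcases hvT with rfl | rfl
      · exact notMem v htA hv
      · exact notMem v hzA hv)
    (by simp; exact ⟨htA a' ha', hzA a' ha'⟩) (by simp; exact ⟨htA a ha, hzA a ha⟩)
    (by
      intro v hv
      by_contra! hcon
      have htv : G.Adj t v := hcon t (by simp)
      have hzv : G.Adj z v := hcon z (by simp)
      rcases h.touch v htv ⟨z, by simp [hZ], hzv⟩ with h1 | h1 | h1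
      · simp only [List.mem_cons, List.mem_append, List.not_mem_nil, or_false] at hv
        rcases hv with rfl | hv | rfl
        · exact hk h1
        · exact (hAM v h1 v (hσM v hv)).1 rfl
        · exact hk' h1
      · exact ((hpZ a ha).tail.far_ends (by simp)).2 (by
          have := h.path a ha v h1
          rw [hZ] at this
          exact absurd hzv (this.tail.far_ends (by simp)).2)
      · exact notMem v h1.1 hv)
    (by
      intro X hX hX0
      have hcard := Finset.card_lt_card hX
      rw [Finset.card_pair htne] at hcard
      have := hX0.card_pos
      obtain ⟨u, rfl⟩ := Finset.card_eq_one.1 (show X.card = 1 by omega)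
      have hu : u = t ∨ u = z := by simpa using hX.subset (Finset.mem_singleton_self u)
      have e : Comp G (({u} : Finset V) : Set V) = G.neighborSet u := by ext; simp [mem_comp]
      rw [e]
      exact hodd u hu)
  simp only [List.cons.injEq] at e
  obtain ⟨rfl, e⟩ := e
  obtain ⟨rfl, e⟩ := List.append_inj' e rfl
  obtain rfl : k' = q := by simpa using e
  have htσ := hs t (by simp)
  have hzσ := hs z (by simp)
  have ht' := hpq t (by simp)
  have hz' := hpq z (by simp)
  have nt := notMem t htA
  have nz := notMem z hzA
  simp at nt nz ht₁ ht₂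
  have aux : (G.Adj t k ∧ G.Adj z k') ∨ (G.Adj z k ∧ G.Adj t k') := by grind
  rcases aux with ⟨h5, h6⟩ | ⟨h5, h6⟩
  · exact h.false_of_leap hZ ha ha' hk hk' hσ hak' hak ha'k ha'k' haσ ha'σ h5 ⟨nt.2.2, by grind⟩ htσ h6
      ⟨nz.1, by grind⟩ hzσ
  · exact h.false_of_leap hZ ha' ha hk' hk hσ.reverse_mid ha'k ha'k' hak' hak (by simpa) (by simpa) h6
      ⟨nt.1, by grind⟩ (by simpa) h5 ⟨nz.2.2, by grind⟩ (by simpa)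

end Core
end ArtemisGraph

/-! ### Prisms with a broken rung -/

namespace ArtemisGraph
open SimpleGraph

variable {V : Type*} {G : SimpleGraph V}

/-- Two rungs `a₁ m₁ b₁`, `a₂ m₂ b₂` of a prism and the two pieces `a₃ p`, `b₃ q` of a broken third
rung. -/
structure OpenRung (G : SimpleGraph V) (a₁ : V) (m₁ : List V) (b₁ a₂ : V) (m₂ : List V) (b₂ a₃ : V)
    (p : List V) (b₃ : V) (q : List V) : Prop where
  p₁ : IndPath G (a₁ :: (m₁ ++ [b₁]))
  p₂ : IndPath G (a₂ :: (m₂ ++ [b₂]))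
  pa : IndPath G (a₃ :: p)
  pb : IndPath G (b₃ :: q)
  anti : Anti G (a₃ :: p) (b₃ :: q)
  h₁₂ : Cross G a₁ m₁ b₁ a₂ m₂ b₂
  a₁₃ : G.Adj a₁ a₃
  a₂₃ : G.Adj a₂ a₃
  b₁₃ : G.Adj b₁ b₃
  b₂₃ : G.Adj b₂ b₃
  far_a₁ : FarL G a₃ (m₁ ++ [b₁])
  far_a₂ : FarL G a₃ (m₂ ++ [b₂])
  far_b₁ : FarL G b₃ (a₁ :: m₁)
  far_b₂ : FarL G b₃ (a₂ :: m₂)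
  anti_p₁ : Anti G p (a₁ :: (m₁ ++ [b₁]))
  anti_p₂ : Anti G p (a₂ :: (m₂ ++ [b₂]))
  anti_q₁ : Anti G q (a₁ :: (m₁ ++ [b₁]))
  anti_q₂ : Anti G q (a₂ :: (m₂ ++ [b₂]))

section OpenRung

variable {a₁ b₁ a₂ b₂ a₃ b₃ t : V} {m₁ m₂ p q : List V}

theorem OpenRung.swap (h : OpenRung G a₁ m₁ b₁ a₂ m₂ b₂ a₃ p b₃ q) :
    OpenRung G a₂ m₂ b₂ a₁ m₁ b₁ a₃ p b₃ q :=
  ⟨h.p₂, h.p₁, h.pa, h.pb, h.anti, h.h₁₂.symm, h.a₂₃, h.a₁₃, h.b₂₃, h.b₁₃, h.far_a₂, h.far_a₁,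
    h.far_b₂, h.far_b₁, h.anti_p₂, h.anti_p₁, h.anti_q₂, h.anti_q₁⟩

theorem OpenRung.flip (h : OpenRung G a₁ m₁ b₁ a₂ m₂ b₂ a₃ p b₃ q) :
    OpenRung G b₁ m₁.reverse a₁ b₂ m₂.reverse a₂ b₃ q a₃ p := by
  obtain ⟨h1, h2, h3, h4, h5, h6, h7, h8, h9, h10, h11, h12, h13, h14, h15, h16, h17, h18⟩ := h
  refine ⟨h1.reverse_mid, h2.reverse_mid, h4, h3, h5.symm, h6.flip, h9, h10, h7, h8, ?_, ?_, ?_, ?_, ?_,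
    ?_, ?_, ?_⟩
  all_goals simp at *; grind

/-- Each piece is cut at its first neighbour of `t`, and `t` mends the rung. -/
theorem OpenRung.exists_defectRung (h : OpenRung G a₁ m₁ b₁ a₂ m₂ b₂ a₃ p b₃ q)
    (n₁ : t ∉ a₁ :: (m₁ ++ [b₁])) (n₂ : t ∉ a₂ :: (m₂ ++ [b₂])) (n₃ : t ∉ a₃ :: p) (n₄ : t ∉ b₃ :: q)
    (hp : ∃ v ∈ a₃ :: p, G.Adj t v) (hq : ∃ v ∈ b₃ :: q, G.Adj t v) :
    ∃ p' q', DefectRung G a₁ m₁ b₁ a₂ m₂ b₂ a₃ p' t q' b₃ := by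
  obtain ⟨p', hp', hpt⟩ := h.pa.exists_shortcut n₃ hp
  obtain ⟨q', hq', hqt⟩ := h.pb.exists_shortcut n₄ hq
  have hq'' : q'.reverse ⊆ q := by intro v hv; exact hq' (by simpa using hv)
  refine ⟨p', q'.reverse, h.p₁, h.p₂, ?_, h.h₁₂, h.a₁₃, h.a₂₃, h.b₁₃, h.b₂₃, h.far_a₁, h.far_a₂, h.far_b₁,
    h.far_b₂, ?_, ?_, n₁, n₂⟩
  · rw [← List.cons_append]
    refine indPath_append.2 ⟨hpt, hqt.reverse_mid, h.anti.mono ?_ ?_⟩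
    · intro v; simp; grind
    · intro v; simp; have := @hq' v; grind
  · exact (Anti.mono (l₁ := p ++ q) (by simpa using ⟨h.anti_p₁, h.anti_q₁⟩)
      (List.append_subset.2 ⟨List.subset_append_of_subset_left _ hp',
        List.subset_append_of_subset_right _ hq''⟩) (by simp))
  · exact (Anti.mono (l₁ := p ++ q) (by simpa using ⟨h.anti_p₂, h.anti_q₂⟩)
      (List.append_subset.2 ⟨List.subset_append_of_subset_left _ hp',
        List.subset_append_of_subset_right _ hq''⟩) (by simp))

end OpenRung

namespace Core

variable {t : V} {Z : List V} {A B : Set V} {a₁ b₁ a₂ b₂ a₃ b₃ : V} {m₁ m₂ p q : List V}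

/-- Otherwise the way from `a₃` along `p`, `Z` and `q` to `b₃` contains no neighbour of `a₁` or `a₂`
after `a₃`, and `a₃` forms a hat with the edge `a₁ a₂`. -/
theorem touch_of_openRung (h : Core G t Z A B) (ho : OpenRung G a₁ m₁ b₁ a₂ m₂ b₂ a₃ p b₃ q) {a b : V}
    {p' q' : List V} (ha : a ∈ A) (hb : b ∈ B) (hp : a₃ :: p = p' ++ [a]) (hq : b₃ :: q = q' ++ [b]) :
    (∃ z ∈ Z, G.Adj z a₁) ∨ ∃ z ∈ Z, G.Adj z a₂ := by
  by_contra! hcon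
  obtain ⟨p1, p2, pa, pb, an, h12, h13, h23, k13, k23, fa1, fa2, fb1, fb2, ap1, ap2, aq1, aq2⟩ := ho
  have hc := h12.cyc p1 p2
  have hat : Hat G a₁ (m₁ ++ b₁ :: b₂ :: m₂.reverse) a₂ a₃ := by
    refine ⟨Cyc.indPath (l₂ := [a₂]) (by simpa using hc) (by simp), ?_, h12.1, by simp; omega,
      h13.symm, h23.symm, ?_⟩
    · refine Cyc.indPath (l₂ := [a₁]) ?_ (by simp)
      simpa using hc.rotate_one
    · simp at *; grind
  have hZ : ∀ x, (∀ z ∈ Z, ¬ G.Adj z x) → FarL G x Z := by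
    intro x hx v hv
    refine ⟨?_, fun e => hx v hv e.symm⟩
    rintro rfl
    obtain ⟨z, hz, hzx⟩ := h.touch_mem hv
    exact hx z hz hzx
  have hchain : List.IsChain G.Adj (a₃ :: (p ++ (Z ++ (b₃ :: q).reverse))) := by
    rw [← List.cons_append, hp]
    have h1 := (h.path a ha b hb).isChain
    have h2 : List.IsChain G.Adj (b₃ :: q).reverse := (indPath_reverse.2 pb).isChain
    rw [hp] at pa
    rw [hq] at h2 ⊢
    simp only [List.reverse_append, List.reverse_singleton, List.singleton_append] at h2 ⊢
    have h3 : List.IsChain G.Adj (p' ++ [a]) := pa.isChain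
    have h4 : List.IsChain G.Adj ((a :: Z) ++ b :: q'.reverse) := by
      rw [List.isChain_split]
      exact ⟨by simpa using h1, h2⟩
    rw [List.append_assoc, List.singleton_append, List.isChain_split]
    exact ⟨h3, by simpa using h4⟩
  refine hat.false_of_chain h.ohf h.pf hchain ?_ ?_ ⟨b₃, by simp, b₁, by simp, k13.symm⟩
  · have := hZ a₁ hcon.1
    simp at *; grind [far_comm]
  · have := hZ a₂ hcon.2
    simp at *; grind [far_comm]

/-- Mending the rung with `t` shows that `t` sees two of `a₁`, `a₂`, `a₃`. It misses `a₂`, which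
sees `Z`, so it sees `a₁` and `a₃`. Take the path from `a₂` through `a₁` towards `b` and that from
`a₂` through `a₃` towards `a`, both stopped at the first later vertex that sees `Z`, and the path
between their ends through `a₃ a₁`. Each has an even number of edges seen by `t`, yet the last
number is the sum of the other two plus one for `a₃ a₁`. -/
theorem false_of_openRung_aux (h : Core G t Z A B) (ho : OpenRung G a₁ m₁ b₁ a₂ m₂ b₂ a₃ p b₃ q)
    {a b : V} {p' q' : List V} (ha : a ∈ A) (hb : b ∈ B) (hp : a₃ :: p = p' ++ [a])
    (hq : b₃ :: q = q' ++ [b])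
    (n₁ : t ∉ a₁ :: (m₁ ++ [b₁])) (n₂ : t ∉ a₂ :: (m₂ ++ [b₂])) (n₃ : t ∉ a₃ :: p) (n₄ : t ∉ b₃ :: q)
    (hM : ∀ v, v ∈ a₁ :: (m₁ ++ [b₁]) ∨ v ∈ a₂ :: (m₂ ++ [b₂]) ∨ v ∈ a₃ :: p ∨ v ∈ b₃ :: q →
      G.Adj t v → (∃ z ∈ Z, G.Adj z v) → v = a ∨ v = b)
    (ha₂ : ∃ z ∈ Z, G.Adj z a₂) : False := by
  have haτ := h.touch_left ha
  have hbτ := h.touch_right hb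
  have hap : a ∈ a₃ :: p := by rw [hp]; simp
  have hbq : b ∈ b₃ :: q := by rw [hq]; simp
  obtain ⟨pd, qd, hdef⟩ := ho.exists_defectRung n₁ n₂ n₃ n₄ ⟨a, hap, h.adj_left a ha⟩
    ⟨b, hbq, h.adj_right b hb⟩
  have h23 := hdef.two_of_three h.ohf h.pf
  obtain ⟨p1, p2, pa, pb, an, h12, h13, h23', k13, k23, fa1, fa2, fb1, fb2, ap1, ap2, aq1, aq2⟩ := ho
  have hA1 : Anti G (a₃ :: p) (m₁ ++ b₁ :: b₃ :: q) := by simp at *; grind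
  have hB1 : FarL G a₁ (b₃ :: q) := by simp at *; grind [far_comm]
  have hA2 : FarL G a₂ (m₁ ++ b₁ :: b₃ :: q) := by
    clear pa pb hp hq hM; simp [Cross] at *; grind [far_comm]
  have hA2p : FarL G a₂ p := by simp at *; grind [far_comm]
  have hA1p : FarL G a₁ p := by simp at *; grind [far_comm]
  have hab1 : a ≠ a₁ := by
    rintro rfl
    rcases List.mem_cons.1 hap with rfl | h'
    · exact h13.ne rfl
    · exact (hA1p a h').1 rfl
  have hab2 : a ≠ a₂ := by
    rintro rfl
    rcases List.mem_cons.1 hap with rfl | h'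
    · exact h23'.ne rfl
    · exact (hA2p a h').1 rfl
  have hbb1 : b ≠ a₁ := fun e => (hB1 b hbq).1 e.symm
  have hbb2 : b ≠ a₂ := fun e => (hA2 b (by simp at hbq ⊢; grind)).1 e.symm
  have ht₂ : ¬ G.Adj t a₂ := fun e => by
    rcases hM a₂ (by simp) e ha₂ with h | h
    · exact hab2 h.symm
    · exact hbb2 h.symm
  have ht₁ : G.Adj t a₁ := by tauto
  have ht₃ : G.Adj t a₃ := by tauto
  have hτ₁ : ¬ ∃ z ∈ Z, G.Adj z a₁ := fun e => by
    rcases hM a₁ (by simp) ht₁ e with h | h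
    · exact hab1 h.symm
    · exact hbb1 h.symm
  have hτZ : ∀ l : List V, (∀ v ∈ l, ¬ ∃ z ∈ Z, G.Adj z v) → Anti G l Z := fun l hl v hv z hz => by
    refine ⟨?_, fun e => hl v hv ⟨z, hz, e.symm⟩⟩
    rintro rfl
    exact hl v hv (h.touch_mem hz)
  -- the path from `a₁` to `b`
  have hW : IndPath G (a₁ :: (m₁ ++ b₁ :: b₃ :: q)) := by
    rw [← List.cons_append]
    refine indPath_append.2 ⟨p1, ⟨k13, ?_, pb⟩, ?_⟩
    · simp at aq1; grind
    · simp at *; grind [anti_comm, far_comm]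
  obtain ⟨u, d', u', eu, hd', hu⟩ := exists_first_split (fun v => ∃ z ∈ Z, G.Adj z v)
    (l := m₁ ++ b₁ :: b₃ :: q) ⟨b, by simp at hbq ⊢; grind, hbτ⟩
  obtain ⟨w, d, w', ew, hd, hw⟩ := exists_first_split (fun v => ∃ z ∈ Z, G.Adj z v)
    (l := a₃ :: p) ⟨a, hap, haτ⟩
  obtain ⟨w₂, ew₂⟩ : ∃ w₂, w ++ [d] = a₃ :: w₂ := by
    cases w with
    | nil => simp at ew; exact ⟨[], by simp [ew.1]⟩
    | cons x w => simp at ew; exact ⟨w ++ [d], by simp [ew.1]⟩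
  have eww : p = w₂ ++ w' := by
    rw [List.append_cons, ew₂] at ew
    simpa using ew
  have humem : ∀ v ∈ u ++ [d'], v ∈ m₁ ++ b₁ :: b₃ :: q := by
    intro v hv; rw [eu]; simp at hv ⊢; grind
  have hwmem : ∀ v ∈ a₃ :: w₂, v ∈ a₃ :: p := by
    intro v hv; rw [eww]; simp at hv ⊢; grind
  have hMu : ∀ v ∈ u ++ [d'], G.Adj t v → (∃ z ∈ Z, G.Adj z v) → v = b := by
    intro v hv htv hzv
    have h1 := humem v hv
    rcases hM v (by simp at h1 ⊢; grind) htv hzv with rfl | h2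
    · exact absurd rfl (hA1 v hap v h1).1
    · exact h2
  have hMw : ∀ v ∈ a₃ :: w₂, G.Adj t v → (∃ z ∈ Z, G.Adj z v) → v = a := by
    intro v hv htv hzv
    have h1 := hwmem v hv
    rcases hM v (.inr (.inr (.inl h1))) htv hzv with h2 | rfl
    · exact h2
    · exact absurd rfl (an v h1 v hbq).1
  have hbw : ∀ v ∈ a₃ :: w₂, Far G b v := fun v hv => (an v (hwmem v hv) b hbq).symm
  have hbu : b ≠ d' → ∀ v ∈ a₁ :: (u ++ [d']), G.Adj t v → Far G b v := by
    intro hbd v hv htv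
    rcases List.eq_nil_or_concat u' with rfl | ⟨u'', x, rfl⟩
    · exfalso
      have h1 : (m₁ ++ b₁ :: q') ++ [b] = u ++ [d'] := by
        rw [← eu, hq]; simp
      exact hbd (by simpa using (List.append_inj' h1 rfl).2)
    have hxb : b = x := by
      have h1 : (m₁ ++ b₁ :: q') ++ [b] = (u ++ d' :: u'') ++ [x] := by
        have : (u ++ d' :: u'') ++ [x] = u ++ d' :: (u''.concat x) := by simp
        rw [this, ← eu, hq]; simp
      simpa using (List.append_inj' h1 rfl).2
    subst hxb
    rw [eu] at hW
    have h2 : Anti G (a₁ :: u) (u'' ++ [b]) := by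
      refine IndPath.anti (x := d') ?_
      simpa using hW
    by_cases hvd : v = d'
    · subst hvd
      exact absurd (hMu v (by simp) htv hd').symm hbd
    · exact (h2 v (by simp at hv ⊢; grind) b (by simp)).symm
  have hpu : IndPath G (a₁ :: (u ++ [d'])) := by
    rw [eu] at hW
    exact IndPath.left (l₂ := u') (by simpa using hW)
  have hpw : IndPath G (a₃ :: w₂) := by
    rw [eww] at pa
    exact IndPath.left (l₂ := w') (by simpa using pa)
  have hbmem : b ∈ a₁ :: (u ++ [d']) → b = d' := by
    intro hmem
    simp only [List.mem_cons, List.mem_append, List.not_mem_nil, or_false] at hmem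
    rcases hmem with h1 | h1 | h1
    · exact absurd h1 hbb1
    · exact absurd hbτ (hu b h1)
    · exact h1
  have htu : t ∉ a₁ :: (u ++ [d']) := fun h1 => by
    simp only [List.mem_cons] at h1
    rcases h1 with rfl | h1
    · simp at n₁
    · have := humem t h1
      simp at this n₁ n₄; grind
  have htw : t ∉ a₃ :: w₂ := fun h1 => n₃ (hwmem t h1)
  have hta₂ : t ≠ a₂ := by rintro rfl; simp at n₂
  have htb := h.adj_right b hb
  have pairmem : ∀ {D D₁ D₂ : List V} {c c' : V}, D = D₁ ++ c :: c' :: D₂ → FarL G t D₁ → FarL G t D₂ →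
      ∀ v ∈ D, G.Adj t v → v = c ∨ v = c' := by
    rintro D D₁ D₂ c c' rfl h1 h2 v hv htv
    have h3 := h1 v
    have h4 := h2 v
    simp only [Far] at h3 h4
    simp at hv
    grind
  have E1 : Even (EC (G.neighborSet t) (a₂ :: ((a₁ :: u) ++ [d']))) := by
    by_contra hodd
    rw [Nat.not_even_iff_odd] at hodd
    have hD : IndPath G (a₂ :: ((a₁ :: u) ++ [d'])) := ⟨h12.1.symm, hA2.mono humem, hpu⟩
    obtain ⟨D₁, c, c', D₂, e', hc, hc', f1, f2, hfalse, -⟩ := h.exists_pair hD (by simp) ha₂ hd'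
      (hτZ _ (by simpa using ⟨by simpa using hτ₁, by simpa using hu⟩)) (by simp at htu ⊢; grind) hodd
    have hcD : c ∈ a₂ :: ((a₁ :: u) ++ [d']) := by rw [e']; simp
    have hcD' : c' ∈ a₂ :: ((a₁ :: u) ++ [d']) := by rw [e']; simp
    have hmem : ∀ c ∈ a₂ :: ((a₁ :: u) ++ [d']), G.Adj t c → c ∈ a₁ :: (u ++ [d']) := by
      intro c h1 h2
      rcases List.mem_cons.1 h1 with rfl | h1
      · exact absurd h2 ht₂
      · exact h1
    have hmb : ∀ c ∈ a₂ :: ((a₁ :: u) ++ [d']), G.Adj t c → (∃ z ∈ Z, G.Adj z c) → c = b := by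
      intro c h1 h2 h3
      rcases List.mem_cons.1 (hmem c h1 h2) with rfl | h1
      · exact absurd h3 hτ₁
      · exact hMu c h1 h2 h3
    -- If `b` is on the path, the two consecutive neighbours of `t` would be `a₁` and `b`, which are
    -- not adjacent. Otherwise `b` lies beyond the path and misses both.
    by_cases hbd : b = d'
    · have r1 := pairmem e' f1 f2 a₁ (by simp) ht₁
      have r2 := pairmem e' f1 f2 b (by simp [hbd]) htb
      rw [e'] at hD
      have hcc : G.Adj c c' := hD.right.1
      have := (hB1 b hbq).2
      grind [adj_comm]
    · have aux : ∀ c ∈ a₂ :: ((a₁ :: u) ++ [d']), G.Adj t c → (∃ z ∈ Z, G.Adj z c) → c ∈ A := by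
        intro c h1 h2 h3
        have h4 := hmb c h1 h2 h3
        exact absurd (hbmem (h4 ▸ hmem c h1 h2)) hbd
      exact hfalse b hb (hbu hbd c (hmem c hcD hc) hc) (hbu hbd c' (hmem c' hcD' hc') hc')
        (aux c hcD hc) (aux c' hcD' hc')
  have E2 : Even (EC (G.neighborSet t) (a₂ :: (a₃ :: w₂))) := by
    by_contra hodd
    rw [Nat.not_even_iff_odd] at hodd
    have hD : IndPath G (a₂ :: (a₃ :: w₂)) := ⟨h23', by rw [eww] at hA2p; simp at hA2p; exact hA2p.1, hpw⟩
    by_cases hw0 : w = []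
    · subst hw0
      have hw₂ : w₂ = [] := by simp at ew₂; exact ew₂.2
      rw [hw₂, EC_cons_of_notMem (show a₂ ∉ G.neighborSet t from ht₂)] at hodd
      simp at hodd
    rw [← ew₂] at hD hodd
    obtain ⟨D₁, c, c', D₂, e', hc, hc', f1, f2, hfalse, -⟩ := h.exists_pair hD hw0 ha₂ hd
      (hτZ _ hw) (by rw [ew₂]; simp at htw ⊢; grind) hodd
    rw [ew₂] at e'
    have hcD : c ∈ a₂ :: (a₃ :: w₂) := by rw [e']; simp
    have hcD' : c' ∈ a₂ :: (a₃ :: w₂) := by rw [e']; simp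
    have hmem : ∀ c ∈ a₂ :: (a₃ :: w₂), G.Adj t c → c ∈ a₃ :: w₂ := by
      intro c h1 h2
      rcases List.mem_cons.1 h1 with rfl | h1
      · exact absurd h2 ht₂
      · exact h1
    exact hfalse b hb (hbw c (hmem c hcD hc)) (hbw c' (hmem c' hcD' hc'))
      (fun h3 => hMw c (hmem c hcD hc) hc h3 ▸ ha) (fun h3 => hMw c' (hmem c' hcD' hc') hc' h3 ▸ ha)
  have eD : d :: ((w.reverse ++ a₁ :: u) ++ [d']) = w₂.reverse ++ a₃ :: (a₁ :: (u ++ [d'])) := by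
    have := congrArg List.reverse ew₂
    simp at this
    rw [List.append_cons w₂.reverse, ← this]
    simp
  have E3 : Even (EC (G.neighborSet t) (d :: ((w.reverse ++ a₁ :: u) ++ [d']))) := by
    by_contra hodd
    rw [Nat.not_even_iff_odd] at hodd
    have hD : IndPath G (d :: ((w.reverse ++ a₁ :: u) ++ [d'])) := by
      rw [eD]
      have f13 : FarL G a₃ (u ++ [d']) := fun v hv => hA1 a₃ (by simp) v (humem v hv)
      refine indPath_append.2 ⟨?_, ⟨h13.symm, f13, hpu⟩, ?_⟩
      · have := indPath_reverse.2 hpw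
        simpa using this
      · intro v hv x hx
        have hv' : v ∈ p := by rw [eww]; simp at hv ⊢; exact .inl hv
        rcases List.mem_cons.1 hx with rfl | hx
        · exact (hA1p v hv').symm
        · exact hA1 v (by simp [hv']) x (humem x hx)
    have hmem : ∀ c ∈ d :: ((w.reverse ++ a₁ :: u) ++ [d']), c ∈ a₃ :: w₂ ∨ c ∈ a₁ :: (u ++ [d']) := by
      intro c h1
      rw [eD] at h1
      simp at h1 ⊢
      grind
    obtain ⟨D₁, c, c', D₂, e', hc, hc', f1, f2, hfalse, -⟩ := h.exists_pair hD (by simp) hd hd'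
      (hτZ _ (by
        intro v hv
        simp only [List.mem_append, List.mem_reverse, List.mem_cons] at hv
        rcases hv with hv | rfl | hv
        · exact hw v hv
        · exact hτ₁
        · exact hu v hv)) (fun h1 => by rcases hmem t h1 with h1 | h1; exacts [htw h1, htu h1]) hodd
    have hcD : c ∈ d :: ((w.reverse ++ a₁ :: u) ++ [d']) := by rw [e']; simp
    have hcD' : c' ∈ d :: ((w.reverse ++ a₁ :: u) ++ [d']) := by rw [e']; simp
    -- If `b` is on the path, `t` sees the three vertices `a₃`, `a₁` and `b` of it, not just two.
    by_cases hbd : b = d'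
    · have r1 := pairmem e' f1 f2 a₁ (by simp) ht₁
      have r2 := pairmem e' f1 f2 b (by simp [hbd]) htb
      have r3 := pairmem e' f1 f2 a₃ (by rw [eD]; simp) ht₃
      have n1 := h13.ne
      have n2 := (hbw a₃ (by simp)).1
      grind
    · have hfar : ∀ c ∈ d :: ((w.reverse ++ a₁ :: u) ++ [d']), G.Adj t c → Far G b c := by
        intro c h1 h2
        rcases hmem c h1 with h1 | h1
        · exact hbw c h1
        · exact hbu hbd c h1 h2
      have hcA : ∀ c ∈ d :: ((w.reverse ++ a₁ :: u) ++ [d']), G.Adj t c → (∃ z ∈ Z, G.Adj z c) →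
          c ∈ A := by
        intro c h1 h2 h3
        rcases hmem c h1 with h1 | h1
        · exact hMw c h1 h2 h3 ▸ ha
        · rcases List.mem_cons.1 h1 with rfl | h4
          · exact absurd h3 hτ₁
          · exact absurd (hbmem (hMu c h4 h2 h3 ▸ h1)) hbd
      exact hfalse b hb (hfar c hcD hc) (hfar c' hcD' hc') (hcA c hcD hc) (hcA c' hcD' hc')
  have ht₂' : a₂ ∉ G.neighborSet t := ht₂
  have e5 : EC (G.neighborSet t) (w₂.reverse ++ [a₃]) = EC (G.neighborSet t) (a₃ :: w₂) := by
    rw [← EC_reverse]; simp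
  rw [EC_cons_of_notMem ht₂'] at E1 E2
  rw [eD, EC_append, e5, EC_cons_cons, if_pos ⟨ht₃, ht₁⟩] at E3
  simp only [List.cons_append] at E1
  grind

/-- There is no prism with a broken rung whose two pieces end in `A` and in `B`, and in which no other
neighbour of `t` sees `Z`. -/
theorem false_of_openRung (h : Core G t Z A B) (ho : OpenRung G a₁ m₁ b₁ a₂ m₂ b₂ a₃ p b₃ q)
    {a b : V} {p' q' : List V} (ha : a ∈ A) (hb : b ∈ B) (hp : a₃ :: p = p' ++ [a])
    (hq : b₃ :: q = q' ++ [b])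
    (hM : ∀ v, v ∈ a₁ :: (m₁ ++ [b₁]) ∨ v ∈ a₂ :: (m₂ ++ [b₂]) ∨ v ∈ a₃ :: p ∨ v ∈ b₃ :: q →
      G.Adj t v → (∃ z ∈ Z, G.Adj z v) → v = a ∨ v = b) : False := by
  have hap : a ∈ a₃ :: p := by rw [hp]; simp
  have hbq : b ∈ b₃ :: q := by rw [hq]; simp
  have hta := h.adj_left a ha
  have htb := h.adj_right b hb
  have hab := h.far ha hb
  have n₃ : t ∉ a₃ :: p := fun h1 => (ho.anti t h1 b hbq).2 htb
  have n₄ : t ∉ b₃ :: q := fun h1 => (ho.anti a hap t h1).2 hta.symm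
  have aux : ∀ {a₁ b₁ a₂ b₂ : V} {m₁ m₂ : List V}, OpenRung G a₁ m₁ b₁ a₂ m₂ b₂ a₃ p b₃ q →
      t ∉ a₁ :: (m₁ ++ [b₁]) := by
    intro a₁ b₁ a₂ b₂ m₁ m₂ ho h1
    have h2 : t = a₁ := by
      by_contra h2
      have h3 : t ∈ m₁ ++ [b₁] := by simpa [h2] using h1
      rcases List.mem_cons.1 hap with rfl | h4
      · exact (ho.far_a₁ t h3).2 hta.symm
      · exact (ho.anti_p₁ a h4 t h1).2 hta.symm
    have h3 : t ∈ a₁ :: m₁ := by simp [h2]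
    rcases List.mem_cons.1 hbq with rfl | h4
    · exact (ho.far_b₁ t h3).2 htb.symm
    · exact (ho.anti_q₁ b h4 t h1).2 htb.symm
  have n₁ := aux ho
  have n₂ := aux ho.swap
  rcases h.touch_of_openRung ho ha hb hp hq with h1 | h1
  · exact h.false_of_openRung_aux ho.swap ha hb hp hq n₂ n₁ n₃ n₄ (fun v hv => hM v (by tauto)) h1
  · exact h.false_of_openRung_aux ho ha hb hp hq n₁ n₂ n₃ n₄ hM h1

end Core
end ArtemisGraph

namespace ArtemisGraph
open SimpleGraph

variable {V : Type*} {G : SimpleGraph V}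

/-! ### Walks and lists -/

theorem IndPath.exists_walk {x y : V} {m : List V} (h : IndPath G (x :: (m ++ [y]))) :
    ∃ p : G.Walk x y, p.support = x :: (m ++ [y]) := by
  induction m generalizing x with
  | nil => exact ⟨(indPath_pair.1 h).toWalk, by simp⟩
  | cons c m ih =>
    obtain ⟨p, hp⟩ := ih h.tail
    exact ⟨.cons h.1 p, by simp [hp]⟩

theorem exists_support_eq_concat {x y : V} (p : G.Walk x y) : ∃ l, p.support = l ++ [y] :=
  ⟨p.support.dropLast, by
    conv_lhs => rw [← List.dropLast_append_getLast p.support_ne_nil]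
    rw [p.getLast_support]⟩

theorem exists_support_eq {x y : V} (p : G.Walk x y) (hp : 1 ≤ p.length) :
    ∃ m, p.support = x :: (m ++ [y]) := by
  cases p with
  | nil => simp at hp
  | cons h q =>
    obtain ⟨l, hl⟩ := exists_support_eq_concat q
    exact ⟨l, by simp [hl]⟩

theorem isChordlessPath_iff {x y : V} {p : G.Walk x y} :
    IsChordlessPath G p ↔ IndPath G p.support := by
  induction p with
  | nil => simp [IsChordlessPath, Walk.isChordless_iff_forall_mem_edges]
  | @cons u v w h p ih =>
    simp only [IsChordlessPath, Walk.isChordless_iff_forall_mem_edges] at ih ⊢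
    have hs : p.support = v :: p.support.tail := (Walk.cons_tail_support p).symm
    constructor
    · rintro ⟨hp, hc⟩
      rw [Walk.cons_isPath_iff] at hp
      have h1 : IndPath G p.support := ih.1 ⟨hp.1, fun {a b} ha hb hab => by
        have := hc (by simp [ha]) (by simp [hb]) hab
        simp only [Walk.edges_cons, List.mem_cons] at this
        rcases this with h2 | h2
        · rw [Sym2.eq_iff] at h2
          grind
        · exact h2⟩
      rw [Walk.support_cons, hs]
      refine ⟨h, fun z hz => ?_, by rwa [← hs]⟩
      have hz' : z ∈ p.support := List.mem_of_mem_tail hz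
      refine ⟨by rintro rfl; exact hp.2 hz', fun hadj => ?_⟩
      have := hc (by simp) (by simp [hz']) hadj
      simp only [Walk.edges_cons, List.mem_cons] at this
      rcases this with h2 | h2
      · rw [Sym2.eq_iff] at h2
        have h3 := h1.nodup
        rw [hs] at h3
        simp at h3
        grind
      · exact hp.2 (p.fst_mem_support_of_mem_edges h2)
    · intro hI
      rw [Walk.support_cons] at hI
      obtain ⟨hp, hc⟩ := ih.2 hI.tail
      have hnd := hI.nodup
      refine ⟨by rw [Walk.cons_isPath_iff]; exact ⟨hp, by simpa using (List.nodup_cons.1 hnd).1⟩, ?_⟩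
      have key : ∀ z ∈ p.support, G.Adj u z → z = v := by
        intro z hz hadj
        rw [hs] at hI hz
        rcases List.mem_cons.1 hz with rfl | hz
        · rfl
        · exact absurd hadj (hI.2.1 z hz).2
      intro a b ha hb hab
      simp only [Walk.support_cons, List.mem_cons, Walk.edges_cons] at ha hb ⊢
      rcases ha with rfl | ha
      · rcases hb with rfl | hb
        · exact absurd hab (G.loopless.irrefl _)
        · exact .inl (by rw [key b hb hab])
      · rcases hb with rfl | hb
        · exact .inl (by rw [key a ha hab.symm, Sym2.eq_swap])
        · exact .inr (hc ha hb hab)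

/-! ### Holes, antiholes and prisms: from lists to induced subgraphs -/

theorem IndPath.adj_getElem_iff {l : List V} (h : IndPath G l) {i j : ℕ} (hij : i < j)
    (hj : j < l.length) : G.Adj l[i] l[j] ↔ j = i + 1 := by
  induction l generalizing i j with
  | nil => simp at hj
  | cons a l ih =>
    cases l with
    | nil => simp at hj; omega
    | cons b l =>
      obtain ⟨j, rfl⟩ : ∃ k, j = k + 1 := ⟨j - 1, by omega⟩
      cases i with
      | zero =>
        cases j with
        | zero => simpa using h.1
        | succ j =>
          simp only [List.getElem_cons_zero, List.getElem_cons_succ]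
          have := (h.2.1 (l[j]'(by simpa using hj)) (List.getElem_mem _)).2
          simp [this]
      | succ i =>
        simp only [List.getElem_cons_succ]
        rw [ih h.2.2 (by omega) (by simpa using hj)]
        omega

theorem Cyc.adj_getElem_iff {l : List V} (h : Cyc G l) {i j : ℕ} (hij : i < j)
    (hj : j < l.length) : G.Adj l[i] l[j] ↔ j = i + 1 ∨ (i = 0 ∧ j + 1 = l.length) := by
  obtain ⟨u, x, m, y, rfl, hm, hp, hx, hy, hf⟩ := h
  obtain ⟨j, rfl⟩ : ∃ k, j = k + 1 := ⟨j - 1, by omega⟩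
  cases i with
  | zero =>
    simp only [List.getElem_cons_zero, List.getElem_cons_succ]
    cases j with
    | zero => simpa using hx
    | succ j =>
      simp only [List.getElem_cons_succ]
      simp only [List.length_cons, List.length_append, List.length_nil] at hj
      by_cases hjm : j < m.length
      · rw [List.getElem_append_left hjm]
        have := (hf m[j] (List.getElem_mem _)).2
        simp [this]; omega
      · obtain rfl : j = m.length := by omega
        simpa using hy
  | succ i =>
    simp only [List.getElem_cons_succ]
    rw [hp.adj_getElem_iff (by omega) (by simpa using hj)]
    simp

theorem Cyc.nodup {l : List V} (h : Cyc G l) : l.Nodup := by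
  obtain ⟨u, x, m, y, rfl, hm, hp, hx, hy, hf⟩ := h
  rw [List.nodup_cons]
  refine ⟨?_, hp.nodup⟩
  have := hf.notMem
  have := hx.ne
  have := hy.ne
  simp; grind

theorem Cyc.four_le {l : List V} (h : Cyc G l) : 4 ≤ l.length := by
  obtain ⟨u, x, m, y, rfl, hm, -⟩ := h
  cases m <;> simp at hm ⊢

theorem Cyc.nonempty_embedding {l : List V} (h : Cyc G l) :
    Nonempty (cycleGraph l.length ↪g G) := by
  refine ⟨⟨⟨l.get, h.nodup.injective_get⟩, ?_⟩⟩
  intro i j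
  have h4 := h.four_le
  obtain ⟨i, hi⟩ := i
  obtain ⟨j, hj⟩ := j
  simp only [Function.Embedding.coeFn_mk, List.get_eq_getElem, cycleGraph_adj', Fin.sub_def]
  rcases lt_trichotomy i j with hij | rfl | hij
  · rw [h.adj_getElem_iff hij hj]
    have e1 : (l.length - i + j) % l.length = j - i := by
      rw [show l.length - i + j = (j - i) + l.length by omega, Nat.add_mod_right,
        Nat.mod_eq_of_lt (by omega)]
    have e2 : (l.length - j + i) % l.length = l.length - (j - i) := by
      rw [Nat.mod_eq_of_lt (by omega)]; omega
    simp only [e1, e2]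
    omega
  · rw [Nat.sub_add_cancel hi.le, Nat.mod_self]
    simp
  · rw [G.adj_comm, h.adj_getElem_iff hij hi]
    have e1 : (l.length - j + i) % l.length = i - j := by
      rw [show l.length - j + i = (i - j) + l.length by omega, Nat.add_mod_right,
        Nat.mod_eq_of_lt (by omega)]
    have e2 : (l.length - i + j) % l.length = l.length - (i - j) := by
      rw [Nat.mod_eq_of_lt (by omega)]; omega
    simp only [e1, e2]
    omega

theorem oddHoleFree_of_classA (h : ClassA G) : OddHoleFree G := by
  intro l hl
  by_contra hodd
  exact h.1 l.length (Nat.not_even_iff_odd.1 hodd) ⟨hl.four_le, hl.nonempty_embedding⟩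

theorem antiholeFree_of_classA (h : ClassA G) : AntiholeFree G := by
  intro l hl
  by_contra h5
  obtain ⟨f⟩ := hl.nonempty_embedding
  refine h.2.1 l.length (by omega) ⟨hl.four_le, ⟨?_⟩⟩
  have := Embedding.complEquiv f
  rwa [compl_compl] at this

theorem Cross.disjoint {a₁ b₁ a₂ b₂ : V} {m₁ m₂ : List V} (h : Cross G a₁ m₁ b₁ a₂ m₂ b₂) {v : V}
    (hv : v ∈ a₁ :: (m₁ ++ [b₁])) : v ∉ a₂ :: (m₂ ++ [b₂]) := by
  have n1 := h.1.ne
  have n2 := h.2.1.ne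
  simp [Cross, FarL, Anti, Far] at *
  grind

theorem Cross.eq_of_adj {a₁ b₁ a₂ b₂ : V} {m₁ m₂ : List V} (h : Cross G a₁ m₁ b₁ a₂ m₂ b₂) {u v : V}
    (hu : u ∈ a₁ :: (m₁ ++ [b₁])) (hv : v ∈ a₂ :: (m₂ ++ [b₂])) (huv : G.Adj u v) :
    (u = a₁ ∧ v = a₂) ∨ (u = b₁ ∧ v = b₂) := by
  simp [Cross, FarL, Anti, Far] at *
  grind [adj_comm]

theorem PrismL.hasPrism {a₁ b₁ a₂ b₂ a₃ b₃ : V} {m₁ m₂ m₃ : List V}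
    (h : PrismL G a₁ m₁ b₁ a₂ m₂ b₂ a₃ m₃ b₃) : HasPrism G := by
  set a : Fin 3 → V := ![a₁, a₂, a₃] with ha
  set b : Fin 3 → V := ![b₁, b₂, b₃] with hb
  set m : Fin 3 → List V := ![m₁, m₂, m₃] with hm
  have hp : ∀ i, IndPath G (a i :: (m i ++ [b i])) := by
    intro i; fin_cases i
    exacts [h.p₁, h.p₂, h.p₃]
  have hc : ∀ i j, i ≠ j → Cross G (a i) (m i) (b i) (a j) (m j) (b j) := by
    intro i j hij
    fin_cases i <;> fin_cases j
    exacts [absurd rfl hij, h.h₁₂, h.h₁₃, h.h₁₂.symm, absurd rfl hij, h.h₂₃, h.h₁₃.symm, h.h₂₃.symm,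
      absurd rfl hij]
  choose P hP using fun i => (hp i).exists_walk
  have hP' : ∀ i, IsChordlessPath G (P i) := fun i => isChordlessPath_iff.2 (by rw [hP]; exact hp i)
  refine ⟨a, b, P, fun i j hij => (hc i j hij).1, fun i j hij => (hc i j hij).2.1, ?_,
    fun i => (hP' i).1, ?_, ?_⟩
  · intro i j
    by_cases hij : i = j
    · subst hij
      have := (hp i).nodup
      simp at this
      exact this.1.2
    · exact (hc i j hij).2.2.1.1
  · intro i j hij u hu
    rw [hP] at hu ⊢
    exact (hc i j hij).disjoint hu
  · intro i j u hu v hv huv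
    by_cases hij : i = j
    · subst hij
      exact .inl ⟨rfl, (hP' i).2.mem_edges hu hv huv⟩
    · rw [hP] at hu hv
      exact .inr ⟨hij, (hc i j hij).eq_of_adj hu hv huv⟩

theorem HasPrism.not_prismFree (h : HasPrism G) : ¬ PrismFree G := by
  obtain ⟨a, b, P, hA, hB, hne, hP, hdis, hadj⟩ := h
  have hlen : ∀ i, 1 ≤ (P i).length := by
    intro i
    by_contra h0
    exact hne i i (Walk.eq_of_length_eq_zero (p := P i) (by omega))
  choose m hm using fun i => exists_support_eq (P i) (hlen i)
  have hp : ∀ i, IndPath G (a i :: (m i ++ [b i])) := by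
    intro i
    rw [← hm, ← isChordlessPath_iff]
    refine ⟨hP i, Walk.isChordless_iff_forall_mem_edges.2 fun u v hu hv huv => ?_⟩
    rcases hadj i i u hu v hv huv with h | h
    · exact h.2
    · exact absurd rfl h.1
  have hc : ∀ i j, i ≠ j → Cross G (a i) (m i) (b i) (a j) (m j) (b j) := by
    intro i j hij
    have h1 := hdis i j hij
    have h2 : ∀ u ∈ (P i).support, ∀ v ∈ (P j).support, G.Adj u v →
        (u = a i ∧ v = a j) ∨ (u = b i ∧ v = b j) := fun u hu v hv huv => by
      rcases hadj i j u hu v hv huv with h | h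
      · exact absurd h.1 hij
      · exact h.2
    have e1 := (hp i).nodup
    have e2 := (hp j).nodup
    rw [hm, hm] at h1 h2
    have h3 := hA i j hij
    have h4 := hB i j hij
    have h5 := hne i j
    have h6 := hne j i
    clear hP hdis hadj hlen hm hA hB hp hne
    generalize a i = a₁ at *
    generalize a j = a₂ at *
    generalize b i = b₁ at *
    generalize b j = b₂ at *
    generalize m i = m₁ at *
    generalize m j = m₂ at *
    have key : ∀ u ∈ a₁ :: (m₁ ++ [b₁]), ∀ v ∈ a₂ :: (m₂ ++ [b₂]),
        ¬ ((u = a₁ ∧ v = a₂) ∨ (u = b₁ ∧ v = b₂)) → Far G u v := fun u hu v hv hn =>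
      ⟨fun e => h1 u hu (e ▸ hv), fun e => hn (h2 u hu v hv e)⟩
    simp at e1 e2
    refine ⟨h3, h4, key _ ?_ _ ?_ ?_, fun v hv => key _ ?_ _ ?_ ?_, (key _ ?_ _ ?_ ?_),
      fun v hv => key _ ?_ _ ?_ ?_, fun v hv => (key _ ?_ _ ?_ ?_).symm,
      fun v hv => (key _ ?_ _ ?_ ?_).symm, fun u hu v hv => key _ ?_ _ ?_ ?_⟩ <;> simp <;> grind
  intro hPF
  exact hPF _ _ _ _ _ _ _ _ _ ⟨hp 0, hp 1, hp 2, hc 0 1 (by decide), hc 0 2 (by decide),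
    hc 1 2 (by decide)⟩

theorem prismFree_of_classA (h : ClassA G) : PrismFree G :=
  fun _ _ _ _ _ _ _ _ _ hp => h.2.2 hp.hasPrism

end ArtemisGraph

namespace ArtemisGraph
open SimpleGraph

variable {V : Type*} {G : SimpleGraph V}

/-! ### The two cliques and the searches in the original graph -/

/-- The situation of `Core` in the graph in which `T` is collapsed to its vertex `t`. -/
structure Frame (G : SimpleGraph V) (T : Set V) (t : V) (Z : List V) (A B : Set V) : Prop where
  mem : t ∈ T
  core : Core (collapse G T t) t Z A B
  notMem : ∀ v ∈ Z, v ∉ T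

/-- `M` is a connected set that contains `B`, is anticomplete to `A`, avoids `T`, and contains every
neighbour of `M` outside `T` that is neither in `A` nor sees `A`. -/
structure Reach (G : SimpleGraph V) (T A B M : Set V) : Prop where
  conn : ConnIn G M
  sub : B ⊆ M
  notMem : ∀ v ∈ M, v ∉ T
  far : ∀ a ∈ A, ∀ v ∈ M, Far G a v
  closed : ∀ u ∈ M, ∀ v, G.Adj u v → v ∉ T → v ∉ A → v ∉ nbr G A → v ∈ M

/-- The vertices outside `T` that see both `A` and `M`. -/
def frontier (G : SimpleGraph V) (T A M : Set V) : Set V :=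
  {v | v ∈ nbr G A ∧ v ∉ T ∧ ∃ u ∈ M, G.Adj u v}

/-- A walk that leaves `M` outside `T` stays in `M` until it meets a vertex that sees `A`, and this
vertex is in the frontier. It cannot pass from `M` to `A` directly. -/
theorem Reach.exists_mem_frontier {T A B M : Set V} (h : Reach G T A B M) {v a : V} {w : List V}
    (hv : v ∈ M) (ha : a ∈ A) (hc : List.IsChain G.Adj (v :: (w ++ [a]))) (hT : ∀ x ∈ w, x ∉ T) :
    ∃ k ∈ w, k ∈ frontier G T A M := by
  induction w generalizing v with
  | nil =>
    simp at hc
    exact absurd hc.symm (h.far a ha v hv).2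
  | cons c w ih =>
    rw [List.cons_append, List.isChain_cons_cons] at hc
    have hcA : c ∉ A := fun hcA => (h.far c hcA v hv).2 hc.1.symm
    have hcT := hT c (by simp)
    by_cases hcN : c ∈ nbr G A
    · exact ⟨c, by simp, hcN, hcT, v, hv, hc.1⟩
    · obtain ⟨k, hk, hk'⟩ := ih (h.closed v hv c hc.1 hcT hcA hcN) hc.2 fun x hx => hT x (by simp [hx])
      exact ⟨k, by simp [hk], hk'⟩

theorem Reach.mem_of_chain {T A B M : Set V} (h : Reach G T A B M) {v : V} {w : List V}
    (hv : v ∈ M) (hc : List.IsChain G.Adj (v :: w)) (hw : ∀ x ∈ w, x ∉ T ∧ x ∉ A ∧ x ∉ nbr G A) :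
    ∀ x ∈ w, x ∈ M := by
  induction w generalizing v with
  | nil => simp
  | cons c w ih =>
    rw [List.isChain_cons_cons] at hc
    obtain ⟨h1, h2, h3⟩ := hw c (by simp)
    have hcM := h.closed v hv c hc.1 h1 h2 h3
    have := ih hcM hc.2 fun x hx => hw x (by simp [hx])
    simpa using ⟨hcM, this⟩

namespace Frame

variable {T : Set V} {t : V} {Z : List V} {A B : Set V}

theorem swap (h : Frame G T t Z A B) : Frame G T t Z.reverse B A :=
  ⟨h.mem, h.core.swap, by simpa using h.notMem⟩

theorem adj_iff (h : Frame G T t Z A B) : ∀ u v, u ∉ T → v ∉ T →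
    ((collapse G T t).Adj u v ↔ G.Adj u v) := fun _ _ hu hv => collapse_adj_iff h.mem hu hv

theorem adj_iff' (h : Frame G T t Z A B) : ∀ u v, u ∉ T → v ∉ T →
    (G.Adj u v ↔ (collapse G T t).Adj u v) := fun _ _ hu hv => (collapse_adj_iff h.mem hu hv).symm

theorem mem_comp_left (h : Frame G T t Z A B) {a : V} (ha : a ∈ A) : a ∈ Comp G T :=
  (collapse_adj_left h.mem).1 (h.core.adj_left a ha)

theorem mem_comp_right (h : Frame G T t Z A B) {b : V} (hb : b ∈ B) : b ∈ Comp G T :=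
  h.swap.mem_comp_left hb

theorem notMem_left (h : Frame G T t Z A B) {a : V} (ha : a ∈ A) : a ∉ T :=
  notMem_of_mem_comp (h.mem_comp_left ha)

theorem notMem_right (h : Frame G T t Z A B) {b : V} (hb : b ∈ B) : b ∉ T :=
  h.swap.notMem_left hb

theorem adj_left (h : Frame G T t Z A B) {a a' : V} (ha : a ∈ A) (ha' : a' ∈ A) (hne : a ≠ a') :
    G.Adj a a' :=
  (h.adj_iff _ _ (h.notMem_left ha) (h.notMem_left ha')).1 (h.core.clique_left ha ha' hne)

theorem far (h : Frame G T t Z A B) {a b : V} (ha : a ∈ A) (hb : b ∈ B) : Far G a b :=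
  ⟨(h.core.far ha hb).1, fun e => (h.core.far ha hb).2
    ((h.adj_iff _ _ (h.notMem_left ha) (h.notMem_right hb)).2 e)⟩

theorem path (h : Frame G T t Z A B) {a b : V} (ha : a ∈ A) (hb : b ∈ B) :
    IndPath G (a :: (Z ++ [b])) := by
  refine (h.core.path a ha b hb).transfer h.adj_iff ?_
  have := h.notMem_left ha
  have := h.notMem_right hb
  have := h.notMem
  simp; grind

/-- Walk back from `B` along `Z`: only the first vertex of `Z` sees `A`. -/
theorem tail_subset (h : Frame G T t Z A B) {M : Set V} (hM : Reach G T A B M) :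
    ∀ v ∈ Z.tail, v ∈ M := by
  obtain ⟨b, hb⟩ := h.core.nonempty_right
  obtain ⟨z, Z', hZ⟩ := List.exists_cons_of_ne_nil h.core.ne_nil
  have key : ∀ v ∈ Z', ∀ a ∈ A, Far G a v := by
    intro v hv a ha
    have := h.path ha hb
    rw [hZ] at this
    exact this.2.1 v (by simp [hv])
  have := hM.mem_of_chain (v := b) (w := Z'.reverse) (hM.sub hb) (by
      obtain ⟨a, ha⟩ := h.core.nonempty_left
      have := h.path ha hb
      rw [hZ] at this
      have := (indPath_reverse.2 this.tail.tail).isChain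
      simpa using this) (by
      intro x hx
      have hx : x ∈ Z' := by simpa using hx
      refine ⟨h.notMem x (by simp [hZ, hx]), fun hxA => (key x hx x hxA).1 rfl, ?_⟩
      rintro ⟨-, a, ha, hax⟩
      exact (key x hx a ha).2 hax)
  simpa [hZ] using this

theorem no_crossing (h : Frame G T t Z A B) {M : Set V} (hM : Reach G T A B M) {a a' k k' : V}
    (ha : a ∈ A) (ha' : a' ∈ A) (hk : k ∈ frontier G T A M) (hk' : k' ∈ frontier G T A M)
    (hak' : G.Adj a k') (hak : ¬ G.Adj a k) (ha'k : G.Adj a' k) (ha'k' : ¬ G.Adj a' k') : False := by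
  have hconn : ConnIn (collapse G T t) M := by
    intro u hu v hv
    refine Relation.ReflTransGen.mono ?_ _ _ (hM.conn u hu v hv)
    intro x y hxy
    exact ⟨(h.adj_iff _ _ (hM.notMem x hxy.2.1) (hM.notMem y hxy.2.2)).2 hxy.1, hxy.2⟩
  have n1 := h.notMem_left ha
  have n2 := h.notMem_left ha'
  obtain ⟨⟨q1, -⟩, q2, u, hu, huk⟩ := hk
  obtain ⟨⟨q1', -⟩, q2', u', hu', huk'⟩ := hk'
  refine h.core.no_crossing hconn hM.sub (h.tail_subset hM) ?_ ha ha' q1 q1' ⟨u, hu, ?_⟩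
    ⟨u', hu', ?_⟩ ((h.adj_iff _ _ n1 q2').2 hak') (fun e => hak ((h.adj_iff _ _ n1 q2).1 e))
    ((h.adj_iff _ _ n2 q2).2 ha'k) (fun e => ha'k' ((h.adj_iff _ _ n2 q2').1 e))
  · intro a ha v hv
    have := hM.far a ha v hv
    exact ⟨this.1, fun e => this.2 ((h.adj_iff _ _ (h.notMem_left ha) (hM.notMem v hv)).1 e)⟩
  · exact (h.adj_iff _ _ (hM.notMem u hu) q2).2 huk
  · exact (h.adj_iff _ _ (hM.notMem u' hu') q2').2 huk'

/-- Take `a` with the most neighbours in the frontier. If `a` misses `k` and `a'` sees it, then by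
`no_crossing` the neighbours of `a'` in the frontier strictly include those of `a`. -/
theorem exists_dominating [Finite V] (h : Frame G T t Z A B) {M : Set V} (hM : Reach G T A B M) :
    ∃ a ∈ A, ∀ k ∈ frontier G T A M, G.Adj a k := by
  obtain ⟨a, ha, hmax⟩ := Set.exists_max_image A
    (fun a => (G.neighborSet a ∩ frontier G T A M).ncard) A.toFinite h.core.nonempty_left
  refine ⟨a, ha, fun k hk => ?_⟩
  by_contra hak
  obtain ⟨a', ha', ha'k⟩ := hk.1.2
  have hnot : ¬ (G.neighborSet a ∩ frontier G T A M ⊂ G.neighborSet a' ∩ frontier G T A M) := by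
    intro hlt
    have := Set.ncard_lt_ncard hlt (Set.toFinite _)
    have := hmax a' ha'
    omega
  apply hnot
  refine ⟨fun k' hk' => ⟨?_, hk'.2⟩, fun hsub => hak (hsub ⟨ha'k, hk⟩).1⟩
  by_contra ha'k'
  exact h.no_crossing hM ha ha' hk hk'.2 hk'.1 hak ha'k ha'k'

/-- Some `a' ∈ A` sees `k`, and a chordless path leads from `k` through `M` to its first vertex in
`B`. Started at `a'`, it has its second vertex outside `A` and its penultimate one outside `B`, so
it is even by `odd_path`; putting `a` in front makes it odd. -/
theorem exists_odd_path (h : Frame G T t Z A B) {M : Set V} (hM : Reach G T A B M) {a k : V}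
    (ha : a ∈ A) (hk : k ∈ frontier G T A M) (hak : ¬ G.Adj a k) :
    ∃ a' ∈ A, ∃ b ∈ B, ∃ m, IndPath G (a :: a' :: (m ++ [b])) ∧ Odd m.length := by
  obtain ⟨⟨hkA, a', ha', ha'k⟩, hkT, u, hu, huk⟩ := hk
  obtain ⟨b₀, hb₀⟩ := h.core.nonempty_right
  obtain ⟨w, hw, hwM, hb₀w⟩ := (hM.conn u hu b₀ (hM.sub hb₀)).exists_chain_mem
  have hwM' : ∀ x ∈ u :: w, x ∈ M := by simpa using ⟨hu, hwM⟩
  have hkB : k ∉ B := fun hkB => (h.far ha' hkB).2 ha'k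
  obtain ⟨g, b, hg, hb, hgB, hgw, -⟩ := exists_indPath_first (· ∈ B) hkB
    (List.isChain_cons_cons.2 ⟨huk.symm, hw⟩) ⟨b₀, hb₀w, hb₀⟩
  have hgM : ∀ x ∈ g ++ [b], x ∈ M := by
    intro x hx
    simp only [List.mem_append, List.mem_singleton] at hx
    rcases hx with hx | rfl
    · exact hwM' x (hgw x hx)
    · exact hM.sub hb
  have hfar : ∀ a ∈ A, FarL G a (g ++ [b]) := fun a ha x hx => hM.far a ha x (hgM x hx)
  have hp : IndPath G (a' :: ((k :: g) ++ [b])) := ⟨ha'k, hfar a' ha', hg⟩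
  have haa : G.Adj a a' := h.adj_left ha ha' (by rintro rfl; exact hak ha'k)
  refine ⟨a', ha', b, hb, k :: g, ⟨haa, ?_, hp⟩, ?_⟩
  · have fak : Far G a k := ⟨by rintro rfl; exact hkA ha, hak⟩
    simpa [fak] using hfar a ha
  · by_contra hev
    rw [Nat.not_odd_iff_even] at hev
    have hp' := hp.transfer h.adj_iff' (by
      have := h.notMem_left ha'
      have := fun x hx => hM.notMem x (hgM x hx)
      simp at this ⊢; grind)
    rcases h.core.odd_path ha' hb hp' hev with ⟨a'', ha'', m', e⟩ | ⟨b', hb', m', e⟩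
    · simp at e
      exact hkA (e.1 ▸ ha'')
    · have : b' ∈ k :: g := by rw [e]; simp
      rcases List.mem_cons.1 this with rfl | h'
      · exact hkB hb'
      · exact hgB b' h' hb'

/-- On the way back from `b` to `a'` the path crosses the frontier at a vertex of `m`, which `a`
misses because the path is chordless. -/
theorem exists_not_adj (h : Frame G T t Z A B) {M : Set V} (hM : Reach G T A B M) {a a' b : V}
    {m : List V} (ha : a ∈ A) (ha' : a' ∈ A) (hb : b ∈ B) (hp : IndPath G (a :: a' :: (m ++ [b]))) :
    ∃ k ∈ frontier G T A M, ¬ G.Adj a k := by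
  have hf := hp.2.1
  obtain ⟨k, hk, hkK⟩ := hM.exists_mem_frontier (v := b) (w := m.reverse) (hM.sub hb) ha'
    hp.tail.reverse_mid.isChain (by
      intro x hx hxT
      exact (hf x (by simp at hx ⊢; exact .inl hx)).2 (h.mem_comp_left ha x hxT).symm)
  exact ⟨k, hkK, (hf k (by simp at hk ⊢; exact .inl hk)).2⟩

/-- By `odd_path`, an odd path would have its second vertex in `A` or its penultimate one in `B`,
and `exists_not_adj` would give a frontier vertex missed by `a` or by `b`. -/
theorem odd_of_dominating (h : Frame G T t Z A B) {M M' : Set V} (hM : Reach G T A B M)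
    (hM' : Reach G T B A M') {a b : V} {m : List V} (ha : a ∈ A) (hb : b ∈ B)
    (hK : ∀ k ∈ frontier G T A M, G.Adj a k) (hL : ∀ k ∈ frontier G T B M', G.Adj b k)
    (hp : IndPath G (a :: (m ++ [b]))) : Odd m.length := by
  by_contra hev
  rw [Nat.not_odd_iff_even] at hev
  have hmT : ∀ v ∈ m, v ∉ T := by
    intro v hv hvT
    rw [hp.eq_singleton_of_adj hv (h.mem_comp_left ha v hvT).symm (h.mem_comp_right hb v hvT).symm] at hev
    simp at hev
  have hp' := hp.transfer h.adj_iff' (by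
      have := h.notMem_left ha
      have := h.notMem_right hb
      simp; grind)
  rcases h.core.odd_path ha hb hp' hev with ⟨a', ha', m', rfl⟩ | ⟨b', hb', m', rfl⟩
  · obtain ⟨k, hk, hk'⟩ := h.exists_not_adj hM ha ha' hb hp
    exact hk' (hK k hk)
  · obtain ⟨k, hk, hk'⟩ := h.swap.exists_not_adj hM' (a := b) (a' := b') (b := a) (m := m'.reverse) hb hb'
      ha (by simpa using hp.reverse_mid)
    exact hk' (hL k hk)

end Frame
end ArtemisGraph

namespace ArtemisGraph
open SimpleGraph

variable {V : Type*} {G : SimpleGraph V}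

/-! ### Prisms after the contraction of two vertices -/

section OpenRung

variable {a₁ b₁ a₂ b₂ a₃ b₃ e e' y : V} {m₁ m₂ p q p₀ q₀ : List V}

theorem IndPath.cons_concat (h : IndPath G (b₃ :: q)) (he : b₃ :: q = q₀ ++ [e]) (hy : G.Adj y e)
    (hq₀ : FarL G y q₀) : IndPath G (b₃ :: (q ++ [y])) := by
  rw [he] at h
  have := IndPath.concat h hy.symm hq₀
  rw [← List.cons_append, he]
  simpa using this

theorem OpenRung.extend (h : OpenRung G a₁ m₁ b₁ a₂ m₂ b₂ a₃ p b₃ q) (he : a₃ :: p = p₀ ++ [e])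
    (hy : G.Adj y e) (hp₀ : FarL G y p₀) (h₁ : FarL G y (a₁ :: (m₁ ++ [b₁])))
    (h₂ : FarL G y (a₂ :: (m₂ ++ [b₂]))) (h₃ : FarL G y (b₃ :: q)) :
    OpenRung G a₁ m₁ b₁ a₂ m₂ b₂ a₃ (p ++ [y]) b₃ q := by
  obtain ⟨g1, g2, g3, g4, g5, g6, g7, g8, g9, g10, g11, g12, g13, g14, g15, g16, g17, g18⟩ := h
  refine ⟨g1, g2, g3.cons_concat he hy hp₀, g4, ?_, g6, g7, g8, g9, g10, g11, g12, g13, g14, ?_, ?_, g17, g18⟩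
  · rw [← List.cons_append, anti_append_left]
    exact ⟨g5, by simp at h₃ ⊢; exact ⟨h₃.1.symm, h₃.2⟩⟩
  · rw [anti_append_left]
    exact ⟨g15, by simp at h₁ ⊢; exact ⟨h₁.1.symm, h₁.2.1, h₁.2.2.symm⟩⟩
  · rw [anti_append_left]
    exact ⟨g16, by simp at h₂ ⊢; exact ⟨h₂.1.symm, h₂.2.1, h₂.2.2.symm⟩⟩

theorem OpenRung.prismL (h : OpenRung G a₁ m₁ b₁ a₂ m₂ b₂ a₃ p b₃ q) (he : a₃ :: p = p₀ ++ [e])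
    (he' : b₃ :: q = q₀ ++ [e']) (hy : G.Adj y e) (hy' : G.Adj y e') (hp₀ : FarL G y p₀)
    (hq₀ : FarL G y q₀) (h₁ : FarL G y (a₁ :: (m₁ ++ [b₁]))) (h₂ : FarL G y (a₂ :: (m₂ ++ [b₂]))) :
    PrismL G a₁ m₁ b₁ a₂ m₂ b₂ a₃ (p ++ y :: q.reverse) b₃ := by
  obtain ⟨g1, g2, g3, g4, g5, g6, g7, g8, g9, g10, g11, g12, g13, g14, g15, g16, g17, g18⟩ := h
  refine ⟨g1, g2, ?_, g6, ?_, ?_⟩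
  · have k1 := g3.cons_concat he hy hp₀
    have k2 := (g4.cons_concat he' hy' hq₀).reverse_mid
    have : IndPath G ((a₃ :: p) ++ y :: (q.reverse ++ [b₃])) := by
      refine indPath_append.2 ⟨k1, k2, ?_⟩
      have : q.reverse ++ [b₃] = (b₃ :: q).reverse := by simp
      rw [this, anti_reverse_right]
      exact g5
    simpa using this
  · clear g1 g2 g3 g4 he he'; simp [Cross] at *; grind [far_comm, anti_comm]
  · clear g1 g2 g3 g4 he he'; simp [Cross] at *; grind [far_comm, anti_comm]

end OpenRung

/-- There is no prism with a broken rung whose two pieces end in `x` and in `y`. -/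
def NoOpenRung (G : SimpleGraph V) (x y : V) : Prop :=
  ∀ a₁ m₁ b₁ a₂ m₂ b₂ a₃ p b₃ q p' q', OpenRung G a₁ m₁ b₁ a₂ m₂ b₂ a₃ p b₃ q →
    a₃ :: p = p' ++ [x] → b₃ :: q = q' ++ [y] → False

theorem NoOpenRung.symm {x y : V} (h : NoOpenRung G x y) : NoOpenRung G y x :=
  fun _ _ _ _ _ _ _ _ _ _ _ _ ho hp hq => h _ _ _ _ _ _ _ _ _ _ _ _ ho.flip hq hp

/-- The graph `G/ab`, with `a` as the new vertex and with `b` as an isolated vertex. -/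
def merge (G : SimpleGraph V) (a b : V) : SimpleGraph V :=
  SimpleGraph.fromRel fun u v => (u ∉ ({a, b} : Set V) ∧ v ∉ ({a, b} : Set V) ∧ G.Adj u v) ∨
    (u = a ∧ v ∉ ({a, b} : Set V) ∧ (G.Adj a v ∨ G.Adj b v))

section merge

variable {a b : V}

theorem merge_adj_iff {u v : V} (hu : u ∉ ({a, b} : Set V)) (hv : v ∉ ({a, b} : Set V)) :
    (merge G a b).Adj u v ↔ G.Adj u v := by
  have hu' : u ≠ a := by rintro rfl; simp at hu
  have hv' : v ≠ a := by rintro rfl; simp at hv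
  simp only [merge, fromRel_adj, hu, hv, not_false_eq_true, true_and, hu', hv', false_and, or_false]
  exact ⟨fun h => h.2.elim id Adj.symm, fun h => ⟨h.ne, .inl h⟩⟩

theorem merge_adj_left {v : V} :
    (merge G a b).Adj a v ↔ v ∉ ({a, b} : Set V) ∧ (G.Adj a v ∨ G.Adj b v) := by
  simp only [merge, fromRel_adj, Set.mem_insert_iff, true_or, not_true_eq_false, false_and, and_false,
    false_or, true_and, Set.mem_singleton_iff]
  constructor
  · rintro ⟨h, h1 | h1⟩
    · exact h1
    · exact h1.elim
  · rintro ⟨h, h1⟩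
    exact ⟨by rintro rfl; simp at h, .inl ⟨h, h1⟩⟩

theorem merge_not_adj_right (hab : a ≠ b) {v : V} : ¬ (merge G a b).Adj b v := by
  simp [merge, fromRel_adj, hab.symm]

theorem far_of_far_merge {v : V} (h : Far (merge G a b) a v) (hv : v ∉ ({a, b} : Set V)) :
    ∀ y, y = a ∨ y = b → Far G y v := by
  have h2 := h.2
  rw [merge_adj_left] at h2
  simp at hv
  rintro y (rfl | rfl)
  · exact ⟨fun e => hv.1 e.symm, fun e => h2 (by simp [hv, e])⟩
  · exact ⟨fun e => hv.2 e.symm, fun e => h2 (by simp [hv, e])⟩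

theorem farL_of_farL_merge {l : List V} (h : FarL (merge G a b) a l) (hl : ∀ v ∈ l, v ∉ ({a, b} : Set V)) :
    ∀ y, y = a ∨ y = b → FarL G y l :=
  fun y hy v hv => far_of_far_merge (h v hv) (hl v hv) y hy

theorem IndPath.notMem_of_merge {l l₀ : List V} (h : IndPath (merge G a b) l) (hab : a ≠ b)
    (hl : 2 ≤ l.length) (hl₀ : l₀ ⊆ l) (ha : a ∉ l₀) : ∀ v ∈ l₀, v ∉ ({a, b} : Set V) := by
  rintro v hv (rfl | rfl)
  · exact ha hv
  · obtain ⟨w, -, hw⟩ := h.exists_adj_of_mem hl (hl₀ hv)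
    exact merge_not_adj_right hab hw

variable {a₁ b₁ a₂ b₂ a₃ b₃ : V} {m₁ m₂ m₃ : List V}

/-- The two neighbours `e`, `e'` of the new vertex on the rung are each seen by `a` or `b`. If one
of the two sees both, it mends the rung in `G`; otherwise one sees only `e` and the other only `e'`,
which gives a broken rung with ends `a` and `b`. -/
theorem merge_no_prism_middle (hP : PrismFree G) (hab : Far G a b) (hno : NoOpenRung G a b)
    (h : PrismL (merge G a b) a₁ m₁ b₁ a₂ m₂ b₂ a₃ m₃ b₃) (ha : a ∈ m₃) : False := by
  have key : ∀ u v, u ∉ ({a, b} : Set V) → v ∉ ({a, b} : Set V) →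
      ((merge G a b).Adj u v ↔ G.Adj u v) := fun u v hu hv => merge_adj_iff hu hv
  have n1 := h.p₁.notMem_of_merge hab.1 (by simp) (List.Subset.refl _) (h.notMem_rung₁ (by simp [ha]))
  have n2 := h.p₂.notMem_of_merge hab.1 (by simp) (List.Subset.refl _)
    (h.swap.notMem_rung₁ (by simp [ha]))
  obtain ⟨p, q, rfl⟩ := List.append_of_mem ha
  obtain ⟨p1, p2, p3, h12, h13, h23⟩ := h
  have hnd := p3.nodup
  have n3 := p3.notMem_of_merge hab.1 (by simp; omega) (l₀ := a₃ :: p) (by intro v; simp; grind)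
    (by simp at hnd ⊢; grind)
  have n4 := p3.notMem_of_merge hab.1 (by simp; omega) (l₀ := q ++ [b₃]) (by intro v; simp; grind)
    (by simp at hnd ⊢; grind)
  obtain ⟨x1, x2, x3⟩ := indPath_append.1
    (show IndPath (merge G a b) ((a₃ :: p) ++ a :: (q ++ [b₃])) by simpa using p3)
  have n4' : ∀ v ∈ b₃ :: q.reverse, v ∉ ({a, b} : Set V) := by
    intro v hv; exact n4 v (by simp at hv ⊢; tauto)
  have ho : OpenRung G a₁ m₁ b₁ a₂ m₂ b₂ a₃ p b₃ q.reverse := by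
    refine ⟨p1.transfer key n1, p2.transfer key n2, (IndPath.left (l₂ := [a]) x1).transfer key n3, ?_,
      Anti.transfer key ?_ n3 n4', h12.transfer key n1 n2, ?_, ?_, ?_, ?_, ?_, ?_, ?_, ?_, ?_, ?_, ?_, ?_⟩
    · have := indPath_reverse.2 x2.tail
      exact IndPath.transfer key (by simpa using this) n4'
    · simp at x3 ⊢; grind
    · exact (key _ _ (n1 _ (by simp)) (n3 _ (by simp))).1 h13.1
    · exact (key _ _ (n2 _ (by simp)) (n3 _ (by simp))).1 h23.1
    · exact (key _ _ (n1 _ (by simp)) (n4 _ (by simp))).1 h13.2.1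
    · exact (key _ _ (n2 _ (by simp)) (n4 _ (by simp))).1 h23.2.1
    · refine FarL.transfer key ?_ (n3 _ (by simp)) fun v hv => n1 v (by simp at hv ⊢; grind)
      simp [Cross] at h13 ⊢; grind [far_comm]
    · refine FarL.transfer key ?_ (n3 _ (by simp)) fun v hv => n2 v (by simp at hv ⊢; grind)
      simp [Cross] at h23 ⊢; grind [far_comm]
    · refine FarL.transfer key ?_ (n4 _ (by simp)) fun v hv => n1 v (by simp at hv ⊢; grind)
      simp [Cross] at h13 ⊢; grind [far_comm]
    · refine FarL.transfer key ?_ (n4 _ (by simp)) fun v hv => n2 v (by simp at hv ⊢; grind)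
      simp [Cross] at h23 ⊢; grind [far_comm]
    · refine Anti.transfer key ?_ (fun v hv => n3 v (by simp [hv])) n1
      simp [Cross] at h13 ⊢; grind [far_comm, anti_comm]
    · refine Anti.transfer key ?_ (fun v hv => n3 v (by simp [hv])) n2
      simp [Cross] at h23 ⊢; grind [far_comm, anti_comm]
    · refine Anti.transfer key ?_ (fun v hv => n4' v (by simp at hv ⊢; tauto)) n1
      simp [Cross] at h13 ⊢; grind [far_comm, anti_comm]
    · refine Anti.transfer key ?_ (fun v hv => n4' v (by simp at hv ⊢; tauto)) n2
      simp [Cross] at h23 ⊢; grind [far_comm, anti_comm]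
  have f1 := farL_of_farL_merge (G := G) (l := a₁ :: (m₁ ++ [b₁])) (by
    simp [Cross] at h13 ⊢; grind [far_comm]) n1
  have f2 := farL_of_farL_merge (G := G) (l := a₂ :: (m₂ ++ [b₂])) (by
    simp [Cross] at h23 ⊢; grind [far_comm]) n2
  obtain ⟨p₀, e, he⟩ : ∃ p₀ e, a₃ :: p = p₀ ++ [e] := by
    rcases List.eq_nil_or_concat (a₃ :: p) with h | ⟨l, e, h⟩
    · simp at h
    · exact ⟨l, e, by simpa using h⟩
  obtain ⟨q₀, e', he'⟩ : ∃ q₀ e', b₃ :: q.reverse = q₀ ++ [e'] := by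
    rcases List.eq_nil_or_concat (b₃ :: q.reverse) with h | ⟨l, e, h⟩
    · simp at h
    · exact ⟨l, e, by simpa using h⟩
  have he₂ : q ++ [b₃] = e' :: q₀.reverse := by
    have := congrArg List.reverse he'
    simpa using this
  rw [he] at x1 n3
  rw [he₂] at x2
  have x1' : IndPath (merge G a b) (p₀ ++ e :: [a]) := by simpa using x1
  have f3 := farL_of_farL_merge (G := G) (l := p₀) (by
    have := x1'.anti
    simpa using this) fun v hv => n3 v (by simp [hv])
  have f4 := farL_of_farL_merge (G := G) (l := q₀) (by
    have := x2.2.1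
    simpa using this) fun v hv => n4' v (by rw [he']; simp [hv])
  have g1 := (merge_adj_left.1 x1'.right.1.symm).2
  have g2 := (merge_adj_left.1 x2.1).2
  have pr : ∀ y, y = a ∨ y = b → G.Adj y e → G.Adj y e' → False := fun y hy h1 h2 =>
    hP _ _ _ _ _ _ _ _ _ (ho.prismL he he' h1 h2 (f3 y hy) (f4 y hy) (f1 y hy) (f2 y hy))
  have op : ∀ x y, x = a ∨ x = b → y = a ∨ y = b → Far G x y → NoOpenRung G x y → G.Adj x e →
      G.Adj y e' → ¬ G.Adj x e' → ¬ G.Adj y e → False := by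
    intro x y hx hy hxy hno h1 h2 h3 h4
    have nx : x ∉ b₃ :: q.reverse := fun h' => by have := n4' x h'; simp at this; tauto
    have ny : y ∉ p₀ ++ [e] := fun h' => by have := n3 y h'; simp at this; tauto
    have k1 : FarL G x (b₃ :: q.reverse) := by
      rw [he']
      intro v hv
      rcases List.mem_append.1 hv with hv | hv
      · exact f4 x hx v hv
      · obtain rfl : v = e' := by simpa using hv
        exact ⟨by rintro rfl; exact nx (by rw [he']; simp), h3⟩
    have k2 : FarL G y (a₃ :: (p ++ [x])) := by
      rw [← List.cons_append, he]
      intro v hv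
      simp only [List.mem_append, List.mem_singleton] at hv
      rcases hv with (hv | rfl) | rfl
      · exact f3 y hy v hv
      · exact ⟨by rintro rfl; exact ny (by simp), h4⟩
      · exact hxy.symm
    have ho1 := ho.extend he h1 (f3 x hx) (f1 x hx) (f2 x hx) k1
    have ho2 := ho1.flip.extend he' h2 (f4 y hy) (by have := f1 y hy; simp at this ⊢; tauto)
      (by have := f2 y hy; simp at this ⊢; tauto) k2
    have ho3 := ho2.flip
    simp only [List.reverse_reverse] at ho3
    exact hno _ _ _ _ _ _ _ _ _ _ (a₃ :: p) (b₃ :: q.reverse) ho3 (by simp) (by simp)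
  have := pr a (.inl rfl)
  have := pr b (.inr rfl)
  have := op a b (.inl rfl) (.inr rfl) hab hno
  have := op b a (.inr rfl) (.inl rfl) hab.symm hno.symm
  tauto

/-- The apex is `a₁`. It is reached from `b₁ b₂ b₃` along the first rung, along the second rung and
the edge `a₂ a₁`, and along `q` and through `y`. -/
theorem OddHoleFree.no_corner_pyramid (hG : OddHoleFree G) {y e : V} {q q₀ : List V}
    (p1 : IndPath G (a₁ :: (m₁ ++ [b₁]))) (p2 : IndPath G (a₂ :: (m₂ ++ [b₂])))
    (h12 : Cross G a₁ m₁ b₁ a₂ m₂ b₂) (pb : IndPath G (b₃ :: q)) (he : b₃ :: q = q₀ ++ [e])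
    (b13 : G.Adj b₁ b₃) (b23 : G.Adj b₂ b₃) (fb1 : FarL G b₃ (a₁ :: m₁)) (fb2 : FarL G b₃ (a₂ :: m₂))
    (aq1 : Anti G q (a₁ :: (m₁ ++ [b₁]))) (aq2 : Anti G q (a₂ :: (m₂ ++ [b₂])))
    (g1 : FarL G y (m₁ ++ [b₁])) (g2 : FarL G y (m₂ ++ [b₂])) (g4 : FarL G y q₀)
    (hy1 : G.Adj y a₁) (hy2 : Far G y a₂) (hye : G.Adj y e) : False := by
  have k2 : IndPath G (b₂ :: ((m₂.reverse ++ [a₂]) ++ [a₁])) := by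
    have := IndPath.concat (l := b₂ :: m₂.reverse) (by simpa using p2.reverse_mid) h12.1.symm (by
      simp [Cross] at h12; simp; grind [far_comm])
    simpa using this
  have k3 : IndPath G (b₃ :: ((q ++ [y]) ++ [a₁])) := by
    have := IndPath.concat (l := b₃ :: q) (by simpa using pb.cons_concat he hye g4) hy1 (by
      simp at fb1 aq1 ⊢; grind [far_comm])
    simpa using this
  refine hG.no_pyramid (u := a₁) p1.reverse_mid k2 k3 ?_ ?_ ?_ (by simp) (by simp) (by simp)
  · clear p1 p2 pb he k2 k3; simp [HeadCross, Cross] at *; grind [far_comm]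
  · clear p1 p2 pb he k2 k3; simp [HeadCross, Cross] at *; grind [far_comm, anti_comm]
  · clear p1 p2 pb he k2 k3; simp [HeadCross, Cross] at *; grind [far_comm, anti_comm]

/-- The case analysis on which of `p`, `q`, `r` hold for the first and for the second vertex. -/
theorem false_of_corner_cases {p q r p' q' r' : Prop} : p ∨ p' → q ∨ q' → r ∨ r' → (p → q → r → False) →
    (p' → q' → r' → False) → (p → q → ¬ r → r' → ¬ p' → ¬ q' → False) →
    (p' → q' → ¬ r' → r → ¬ p → ¬ q → False) → (p → ¬ q → r → False) →
    (p' → ¬ q' → r' → False) → (q → ¬ p → r → False) → (q' → ¬ p' → r' → False) →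
    (p → ¬ q → q' → ¬ p' → False) → (p' → ¬ q' → q → ¬ p → False) → False := by
  by_cases p <;> by_cases q <;> by_cases r <;> by_cases p' <;> by_cases q' <;> by_cases r' <;> simp [*]

-- The neighbours `a₁`, `a₂`, `e` of the new vertex are each seen by `a` or `b`. If one of the two
-- sees all three, there is a prism in `G`; if it sees `e` and just one of `a₁`, `a₂`, a pyramid. If
-- one sees `a₁` and `a₂` only and the other `e` only, there is a broken rung. If one sees `a₁` but
-- not `a₂` and the other `a₂` but not `a₁`, then `a` and `b` are joined by a chordless path of
-- length three.
set_option maxHeartbeats 1000000 in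
theorem merge_no_prism_corner (hG : OddHoleFree G) (hP : PrismFree G) (hab : Far G a b)
    (hno : NoOpenRung G a b) (hodd : ∀ m, IndPath G (a :: (m ++ [b])) → Odd m.length)
    (h : PrismL (merge G a b) a₁ m₁ b₁ a₂ m₂ b₂ a m₃ b₃) : False := by
  have key : ∀ u v, u ∉ ({a, b} : Set V) → v ∉ ({a, b} : Set V) →
      ((merge G a b).Adj u v ↔ G.Adj u v) := fun u v hu hv => merge_adj_iff hu hv
  have n1 := h.p₁.notMem_of_merge hab.1 (by simp) (List.Subset.refl _) (h.notMem_rung₁ (by simp))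
  have n2 := h.p₂.notMem_of_merge hab.1 (by simp) (List.Subset.refl _)
    (h.swap.notMem_rung₁ (by simp))
  obtain ⟨p1, p2, p3, h12, h13, h23⟩ := h
  have n4 := p3.notMem_of_merge hab.1 (by simp) (l₀ := m₃ ++ [b₃]) (by intro v; simp; grind)
    (by have hnd := p3.nodup; simp at hnd ⊢; grind)
  have n4' : ∀ v ∈ b₃ :: m₃.reverse, v ∉ ({a, b} : Set V) := by
    intro v hv; exact n4 v (by simp at hv ⊢; tauto)
  have n5 : ∀ v ∈ m₃.reverse, v ∉ ({a, b} : Set V) := fun v hv => n4' v (by simp at hv ⊢; tauto)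
  have p1' := p1.transfer key n1
  have p2' := p2.transfer key n2
  have h12' := h12.transfer key n1 n2
  have pb : IndPath G (b₃ :: m₃.reverse) := by
    have := indPath_reverse.2 p3.tail
    exact IndPath.transfer key (by simpa using this) n4'
  have b13 := (key _ _ (n1 _ (by simp)) (n4 _ (by simp))).1 h13.2.1
  have b23 := (key _ _ (n2 _ (by simp)) (n4 _ (by simp))).1 h23.2.1
  have fb1 : FarL G b₃ (a₁ :: m₁) := by
    refine FarL.transfer key ?_ (n4 _ (by simp)) fun v hv => n1 v (by simp at hv ⊢; grind)
    simp [Cross] at h13 ⊢; grind [far_comm]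
  have fb2 : FarL G b₃ (a₂ :: m₂) := by
    refine FarL.transfer key ?_ (n4 _ (by simp)) fun v hv => n2 v (by simp at hv ⊢; grind)
    simp [Cross] at h23 ⊢; grind [far_comm]
  have aq1 : Anti G m₃.reverse (a₁ :: (m₁ ++ [b₁])) := by
    refine Anti.transfer key ?_ n5 n1
    simp [Cross] at h13 ⊢; grind [far_comm, anti_comm]
  have aq2 : Anti G m₃.reverse (a₂ :: (m₂ ++ [b₂])) := by
    refine Anti.transfer key ?_ n5 n2
    simp [Cross] at h23 ⊢; grind [far_comm, anti_comm]
  have g1 := farL_of_farL_merge (G := G) (a := a) (b := b) (l := m₁ ++ [b₁]) (by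
    simp [Cross] at h13 ⊢; grind [far_comm]) fun v hv => n1 v (by simp at hv ⊢; grind)
  have g2 := farL_of_farL_merge (G := G) (a := a) (b := b) (l := m₂ ++ [b₂]) (by
    simp [Cross] at h23 ⊢; grind [far_comm]) fun v hv => n2 v (by simp at hv ⊢; grind)
  obtain ⟨q₀, e, he⟩ : ∃ q₀ e, b₃ :: m₃.reverse = q₀ ++ [e] := by
    rcases List.eq_nil_or_concat (b₃ :: m₃.reverse) with h | ⟨l, e, h⟩
    · simp at h
    · exact ⟨l, e, by simpa using h⟩
  have he₂ : m₃ ++ [b₃] = e :: q₀.reverse := by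
    have := congrArg List.reverse he
    simpa using this
  have p3' := p3
  rw [he₂] at p3'
  have g4 := farL_of_farL_merge (G := G) (l := q₀) (by simpa using p3'.2.1)
    fun v hv => n4' v (by rw [he]; simp [hv])
  have c1 := (merge_adj_left.1 h13.1.symm).2
  have c2 := (merge_adj_left.1 h23.1.symm).2
  have c3 := (merge_adj_left.1 p3'.1).2
  have hne : ∀ y, y = a ∨ y = b → y ≠ a₁ ∧ y ≠ a₂ ∧ y ≠ e := by
    intro y hy
    have k1 := n1 a₁ (by simp)
    have k2 := n2 a₂ (by simp)
    have k3 := n4 e (by rw [he₂]; simp)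
    simp at k1 k2 k3
    grind
  have far1 : ∀ y, y = a ∨ y = b → ¬ G.Adj y a₁ → FarL G y (a₁ :: (m₁ ++ [b₁])) := fun y hy hn => by
    rw [farL_cons]
    exact ⟨⟨(hne y hy).1, hn⟩, g1 y hy⟩
  have far2 : ∀ y, y = a ∨ y = b → ¬ G.Adj y a₂ → FarL G y (a₂ :: (m₂ ++ [b₂])) := fun y hy hn => by
    rw [farL_cons]
    exact ⟨⟨(hne y hy).2.1, hn⟩, g2 y hy⟩
  have far3 : ∀ y, y = a ∨ y = b → ¬ G.Adj y e → FarL G y (b₃ :: m₃.reverse) := fun y hy hn => by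
    rw [he, farL_append]
    exact ⟨g4 y hy, by simpa using ⟨(hne y hy).2.2, hn⟩⟩
  have pr : ∀ y, y = a ∨ y = b → G.Adj y a₁ → G.Adj y a₂ → G.Adj y e → False := by
    intro y hy k1 k2 k3
    have hp := (pb.cons_concat he k3 (g4 y hy)).reverse_mid
    simp only [List.reverse_reverse] at hp
    have q1 := g1 y hy
    have q2 := g2 y hy
    refine hP a₁ m₁ b₁ a₂ m₂ b₂ y m₃ b₃ ⟨p1', p2', hp, h12', ?_, ?_⟩
    · have := k1.symm
      simp [Cross] at fb1 aq1 q1 ⊢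
      grind [far_comm, anti_comm]
    · have := k2.symm
      simp [Cross] at fb2 aq2 q2 ⊢
      grind [far_comm, anti_comm]
  have op : ∀ x y, x = a ∨ x = b → y = a ∨ y = b → Far G x y → NoOpenRung G x y → G.Adj x a₁ →
      G.Adj x a₂ → ¬ G.Adj x e → G.Adj y e → ¬ G.Adj y a₁ → ¬ G.Adj y a₂ → False := by
    intro x y hx hy hxy hno k1 k2 k3 k4 k5 k6
    have ho : OpenRung G a₁ m₁ b₁ a₂ m₂ b₂ x [] b₃ m₃.reverse :=
      ⟨p1', p2', by simp, pb, by have := far3 x hx k3; simp at this ⊢; exact ⟨this.1.symm, this.2⟩, h12', k1.symm, k2.symm, b13, b23, g1 x hx,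
        g2 x hx, fb1, fb2, by simp, by simp, aq1, aq2⟩
    have ho2 := ho.flip.extend he k4 (g4 y hy) (by have := far1 y hy k5; simp at this ⊢; tauto)
      (by have := far2 y hy k6; simp at this ⊢; tauto) (by simpa using hxy.symm)
    have ho3 := ho2.flip
    simp only [List.reverse_reverse] at ho3
    exact hno _ _ _ _ _ _ _ _ _ _ [] (b₃ :: m₃.reverse) ho3 (by simp) (by simp)
  have py1 : ∀ y, y = a ∨ y = b → G.Adj y a₁ → ¬ G.Adj y a₂ → G.Adj y e → False := fun y hy k1 k2 k3 =>
    hG.no_corner_pyramid p1' p2' h12' pb he b13 b23 fb1 fb2 aq1 aq2 (g1 y hy) (g2 y hy) (g4 y hy) k1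
      ⟨(hne y hy).2.1, k2⟩ k3
  have py2 : ∀ y, y = a ∨ y = b → G.Adj y a₂ → ¬ G.Adj y a₁ → G.Adj y e → False := fun y hy k1 k2 k3 =>
    hG.no_corner_pyramid p2' p1' h12'.symm pb he b23 b13 fb2 fb1 aq2 aq1 (g2 y hy) (g1 y hy) (g4 y hy) k1
      ⟨(hne y hy).1, k2⟩ k3
  have ev : ∀ x y, x = a ∨ x = b → y = a ∨ y = b → Far G x y → G.Adj x a₁ → ¬ G.Adj x a₂ → G.Adj y a₂ →
      ¬ G.Adj y a₁ → IndPath G (x :: ([a₁, a₂] ++ [y])) := by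
    intro x y hx hy hxy k1 k2 k3 k4
    have q1 : Far G x a₂ := ⟨(hne x hx).2.1, k2⟩
    have q2 : Far G a₁ y := ⟨(hne y hy).1.symm, fun e => k4 e.symm⟩
    exact ⟨k1, by simp [q1, hxy], h12'.1, by simp [q2], indPath_pair.2 k3.symm⟩
  have z1 := pr a (.inl rfl)
  have z2 := pr b (.inr rfl)
  have z3 := op a b (.inl rfl) (.inr rfl) hab hno
  have z4 := op b a (.inr rfl) (.inl rfl) hab.symm hno.symm
  have z5 := py1 a (.inl rfl)
  have z6 := py1 b (.inr rfl)
  have z7 := py2 a (.inl rfl)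
  have z8 := py2 b (.inr rfl)
  have z9 : G.Adj a a₁ → ¬ G.Adj a a₂ → G.Adj b a₂ → ¬ G.Adj b a₁ → False := fun k1 k2 k3 k4 => by
    have := hodd _ (ev a b (.inl rfl) (.inr rfl) hab k1 k2 k3 k4)
    simp at this
    grind
  have z10 : G.Adj b a₁ → ¬ G.Adj b a₂ → G.Adj a a₂ → ¬ G.Adj a a₁ → False := fun k1 k2 k3 k4 => by
    have := hodd _ (ev b a (.inr rfl) (.inl rfl) hab.symm k1 k2 k3 k4).reverse_mid
    simp at this
    grind
  exact false_of_corner_cases c1 c2 c3 z1 z2 z3 z4 z5 z6 z7 z8 z9 z10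

theorem merge_prismFree (hG : OddHoleFree G) (hP : PrismFree G) (hab : Far G a b)
    (hno : NoOpenRung G a b) (hodd : ∀ m, IndPath G (a :: (m ++ [b])) → Odd m.length) :
    PrismFree (merge G a b) := by
  have key : ∀ u v, u ∉ ({a, b} : Set V) → v ∉ ({a, b} : Set V) →
      ((merge G a b).Adj u v ↔ G.Adj u v) := fun u v hu hv => merge_adj_iff hu hv
  have aux : ∀ {a₁ m₁ b₁ a₂ m₂ b₂ a₃ m₃ b₃}, PrismL (merge G a b) a₁ m₁ b₁ a₂ m₂ b₂ a₃ m₃ b₃ →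
      a ∉ a₃ :: (m₃ ++ [b₃]) := by
    intro a₁ m₁ b₁ a₂ m₂ b₂ a₃ m₃ b₃ h ham
    simp only [List.mem_cons, List.mem_append, List.not_mem_nil, or_false] at ham
    rcases ham with rfl | ham | rfl
    · exact merge_no_prism_corner hG hP hab hno hodd h
    · exact merge_no_prism_middle hP hab hno h ham
    · exact merge_no_prism_corner hG hP hab hno hodd h.flip
  intro a₁ m₁ b₁ a₂ m₂ b₂ a₃ m₃ b₃ h
  have n3 := h.p₃.notMem_of_merge hab.1 (by simp) (List.Subset.refl _) (aux h)
  have n1 := h.p₁.notMem_of_merge hab.1 (by simp) (List.Subset.refl _) (aux h.rotate)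
  have n2 := h.p₂.notMem_of_merge hab.1 (by simp) (List.Subset.refl _) (aux h.rotate.rotate)
  obtain ⟨p1, p2, p3, h12, h13, h23⟩ := h
  exact hP _ _ _ _ _ _ _ _ _ ⟨p1.transfer key n1, p2.transfer key n2, p3.transfer key n3,
    h12.transfer key n1 n2, h13.transfer key n1 n3, h23.transfer key n2 n3⟩

end merge
end ArtemisGraph

namespace ArtemisGraph
open SimpleGraph

variable {V : Type*} {G : SimpleGraph V}

/-! ### The chosen pair does not create prisms -/

section OpenRung

variable {a₁ b₁ a₂ b₂ a₃ b₃ a b v : V} {m₁ m₂ p q p' q' : List V}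

/-- The vertices of a prism with a broken rung. -/
def InOpenRung (a₁ : V) (m₁ : List V) (b₁ a₂ : V) (m₂ : List V) (b₂ a₃ : V) (p : List V) (b₃ : V)
    (q : List V) (v : V) : Prop :=
  v ∈ a₁ :: (m₁ ++ [b₁]) ∨ v ∈ a₂ :: (m₂ ++ [b₂]) ∨ v ∈ a₃ :: p ∨ v ∈ b₃ :: q

theorem OpenRung.transfer {H : SimpleGraph V} {T : Set V}
    (key : ∀ u v, u ∉ T → v ∉ T → (G.Adj u v ↔ H.Adj u v))
    (h : OpenRung G a₁ m₁ b₁ a₂ m₂ b₂ a₃ p b₃ q)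
    (n : ∀ v, InOpenRung a₁ m₁ b₁ a₂ m₂ b₂ a₃ p b₃ q v → v ∉ T) :
    OpenRung H a₁ m₁ b₁ a₂ m₂ b₂ a₃ p b₃ q := by
  have n1 : ∀ v ∈ a₁ :: (m₁ ++ [b₁]), v ∉ T := fun v hv => n v (.inl hv)
  have n2 : ∀ v ∈ a₂ :: (m₂ ++ [b₂]), v ∉ T := fun v hv => n v (.inr (.inl hv))
  have n3 : ∀ v ∈ a₃ :: p, v ∉ T := fun v hv => n v (.inr (.inr (.inl hv)))
  have n4 : ∀ v ∈ b₃ :: q, v ∉ T := fun v hv => n v (.inr (.inr (.inr hv)))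
  have n3' : ∀ v ∈ p, v ∉ T := fun v hv => n3 v (by simp [hv])
  have n4' : ∀ v ∈ q, v ∉ T := fun v hv => n4 v (by simp [hv])
  have a1 := n1 a₁ (by simp)
  have a2 := n2 a₂ (by simp)
  have a3 := n3 a₃ (by simp)
  have b1 := n1 b₁ (by simp)
  have b2 := n2 b₂ (by simp)
  have b3 := n4 b₃ (by simp)
  exact ⟨h.p₁.transfer key n1, h.p₂.transfer key n2, h.pa.transfer key n3, h.pb.transfer key n4,
    h.anti.transfer key n3 n4, h.h₁₂.transfer key n1 n2, (key _ _ a1 a3).1 h.a₁₃,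
    (key _ _ a2 a3).1 h.a₂₃, (key _ _ b1 b3).1 h.b₁₃, (key _ _ b2 b3).1 h.b₂₃,
    h.far_a₁.transfer key a3 fun v hv => n1 v (List.mem_cons_of_mem _ hv),
    h.far_a₂.transfer key a3 fun v hv => n2 v (List.mem_cons_of_mem _ hv),
    h.far_b₁.transfer key b3 fun v hv => n1 v (by simp at hv ⊢; tauto),
    h.far_b₂.transfer key b3 fun v hv => n2 v (by simp at hv ⊢; tauto),
    h.anti_p₁.transfer key n3' n1, h.anti_p₂.transfer key n3' n2,
    h.anti_q₁.transfer key n4' n1, h.anti_q₂.transfer key n4' n2⟩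

/-- On an unbroken rung, only the end in the triangle of `a₃` can see the piece that contains `a`,
and only the other end the piece that contains `b`; and the two pieces are anticomplete to each
other. -/
theorem OpenRung.not_adj_both (h : OpenRung G a₁ m₁ b₁ a₂ m₂ b₂ a₃ p b₃ q) (ha : a ∈ a₃ :: p)
    (hb : b ∈ b₃ :: q) (hv : InOpenRung a₁ m₁ b₁ a₂ m₂ b₂ a₃ p b₃ q v) (hva : G.Adj v a) :
    ¬ G.Adj v b := by
  intro hvb
  have aux : ∀ {a₁ m₁ b₁ a₂ m₂ b₂}, OpenRung G a₁ m₁ b₁ a₂ m₂ b₂ a₃ p b₃ q →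
      v ∈ a₁ :: (m₁ ++ [b₁]) → False := by
    intro a₁ m₁ b₁ a₂ m₂ b₂ h hv'
    have e1 : v = a₁ := by
      rcases List.mem_cons.1 ha with rfl | ha
      · by_contra hne
        exact (h.far_a₁ v ((List.mem_cons.1 hv').resolve_left hne)).2 hva.symm
      · exact absurd hva.symm (h.anti_p₁ a ha v hv').2
    have e2 : v = b₁ := by
      rcases List.mem_cons.1 hb with rfl | hb
      · by_contra hne
        exact (h.far_b₁ v (by simp at hv' ⊢; tauto)).2 hvb.symm
      · exact absurd hvb.symm (h.anti_q₁ b hb v hv').2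
    have := h.p₁.nodup
    simp at this
    exact this.1.2 (e1.symm.trans e2)
  rcases hv with hv | hv | hv | hv
  · exact aux h hv
  · exact aux h.swap hv
  · exact (h.anti v hv b hb).2 hvb
  · exact (h.anti a ha v hv).2 hva.symm

theorem OpenRung.path₁ (h : OpenRung G a₁ m₁ b₁ a₂ m₂ b₂ a₃ p b₃ q) :
    IndPath G (q.reverse ++ b₃ :: (b₁ :: (m₁.reverse ++ a₁ :: a₃ :: p))) := by
  obtain ⟨h1, h2, h3, h4, h5, h6, h7, h8, h9, h10, h11, h12, h13, h14, h15, h16, h17, h18⟩ := h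
  have k1 : IndPath G ((b₁ :: m₁.reverse) ++ a₁ :: (a₃ :: p)) := by
    refine indPath_append.2 ⟨h1.reverse_mid, ⟨h7, ?_, h3⟩, ?_⟩
    · simp at h15 ⊢; grind [far_comm]
    · simp at h11 h15 ⊢; grind [far_comm, anti_comm]
  refine indPath_append.2 ⟨by simpa using indPath_reverse.2 h4, ⟨h9.symm, ?_, by simpa using k1⟩, ?_⟩
  · simp at h5 h13 ⊢; grind [far_comm]
  · simp at h5 h17 ⊢; grind [far_comm, anti_comm]

/-- The two pieces and one unbroken rung form a chordless path from `b` to `a`, on which `a` sees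
only the penultimate vertex. So `v` is that vertex, and `w` is what lies between `b` and `v`. -/
theorem OpenRung.exists_chain₁ (h : OpenRung G a₁ m₁ b₁ a₂ m₂ b₂ a₃ p b₃ q) (hp : a₃ :: p = p' ++ [a])
    (hq : b₃ :: q = q' ++ [b]) (hv : v ∈ a₁ :: (m₁ ++ [b₁]) ∨ v ∈ a₃ :: p ∨ v ∈ b₃ :: q)
    (hvb : v ≠ b) (hva : G.Adj a v) :
    ∃ w, List.IsChain G.Adj (b :: (w ++ [v])) ∧ FarL G a w ∧
      ∀ x ∈ w, InOpenRung a₁ m₁ b₁ a₂ m₂ b₂ a₃ p b₃ q x := by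
  have hI := h.path₁
  have hq' : q.reverse ++ [b₃] = b :: q'.reverse := by
    have := congrArg List.reverse hq
    simpa using this
  have e : q.reverse ++ b₃ :: (b₁ :: (m₁.reverse ++ a₁ :: a₃ :: p)) =
      b :: ((q'.reverse ++ b₁ :: (m₁.reverse ++ a₁ :: p')) ++ [a]) := by
    rw [hp, List.append_cons, hq']
    simp
  have hmem : ∀ x, x ∈ q.reverse ++ b₃ :: (b₁ :: (m₁.reverse ++ a₁ :: a₃ :: p)) ↔
      x ∈ a₁ :: (m₁ ++ [b₁]) ∨ x ∈ a₃ :: p ∨ x ∈ b₃ :: q := by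
    intro x; simp; tauto
  rw [e] at hI hmem
  have hvm : v ∈ q'.reverse ++ b₁ :: (m₁.reverse ++ a₁ :: p') := by
    have := (hmem v).2 hv
    simp only [List.mem_cons, List.mem_append, List.not_mem_nil, or_false] at this ⊢
    have := hva.ne
    grind
  obtain ⟨w, hw⟩ := hI.eq_concat_of_adj hvm hva
  rw [hw] at hI hmem
  refine ⟨w, ?_, ?_, fun x hx => ?_⟩
  · have : IndPath G ((b :: (w ++ [v])) ++ [a]) := by simpa using hI
    exact this.left.isChain
  · have : IndPath G ((b :: w) ++ v :: [a]) := by simpa using hI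
    have := this.anti
    simp at this
    exact this.2
  · have := (hmem x).1 (by simp [hx])
    unfold InOpenRung
    tauto

theorem OpenRung.exists_chain (h : OpenRung G a₁ m₁ b₁ a₂ m₂ b₂ a₃ p b₃ q) (hp : a₃ :: p = p' ++ [a])
    (hq : b₃ :: q = q' ++ [b]) (hv : InOpenRung a₁ m₁ b₁ a₂ m₂ b₂ a₃ p b₃ q v)
    (hvb : v ≠ b) (hva : G.Adj a v) :
    ∃ w, List.IsChain G.Adj (b :: (w ++ [v])) ∧ FarL G a w ∧
      ∀ x ∈ w, InOpenRung a₁ m₁ b₁ a₂ m₂ b₂ a₃ p b₃ q x := by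
  by_cases hv2 : v ∈ a₂ :: (m₂ ++ [b₂])
  · obtain ⟨w, h1, h2, h3⟩ := h.swap.exists_chain₁ hp hq (.inl hv2) hvb hva
    refine ⟨w, h1, h2, fun x hx => ?_⟩
    have := h3 x hx
    unfold InOpenRung at this ⊢
    tauto
  · exact h.exists_chain₁ hp hq (by unfold InOpenRung at hv; tauto) hvb hva

end OpenRung

namespace Frame

variable {T : Set V} {t : V} {Z : List V} {A B : Set V} {a₁ b₁ a₂ b₂ a₃ b₃ a b v : V}
  {m₁ m₂ p q p' q' : List V}

/-- Another vertex `v` of `A` would see `a`, and a chain inside the broken prism would lead from `b`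
to `v` with no neighbour of `a` in between. This chain crosses the frontier, all of which `a` sees.
-/
theorem eq_of_mem_openRung (h : Frame G T t Z A B) {M : Set V} (hM : Reach G T A B M)
    (ho : OpenRung G a₁ m₁ b₁ a₂ m₂ b₂ a₃ p b₃ q) (hp : a₃ :: p = p' ++ [a])
    (hq : b₃ :: q = q' ++ [b]) (n : ∀ v, InOpenRung a₁ m₁ b₁ a₂ m₂ b₂ a₃ p b₃ q v → v ∉ T)
    (ha : a ∈ A) (hb : b ∈ B) (hK : ∀ k ∈ frontier G T A M, G.Adj a k) (hv : v ∈ A)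
    (hvo : InOpenRung a₁ m₁ b₁ a₂ m₂ b₂ a₃ p b₃ q v) : v = a := by
  by_contra hne
  obtain ⟨w, hw, hf, hwo⟩ := ho.exists_chain hp hq hvo (h.far hv hb).1 (h.adj_left ha hv (Ne.symm hne))
  obtain ⟨k, hk, hk'⟩ := hM.exists_mem_frontier (hM.sub hb) hv hw fun x hx => n x (hwo x hx)
  exact (hf k hk).2 (hK k hk')

/-- No vertex of a broken prism sees both `a` and `b`. This keeps the broken prism out of `T` and
excludes vertices complete to `A` and `B`. By `touch`, the neighbours of `t` in it that see `Z` are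
then `a` and `b` only. -/
theorem noOpenRung (h : Frame G T t Z A B) {M M' : Set V} (hM : Reach G T A B M)
    (hM' : Reach G T B A M') (ha : a ∈ A) (hb : b ∈ B) (hK : ∀ k ∈ frontier G T A M, G.Adj a k)
    (hL : ∀ k ∈ frontier G T B M', G.Adj b k) : NoOpenRung G a b := by
  intro a₁ m₁ b₁ a₂ m₂ b₂ a₃ p b₃ q p' q' ho hp hq
  have hap : a ∈ a₃ :: p := by rw [hp]; simp
  have hbq : b ∈ b₃ :: q := by rw [hq]; simp
  have n : ∀ v, InOpenRung a₁ m₁ b₁ a₂ m₂ b₂ a₃ p b₃ q v → v ∉ T := fun v hv hvT =>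
    ho.not_adj_both hap hbq hv (h.mem_comp_left ha v hvT) (h.mem_comp_right hb v hvT)
  have hflip : ∀ v, InOpenRung b₁ m₁.reverse a₁ b₂ m₂.reverse a₂ b₃ q a₃ p v ↔
      InOpenRung a₁ m₁ b₁ a₂ m₂ b₂ a₃ p b₃ q v := by
    intro v; unfold InOpenRung; simp; tauto
  refine h.core.false_of_openRung (ho.transfer h.adj_iff' n) ha hb hp hq fun v hv hvt hvz => ?_
  rcases h.core.touch v hvt hvz with h1 | h1 | ⟨h1, h2⟩
  · exact .inl (h.eq_of_mem_openRung hM ho hp hq n ha hb hK h1 hv)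
  · exact .inr (h.swap.eq_of_mem_openRung hM' ho.flip hq hp (fun v hv => n v ((hflip v).1 hv)) hb ha hL h1
      ((hflip v).2 hv))
  · exact absurd ((h.adj_iff _ _ (n v hv) (h.notMem_right hb)).1 (h2 b hb))
      (ho.not_adj_both hap hbq hv ((h.adj_iff _ _ (n v hv) (h.notMem_left ha)).1 (h1 a ha)))

end Frame

/-! ### The contracted graph inside `merge` -/

theorem HasPrism.map {W : Type*} {H : SimpleGraph W} (h : HasPrism H) (f : H ↪g G) : HasPrism G := by
  obtain ⟨a, b, P, h1, h2, h3, h4, h5, h6⟩ := h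
  refine ⟨f ∘ a, f ∘ b, fun i => (P i).map f.toHom, fun i j hij => f.map_adj_iff.2 (h1 i j hij),
    fun i j hij => f.map_adj_iff.2 (h2 i j hij), fun i j e => h3 i j (f.injective e),
    fun i => (h4 i).map f.injective, ?_, ?_⟩
  · intro i j hij u hu hu'
    rw [Walk.support_map, List.mem_map] at hu hu'
    obtain ⟨x, hx, rfl⟩ := hu
    obtain ⟨x', hx', e⟩ := hu'
    obtain rfl : x' = x := f.injective e
    exact h5 i j hij _ hx hx'
  · intro i j u hu v hv huv
    rw [Walk.support_map, List.mem_map] at hu hv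
    obtain ⟨x, hx, rfl⟩ := hu
    obtain ⟨y, hy, rfl⟩ := hv
    rcases h6 i j x hx y hy (f.map_adj_iff.1 huv) with ⟨e, h⟩ | ⟨e, h⟩
    · refine .inl ⟨e, ?_⟩
      rw [Walk.edges_map, List.mem_map]
      exact ⟨s(x, y), h, rfl⟩
    · refine .inr ⟨e, ?_⟩
      rcases h with ⟨rfl, rfl⟩ | ⟨rfl, rfl⟩
      · exact .inl ⟨rfl, rfl⟩
      · exact .inr ⟨rfl, rfl⟩

theorem exists_contract_embedding (G : SimpleGraph V) (a b : V) :
    Nonempty (contract G a b ↪g merge G a b) := by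
  refine ⟨⟨⟨fun x => x.elim a Subtype.val, ?_⟩, ?_⟩⟩
  · rintro (_ | ⟨u, hu⟩) (_ | ⟨v, hv⟩) e
    · rfl
    · exact absurd e.symm hv.1
    · exact absurd e hu.1
    · simpa using e
  · have key : ∀ v : {v : V // v ≠ a ∧ v ≠ b}, v.1 ∉ ({a, b} : Set V) := fun v => by simpa using v.2
    rintro (_ | u) (_ | v)
    · exact ⟨fun h => (h.ne rfl).elim, fun h => h.elim⟩
    · exact merge_adj_left.trans ⟨fun h => h.2, fun h => ⟨key v, h⟩⟩
    · exact (adj_comm _ _ _).trans (merge_adj_left.trans ⟨fun h => h.2, fun h => ⟨key u, h⟩⟩)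
    · exact merge_adj_iff (key u) (key v)

end ArtemisGraph

namespace ArtemisGraph
open SimpleGraph

variable {V : Type*} {G : SimpleGraph V} {T : Set V}

/-! ### Minimal outer paths -/

theorem complete_eq_comp : complete G T = Comp G T := by
  ext v
  exact ⟨fun h => h.2, fun h => ⟨notMem_of_mem_comp h, h⟩⟩

theorem IsMaximalInteresting.connIn (hT : IsMaximalInteresting G T) : ConnIn Gᶜ T :=
  connIn_of_preconnected hT.1.2.1.preconnected

theorem ConnIn.insert_of_adj {H : SimpleGraph V} (hT : ConnIn H T) {z s : V} (hs : s ∈ T) (hzs : H.Adj z s) :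
    ConnIn H (insert z T) := by
  have key : ∀ u ∈ insert z T, LinkIn H (insert z T) u s := by
    rintro u (rfl | hu)
    · exact .single ⟨hzs, by simp, by simp [hs]⟩
    · exact (hT u hu s hs).mono (Set.subset_insert _ _)
  exact fun u hu v hv => (key u hu).trans (key v hv).symm

/-- The neighbours in `C(T)` of an outer vertex of a maximal interesting set `T` form a clique. -/
theorem IsMaximalInteresting.isClique (hT : IsMaximalInteresting G T) {z : V} (hz : z ∉ T)
    (hzC : z ∉ Comp G T) : G.IsClique {u | u ∈ Comp G T ∧ G.Adj z u} := by
  by_contra hcl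
  obtain ⟨s, hs, hzs⟩ : ∃ s ∈ T, ¬ G.Adj s z := by
    by_contra! h
    exact hzC h
  -- If the neighbours are not a clique, then `insert z T` is a larger interesting set; it is
  -- co-connected because `z` misses the vertex `s` of `T`.
  refine hT.2 (insert z T) ⟨⟨z, by simp⟩, ?_, ?_⟩ (Set.ssubset_insert hz)
  · have : Nonempty (insert z T : Set V) := ⟨⟨z, by simp⟩⟩
    refine ⟨preconnected_of_connIn (hT.connIn.insert_of_adj hs ?_)⟩
    rw [compl_adj]
    exact ⟨by rintro rfl; exact hz hs, fun e => hzs e.symm⟩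
  · refine fun h => hcl (h.subset ?_)
    rintro u ⟨hu, hzu⟩
    rw [complete_eq_comp]
    rintro t (rfl | ht)
    · exact hzu
    · exact hu t ht

/-- A minimal outer path `x, m, y` in which `m` has odd length at least two. -/
structure MinOuter (G : SimpleGraph V) (T : Set V) (x : V) (m : List V) (y : V) : Prop where
  path : IndPath G (x :: (m ++ [y]))
  odd : Odd m.length
  two_le : 2 ≤ m.length
  left : x ∈ Comp G T
  right : y ∈ Comp G T
  out : ∀ v ∈ m, v ∉ T ∧ v ∉ Comp G T
  min : ∀ x' m' y', IndPath G (x' :: (m' ++ [y'])) → m' ≠ [] → x' ∈ Comp G T → y' ∈ Comp G T →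
    m' ⊆ m → m ⊆ m'
  clique : ∀ v ∈ m, G.IsClique {u | u ∈ Comp G T ∧ G.Adj v u}

/-- The vertices of `C(T)` that see the first vertex of `m` and miss the other ones. -/
def firstSet (G : SimpleGraph V) (T : Set V) (m : List V) : Set V :=
  {u | u ∈ Comp G T ∧ (∃ z ∈ m.head?, G.Adj z u) ∧ FarL G u m.tail}

namespace MinOuter

variable {x y u a b : V} {m : List V}

theorem swap (h : MinOuter G T x m y) : MinOuter G T y m.reverse x := by
  obtain ⟨h1, h2, h3, h4, h5, h6, h7, h8⟩ := h
  refine ⟨h1.reverse_mid, by simpa, by simpa, h5, h4, by simpa using h6, fun x' m' y' k1 k2 k3 k4 k5 => ?_,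
    by simpa using h8⟩
  have := h7 x' m' y' k1 k2 k3 k4 (by simpa using k5)
  simpa using this

theorem exists_cons (h : MinOuter G T x m y) : ∃ z m', m = z :: m' ∧ m' ≠ [] := by
  have := h.two_le
  match m, this with
  | z :: w :: m', _ => exact ⟨z, w :: m', rfl, by simp⟩

theorem ne_of_mem (h : MinOuter G T x m y) {v : V} (hv : v ∈ m) (hu : u ∈ Comp G T) : u ≠ v := by
  rintro rfl
  exact (h.out u hv).2 hu

/-- If `u` saw a vertex of `m` beyond the first one, then `u` and the part of the path from its last
neighbour on would be an outer path with smaller interior, against minimality. -/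
theorem mem_firstSet_of_far (h : MinOuter G T x m y) (hu : u ∈ Comp G T) (huy : Far G u y)
    (hm : ∃ z ∈ m, G.Adj z u) : u ∈ firstSet G T m := by
  obtain ⟨z, m', rfl, hm'⟩ := h.exists_cons
  have hf : FarL G u m' := by
    by_contra hf
    obtain ⟨l₁, c, l₂, rfl, hc, hl₂⟩ := exists_last_split (fun v => G.Adj u v) (l := m') (by
      by_contra! hn
      exact hf fun v hv => ⟨h.ne_of_mem (by simp [hv]) hu, hn v hv⟩)
    have h1 : IndPath G ((x :: z :: l₁) ++ (c :: (l₂ ++ [y]))) := by simpa using h.path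
    have h2 : IndPath G (u :: ((c :: l₂) ++ [y])) := by
      refine ⟨hc, ?_, h1.right⟩
      intro v hv
      replace hv : v ∈ l₂ ++ [y] := hv
      simp only [List.mem_append, List.mem_singleton] at hv
      rcases hv with hv | rfl
      · exact ⟨h.ne_of_mem (by simp [hv]) hu, hl₂ v hv⟩
      · exact huy
    have h3 := h.min _ _ _ h2 (by simp) hu h.right (by intro v; simp; tauto) (List.mem_cons_self (a := z))
    have := h.path.nodup
    simp at this h3
    grind
  obtain ⟨v, hv, hvu⟩ := hm
  refine ⟨hu, ⟨z, by simp, ?_⟩, hf⟩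
  rcases List.mem_cons.1 hv with rfl | hv
  · exact hvu
  · exact absurd hvu.symm (hf v hv).2

/-- If `u` saw `y` as well, it would close the path from the first vertex of `m` to `y`, whose
interior is even, to an odd hole. -/
theorem far_of_mem_firstSet (h : MinOuter G T x m y) (hG : OddHoleFree G) (hu : u ∈ firstSet G T m) :
    Far G u y := by
  obtain ⟨z, m', rfl, hm'⟩ := h.exists_cons
  obtain ⟨hu, ⟨z', hz', hzu⟩, hf⟩ := hu
  obtain rfl : z = z' := by simpa using hz'
  refine ⟨?_, fun huy => ?_⟩
  · rintro rfl
    exact (h.path.tail.far_ends hm').2 hzu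
  · have := hG.odd (u := u) (m := m') h.path.tail hm' hzu.symm huy hf
    have := h.odd
    simp at this
    grind

theorem mem_firstSet_iff (h : MinOuter G T x m y) (hG : OddHoleFree G) :
    u ∈ firstSet G T m ↔ u ∈ Comp G T ∧ (∃ z ∈ m.head?, G.Adj z u) ∧ ¬ G.Adj u y := by
  constructor
  · exact fun hu => ⟨hu.1, hu.2.1, (h.far_of_mem_firstSet hG hu).2⟩
  · rintro ⟨h1, ⟨z, hz, hzu⟩, h3⟩
    refine h.mem_firstSet_of_far h1 ⟨?_, h3⟩ ⟨z, List.mem_of_mem_head? hz, hzu⟩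
    rintro rfl
    obtain ⟨z', m', rfl, hm'⟩ := h.exists_cons
    obtain rfl : z' = z := by simpa using hz
    exact (h.path.tail.far_ends hm').2 hzu

theorem left_mem (h : MinOuter G T x m y) : x ∈ firstSet G T m := by
  obtain ⟨z, m', rfl, hm'⟩ := h.exists_cons
  have := h.path
  exact ⟨h.left, ⟨z, by simp, this.1.symm⟩, fun v hv => this.2.1 v (List.mem_append_left _ hv)⟩

theorem right_mem (h : MinOuter G T x m y) : y ∈ firstSet G T m.reverse := h.swap.left_mem

theorem replace_left (h : MinOuter G T x m y) (hG : OddHoleFree G) (ha : a ∈ firstSet G T m) :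
    MinOuter G T a m y := by
  refine ⟨?_, h.odd, h.two_le, ha.1, h.right, h.out, h.min, h.clique⟩
  have hf := h.far_of_mem_firstSet hG ha
  obtain ⟨z, m', rfl, hm'⟩ := h.exists_cons
  obtain ⟨hu, ⟨z', hz', hzu⟩, hf'⟩ := ha
  obtain rfl : z = z' := by simpa using hz'
  exact ⟨hzu.symm, by simpa [hf] using hf', h.path.tail⟩

theorem replace (h : MinOuter G T x m y) (hG : OddHoleFree G) (ha : a ∈ firstSet G T m)
    (hb : b ∈ firstSet G T m.reverse) : MinOuter G T a m b := by
  have := ((h.replace_left hG ha).swap.replace_left hG hb).swap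
  simpa using this

theorem isClique (h : MinOuter G T x m y) : G.IsClique (firstSet G T m) := by
  obtain ⟨z, m', rfl, hm'⟩ := h.exists_cons
  refine (h.clique z (by simp)).subset ?_
  rintro u ⟨hu, ⟨z', hz', hzu⟩, -⟩
  obtain rfl : z = z' := by simpa using hz'
  exact ⟨hu, hzu⟩

/-- Any `b` of the second clique can replace the end `y`; a vertex of `C(T)` outside that clique
which sees `m` and misses `b` then belongs to the first set. -/
theorem adj_of_touch (h : MinOuter G T x m y) (hG : OddHoleFree G) (hu : u ∈ Comp G T)
    (hm : ∃ z ∈ m, G.Adj z u) (huA : u ∉ firstSet G T m) (huB : u ∉ firstSet G T m.reverse)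
    (hb : b ∈ firstSet G T m.reverse) : G.Adj u b := by
  by_contra hub
  refine huA ((h.replace hG h.left_mem hb).mem_firstSet_of_far hu ⟨?_, hub⟩ hm)
  rintro rfl
  exact huB hb

theorem frame [Finite V] (h : MinOuter G T x m y) (hG : OddHoleFree G) (hP : PrismFree G)
    (hA : AntiholeFree G) (hT : ConnIn Gᶜ T) {t : V} (ht : t ∈ T) :
    Frame G T t m (firstSet G T m) (firstSet G T m.reverse) := by
  have key : ∀ u v, u ∉ T → v ∉ T → (G.Adj u v ↔ (collapse G T t).Adj u v) := fun u v hu hv =>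
    (collapse_adj_iff ht hu hv).symm
  have hc : ∀ {m}, G.IsClique (firstSet G T m) → (collapse G T t).IsClique (firstSet G T m) :=
    fun h u hu v hv hne => (key _ _ (notMem_of_mem_comp hu.1) (notMem_of_mem_comp hv.1)).1 (h hu hv hne)
  refine ⟨ht, ⟨collapse_oddHoleFree hG hP hA ht hT, collapse_prismFree hG hP hA ht hT, ?_, h.odd, h.two_le,
    ⟨x, h.left_mem⟩, ⟨y, h.right_mem⟩, fun a ha => (collapse_adj_left ht).2 ha.1,
    fun b hb => (collapse_adj_left ht).2 hb.1, hc h.isClique, hc h.swap.isClique, ?_, ?_⟩,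
    fun v hv => (h.out v hv).1⟩
  · intro a ha b hb
    refine (h.replace hG ha hb).path.transfer key ?_
    have := notMem_of_mem_comp ha.1
    have := notMem_of_mem_comp hb.1
    have := h.out
    simp; grind
  · intro v hv
    refine ⟨?_, fun e => (h.out v hv).2 ((collapse_adj_left ht).1 e)⟩
    rintro rfl
    exact (h.out t hv).1 ht
  · rintro u hu ⟨z, hz, hzu⟩
    have huC := (collapse_adj_left ht).1 hu
    have huT := notMem_of_mem_comp huC
    have hm : ∃ z ∈ m, G.Adj z u := ⟨z, hz, (key _ _ (h.out z hz).1 huT).2 hzu⟩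
    by_cases h1 : u ∈ firstSet G T m
    · exact .inl h1
    by_cases h2 : u ∈ firstSet G T m.reverse
    · exact .inr (.inl h2)
    refine .inr (.inr ⟨fun a ha => (key _ _ huT (notMem_of_mem_comp ha.1)).1 ?_,
      fun b hb => (key _ _ huT (notMem_of_mem_comp hb.1)).1 (h.adj_of_touch hG huC hm h1 h2 hb)⟩)
    exact h.swap.adj_of_touch hG huC (by simpa using hm) h2 (by simpa using h1) (by simpa using ha)

end MinOuter

/-! ### Outer paths given as walks -/

section walk

variable {x y : V} {p : G.Walk x y} {m : List V}

theorem length_eq_of_support (hs : p.support = x :: (m ++ [y])) : p.length = m.length + 1 := by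
  have := congrArg List.length hs
  simp at this
  exact this

theorem getVert_succ_of_support (hs : p.support = x :: (m ++ [y])) {i : ℕ} (hi : i < m.length) :
    p.getVert (i + 1) = m[i] := by
  have hl := length_eq_of_support hs
  rw [p.getVert_eq_support_getElem (by omega)]
  simp [hs, hi]

theorem getVert_one_eq_head (hs : p.support = x :: (m ++ [y])) (hm : m ≠ []) :
    p.getVert 1 = m.head hm := by
  rw [getVert_succ_of_support hs (i := 0) (List.length_pos_iff.2 hm), List.head_eq_getElem]

theorem interior_eq (hs : p.support = x :: (m ++ [y])) (hp : IsChordlessPath G p) :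
    interior p = {v | v ∈ m} := by
  have hnd := (isChordlessPath_iff.1 hp).nodup
  rw [hs] at hnd
  ext v
  simp only [interior, Set.mem_ofPred_eq, hs]
  simp at hnd ⊢
  grind

theorem isOuterPath_iff (hs : p.support = x :: (m ++ [y])) :
    IsOuterPath G T p ↔ IndPath G (x :: (m ++ [y])) ∧ m ≠ [] ∧ x ∈ Comp G T ∧ y ∈ Comp G T ∧
      ∀ v ∈ m, v ∉ T ∧ v ∉ Comp G T := by
  have hl := length_eq_of_support hs
  unfold IsOuterPath
  rw [complete_eq_comp, ← hs, ← isChordlessPath_iff, ← List.length_pos_iff]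
  refine and_congr_right fun hp => ?_
  rw [interior_eq hs hp]
  simp [hl, Nat.succ_le_iff]

theorem IsMinimalOuterPath.minOuter [Finite V] (hT : IsMaximalInteresting G T)
    (hG : OddHoleFree G) (hP : PrismFree G) (hA : AntiholeFree G) (hp : IsMinimalOuterPath G T p) :
    ∃ m, p.support = x :: (m ++ [y]) ∧ MinOuter G T x m y := by
  obtain ⟨m, hs⟩ := exists_support_eq p (by have := hp.1.2.1; omega)
  obtain ⟨h1, h2, h3, h4, h5⟩ := (isOuterPath_iff hs).1 hp.1
  have hcl : ∀ v ∈ m, G.IsClique {u | u ∈ Comp G T ∧ G.Adj v u} := fun v hv =>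
    hT.isClique (h5 v hv).1 (h5 v hv).2
  refine ⟨m, hs, h1, ?_, ?_, h3, h4, h5, ?_, hcl⟩
  · have hfin := T.toFinite
    refine outer_path_odd hG hP hA _ hfin.toFinset rfl ?_ ?_ x y m h1 ?_ ?_ ?_ ?_ h2
    · simpa using hT.1.1
    · simpa using hT.connIn
    · simpa using h3
    · simpa using h4
    · simpa using fun v hv => (h5 v hv).1
    · simpa using fun v hv => (h5 v hv).2
  -- A single interior vertex would see both ends, which are not adjacent, against `hcl`.
  · match m, h2 with
    | [z], _ =>
      have hf := h1.far_ends (by simp)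
      exact absurd (hcl z (by simp) ⟨h3, h1.1.symm⟩ ⟨h4, indPath_pair.1 h1.tail⟩ hf.1) hf.2
    | _ :: _ :: _, _ => simp
  · intro x' m' y' k1 k2 k3 k4 k5
    obtain ⟨q, hq⟩ := k1.exists_walk
    have ho := (isOuterPath_iff (T := T) hq).2 ⟨k1, k2, k3, k4, fun v hv => h5 v (k5 hv)⟩
    have := hp.2 _ _ q ho
    rw [interior_eq hq ho.1, interior_eq hs hp.1.1] at this
    by_contra hn
    exact this ⟨k5, hn⟩

theorem algA_eq (h : MinOuter G T x m y) (hs : p.support = x :: (m ++ [y])) (hG : OddHoleFree G) :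
    algA G T p = firstSet G T m := by
  obtain ⟨z, m', rfl, -⟩ := h.exists_cons
  ext u
  rw [h.mem_firstSet_iff hG, algA, complete_eq_comp, getVert_one_eq_head hs (by simp)]
  simp [adj_comm]
  tauto

theorem orderA_eq (h : MinOuter G T x m y) (hs : p.support = x :: (m ++ [y])) :
    orderA G T p = firstSet G T m := by
  have hl := length_eq_of_support hs
  obtain ⟨z, m', rfl, -⟩ := h.exists_cons
  ext u
  simp only [orderA, Set.mem_ofPred_eq, firstSet, complete_eq_comp, getVert_one_eq_head hs (List.cons_ne_nil _ _)]
  refine and_congr_right fun hu => and_congr (by simp [adj_comm]) ⟨fun hi v hv => ?_, fun hf i h1 h2 e => ?_⟩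
  · obtain ⟨i, hi', rfl⟩ := List.getElem_of_mem (l := m') hv
    refine ⟨h.ne_of_mem (by simp) hu, ?_⟩
    have := hi (i + 2) (by omega) (by simp at hl; omega)
    rwa [getVert_succ_of_support hs (i := i + 1) (by simpa using hi')] at this
  · obtain ⟨i, rfl⟩ := Nat.exists_eq_add_of_le' h1
    simp at hl
    rw [getVert_succ_of_support hs (i := i + 1) (by simp; omega)] at e
    exact (hf _ (by simp)).2 e

theorem support_reverse_eq (hs : p.support = x :: (m ++ [y])) :
    p.reverse.support = y :: (m.reverse ++ [x]) := by
  simp [hs]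

theorem algB_eq_reverse : algB G T p = algA G T p.reverse := by
  simp [algA, algB, Walk.getVert_reverse]

theorem orderB_eq_reverse : orderB G T p = orderA G T p.reverse := by
  ext u
  simp only [orderA, orderB, Set.mem_ofPred_eq, Walk.getVert_reverse, Walk.length_reverse]
  refine and_congr_right fun _ => and_congr_right fun _ => ⟨fun h i h1 h2 => h _ ?_ ?_, fun h i h1 h2 => ?_⟩
  · omega
  · omega
  · have := h (p.length - i) (by omega) (by omega)
    rwa [Nat.sub_sub_self (by omega)] at this

end walk

end ArtemisGraph

namespace ArtemisGraph
open SimpleGraph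

variable {V : Type*} {G : SimpleGraph V} {S X Y : Set V}

/-! ### Breadth first search -/

/-- The invariants of a breadth first search from `X` to `Y` in `G[S]`, if `X ⊆ S` and `X` and `Y` are
disjoint. -/
structure BFSInv (G : SimpleGraph V) (S X Y : Set V) (s : BFSState V) : Prop where
  sub : X ⊆ s.reached
  reached_sub : s.reached ⊆ S
  queue : ∀ v ∈ s.queue, v ∈ s.reached ∧ v ∉ Y
  closed : ∀ u ∈ s.reached, u ∉ Y → u ∉ s.queue → ∀ v ∈ S, G.Adj u v → v ∈ s.reached
  link : ∀ v ∈ s.reached, v ∉ Y → ∃ b ∈ X, LinkIn G (s.reached \ Y) b v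
  touch : ∀ v ∈ s.reached, v ∈ Y → ∃ u ∈ s.reached \ Y, G.Adj u v

theorem BFSInv.start {q : List V} (hX : X ⊆ S) (hXY : ∀ v ∈ X, v ∉ Y) (hq : ∀ v, v ∈ q ↔ v ∈ X ∩ S) :
    BFSInv G S X Y ⟨q, X ∩ S⟩ := by
  refine ⟨fun v hv => ⟨hv, hX hv⟩, fun v hv => hv.2, fun v hv => ?_, fun u hu _ huq => ?_,
    fun v hv _ => ⟨v, hv.1, .refl⟩, fun v hv hvY => absurd hvY (hXY v hv.1)⟩
  · have := (hq v).1 hv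
    exact ⟨this, hXY v this.1⟩
  · exact absurd ((hq u).2 hu) huq

theorem BFSInv.step {s s' : BFSState V} (h : BFSInv G S X Y s) (hs : BFSStep G S Y s s') :
    BFSInv G S X Y s' := by
  obtain ⟨u, q, new, R, -, hnew⟩ := hs
  obtain ⟨h1, h2, h3, h4, h5, h6⟩ := h
  dsimp only at h1 h2 h3 h4 h5 h6
  have hu := h3 u (by simp)
  have hmono : R \ Y ⊆ (R ∪ {v | v ∈ S ∧ G.Adj u v}) \ Y := Set.sdiff_subset_sdiff_left Set.subset_union_left
  refine ⟨fun v hv => .inl (h1 hv), Set.union_subset h2 fun v hv => hv.1, ?_, ?_, ?_, ?_⟩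
  · intro v hv
    rcases List.mem_append.1 hv with hv | hv
    · exact ⟨.inl (h3 v (by simp [hv])).1, (h3 v (by simp [hv])).2⟩
    · have := (hnew v).1 hv
      exact ⟨.inr ⟨this.1, this.2.1⟩, this.2.2.2⟩
  · intro w hw hwY hwq v hv hwv
    simp only [List.mem_append, not_or] at hwq
    by_cases hwu : w = u
    · subst hwu
      exact .inr ⟨hv, hwv⟩
    · by_cases hwR : w ∈ R
      · exact .inl (h4 w hwR hwY (by simp [hwu, hwq.1]) v hv hwv)
      · rcases hw with hw | hw
        · exact absurd hw hwR
        · exact absurd ((hnew w).2 ⟨hw.1, hw.2, hwR, hwY⟩) hwq.2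
  · intro v hv hvY
    by_cases hvR : v ∈ R
    · obtain ⟨b, hb, hl⟩ := h5 v hvR hvY
      exact ⟨b, hb, hl.mono hmono⟩
    · have hv' := hv.resolve_left hvR
      obtain ⟨b, hb, hl⟩ := h5 u hu.1 hu.2
      exact ⟨b, hb, (hl.mono hmono).tail ⟨hv'.2, hmono hu, hv, hvY⟩⟩
  · intro v hv hvY
    by_cases hvR : v ∈ R
    · obtain ⟨w, hw, hwv⟩ := h6 v hvR hvY
      exact ⟨w, hmono hw, hwv⟩
    · exact ⟨u, hmono hu, (hv.resolve_left hvR).2⟩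

theorem BFSInv.of_result {R : Set V} (hX : X ⊆ S) (hXY : ∀ v ∈ X, v ∉ Y) (h : IsBFSResult G S X Y R) :
    BFSInv G S X Y ⟨[], R⟩ := by
  obtain ⟨q₀, -, hq, hr⟩ := h
  have h0 := BFSInv.start (G := G) hX hXY hq
  generalize (⟨[], R⟩ : BFSState V) = s at hr ⊢
  induction hr with
  | refl => exact h0
  | tail _ hs ih => exact ih.step hs

/-- Each step decreases the length of the queue plus the number of unreached vertices: one vertex
leaves the queue, and those appended are newly reached. -/
theorem exists_bfs_run [Finite V] (G : SimpleGraph V) (S Y : Set V) (s : BFSState V) :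
    ∃ R, Relation.ReflTransGen (BFSStep G S Y) s ⟨[], R⟩ := by
  classical
  induction hn : s.queue.length + s.reachedᶜ.ncard using Nat.strong_induction_on generalizing s with
  | _ n ih =>
  obtain ⟨q, R⟩ := s
  cases q with
  | nil => exact ⟨R, .refl⟩
  | cons u q =>
    set N : Set V := {v | v ∈ S ∧ G.Adj u v ∧ v ∉ R ∧ v ∉ Y}
    have hN := N.toFinite
    have hstep : BFSStep G S Y ⟨u :: q, R⟩ ⟨q ++ hN.toFinset.toList, R ∪ {v | v ∈ S ∧ G.Adj u v}⟩ :=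
      .scan u q _ R (Finset.nodup_toList _) fun v => by
        rw [Finset.mem_toList, Set.Finite.mem_toFinset, Set.mem_ofPred_eq]
    have hcard : N.ncard + (R ∪ {v | v ∈ S ∧ G.Adj u v})ᶜ.ncard ≤ Rᶜ.ncard := by
      rw [← Set.ncard_union_eq ?_ hN (Set.toFinite _)]
      · refine Set.ncard_le_ncard ?_ (Set.toFinite _)
        rintro v (hv | hv)
        · exact hv.2.2.1
        · exact fun hR => hv (.inl hR)
      · rw [Set.disjoint_left]
        exact fun v hv hv' => hv' (.inr ⟨hv.1, hv.2.1⟩)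
    obtain ⟨R', hR'⟩ := ih (m := (q ++ hN.toFinset.toList).length + (R ∪ {v | v ∈ S ∧ G.Adj u v})ᶜ.ncard) (by
      rw [← hn]
      simp only [List.length_append, Finset.length_toList, List.length_cons]
      rw [← Set.ncard_eq_toFinset_card N hN]
      omega) ⟨_, _⟩ rfl
    exact ⟨R', .head hstep hR'⟩

theorem exists_isBFSResult [Finite V] (G : SimpleGraph V) (S X Y : Set V) :
    ∃ R, IsBFSResult G S X Y R := by
  have hfin := (X ∩ S).toFinite
  obtain ⟨R, hR⟩ := exists_bfs_run G S Y ⟨hfin.toFinset.toList, X ∩ S⟩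
  exact ⟨R, _, Finset.nodup_toList _, fun v => by simp, hR⟩

/-- `M` consists of the reached vertices outside `N(A)`. All of them have been scanned, so `M` is
closed. Each is linked to a vertex of `B` inside `M`, and `B` is a clique, so `M` is connected. -/
theorem Frame.exists_reach {T A B : Set V} {t : V} {Z : List V} (h : Frame G T t Z A B) {K : Set V}
    (hK : IsSearchOutput G T A B K) : ∃ M, Reach G T A B M ∧ K = frontier G T A M := by
  obtain ⟨R, hR, rfl⟩ := hK
  have hinv := BFSInv.of_result (G := G) (R := R) (fun b hb => ?_) (fun b hb => ?_) hR
  · obtain ⟨h1, h2, -, h4, h5, h6⟩ := hinv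
    dsimp only at h1 h2 h4 h5 h6
    have hS : ∀ v ∈ R, v ∉ T ∧ v ∉ A := fun v hv => by simpa using h2 hv
    have hB : ∀ b ∈ B, b ∈ R \ nbr G A := by
      refine fun b hb => ⟨h1 hb, ?_⟩
      rintro ⟨-, a, ha, hab⟩
      exact (h.far ha hb).2 hab
    refine ⟨R \ nbr G A, ⟨?_, hB, fun v hv => (hS v hv.1).1, ?_, ?_⟩, ?_⟩
    · intro u hu v hv
      obtain ⟨b, hb, hbu⟩ := h5 u hu.1 hu.2
      obtain ⟨b', hb', hbv⟩ := h5 v hv.1 hv.2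
      refine (hbu.symm.trans ?_).trans hbv
      by_cases hbb : b = b'
      · subst hbb; exact .refl
      · exact .single ⟨h.swap.adj_left hb hb' hbb, hB b hb, hB b' hb'⟩
    · rintro a ha v ⟨hvR, hvN⟩
      have hvA := (hS v hvR).2
      exact ⟨by rintro rfl; exact hvA ha, fun e => hvN ⟨hvA, a, ha, e⟩⟩
    · intro u hu v huv hvT hvA hvN
      exact ⟨h4 u hu.1 hu.2 (by simp) v (by simp [hvT, hvA]) huv, hvN⟩
    · ext v
      constructor
      · rintro ⟨hvN, hvR⟩
        exact ⟨hvN, (hS v hvR).1, h6 v hvR hvN⟩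
      · rintro ⟨hvN, hvT, u, hu, huv⟩
        exact ⟨hvN, h4 u hu.1 hu.2 (by simp) v (by simp [hvT, hvN.1]) huv⟩
  · have := h.notMem_right hb
    simp only [Set.mem_compl_iff, Set.mem_union, not_or]
    exact ⟨this, fun ha => (h.far ha hb).1 rfl⟩
  · rintro ⟨-, a, ha, hab⟩
    exact (h.far ha hb).2 hab

theorem exists_isSearchOutput [Finite V] (G : SimpleGraph V) (T A B : Set V) :
    ∃ K, IsSearchOutput G T A B K := by
  obtain ⟨R, hR⟩ := exists_isBFSResult G (T ∪ A)ᶜ B (nbr G A)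
  exact ⟨_, R, hR, rfl⟩

end ArtemisGraph

namespace ArtemisGraph
open SimpleGraph

variable {V : Type*} {G : SimpleGraph V} {T : Set V} {t : V} {Z : List V} {A B : Set V}

/-! ### Correctness of the algorithm -/

/-- Since `A` and `B` are anticomplete, the second vertex of the path is not its end, so it can be
split off. Then `m.length` is the length of the path minus two. -/
theorem pathLT_iff (hAB : ∀ a ∈ A, ∀ b ∈ B, Far G a b) {u u' : V} :
    pathLT G A B u u' ↔ u ∈ A ∧ u' ∈ A ∧ ∃ b ∈ B, ∃ m, IndPath G (u :: u' :: (m ++ [b])) ∧ Odd m.length := by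
  refine and_congr_right fun hu => and_congr_right fun hu' => exists_congr fun b => and_congr_right fun hb => ?_
  constructor
  · rintro ⟨p, hp, hodd, rfl⟩
    obtain ⟨m, hs⟩ := exists_support_eq p hodd.pos
    have hl := length_eq_of_support hs
    rw [isChordlessPath_iff, hs] at hp
    cases m with
    | nil => exact absurd (indPath_pair.1 hp) (hAB u hu b hb).2
    | cons c m =>
      rw [getVert_one_eq_head hs (by simp)]
      refine ⟨m, hp, ?_⟩
      rw [hl] at hodd
      simp at hodd
      grind
  · rintro ⟨m, hp, hodd⟩
    obtain ⟨p, hs⟩ := IndPath.exists_walk (m := u' :: m) hp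
    have hl := length_eq_of_support hs
    refine ⟨p, isChordlessPath_iff.2 (by rw [hs]; exact hp), ?_, by rw [getVert_one_eq_head hs (by simp)]; rfl⟩
    rw [hl]
    simp
    grind

namespace Frame

theorem isMaximalVertex_iff (h : Frame G T t Z A B) {M : Set V} (hM : Reach G T A B M) {a : V}
    (ha : a ∈ A) : IsMaximalVertex G A B a ↔ ∀ k ∈ frontier G T A M, G.Adj a k := by
  have hAB : ∀ a ∈ A, ∀ b ∈ B, Far G a b := fun a ha b hb => h.far ha hb
  constructor
  · intro hmax k hk
    by_contra hak
    obtain ⟨a', ha', b, hb, m, hp⟩ := h.exists_odd_path hM ha hk hak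
    exact hmax.2 a' ha' ((pathLT_iff hAB).2 ⟨ha, ha', b, hb, m, hp⟩)
  · refine fun hK => ⟨ha, fun a' ha' hlt => ?_⟩
    obtain ⟨-, -, b, hb, m, hp, -⟩ := (pathLT_iff hAB).1 hlt
    obtain ⟨k, hk, hak⟩ := h.exists_not_adj hM ha ha' hb hp
    exact hak (hK k hk)

theorem isSpecialEvenPair (h : Frame G T t Z A B) (hG : OddHoleFree G) (hP : PrismFree G)
    {M M' : Set V} (hM : Reach G T A B M) (hM' : Reach G T B A M') {a b : V} (ha : a ∈ A) (hb : b ∈ B)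
    (hK : ∀ k ∈ frontier G T A M, G.Adj a k) (hL : ∀ k ∈ frontier G T B M', G.Adj b k) :
    IsSpecialEvenPair G a b := by
  have hab := h.far ha hb
  have hodd : ∀ m, IndPath G (a :: (m ++ [b])) → Odd m.length := fun m =>
    h.odd_of_dominating hM hM' ha hb hK hL
  refine ⟨⟨hab.1, hab.2, fun p hp => ?_⟩, fun hc => ?_⟩
  · obtain ⟨m, hs⟩ := exists_support_eq p (by
      by_contra h0
      exact hab.1 (Walk.eq_of_length_eq_zero (p := p) (by omega)))
    rw [isChordlessPath_iff, hs] at hp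
    rw [length_eq_of_support hs]
    exact (hodd m hp).add_one
  · obtain ⟨f⟩ := exists_contract_embedding G a b
    exact HasPrism.not_prismFree (hc.map f)
      (merge_prismFree hG hP hab (h.noOpenRung hM hM' ha hb hK hL) hodd)

theorem search_correct [Finite V] (h : Frame G T t Z A B) {K : Set V} (hK : IsSearchOutput G T A B K) :
    (∃ a ∈ A, ∀ u ∈ K, G.Adj a u) ∧
      ∀ a ∈ A, IsMaximalVertex G A B a ↔ ∀ u ∈ K, G.Adj a u := by
  obtain ⟨M, hM, rfl⟩ := h.exists_reach hK
  exact ⟨h.exists_dominating hM, fun a ha => h.isMaximalVertex_iff hM ha⟩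

end Frame

end ArtemisGraph

theorem mainTheorem2 {V : Type*} [Finite V] (G : SimpleGraph V) (hG : ArtemisGraph.ClassA G)
    (T : Set V) (hT : ArtemisGraph.IsMaximalInteresting G T)
    {x y : V} (p : G.Walk x y) (hp : ArtemisGraph.IsMinimalOuterPath G T p)
    (A B : Set V) (hA : A = ArtemisGraph.algA G T p) (hB : B = ArtemisGraph.algB G T p) :
    -- the sets computed by the algorithm are the sets on which the two orders are defined
    A = ArtemisGraph.orderA G T p ∧ B = ArtemisGraph.orderB G T p ∧
    -- whatever set `K` the first search outputs, the maximal vertices are those that see all of `K`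
    (∃ K, ArtemisGraph.IsSearchOutput G T A B K) ∧
    (∀ K, ArtemisGraph.IsSearchOutput G T A B K →
      (∃ a ∈ A, ∀ u ∈ K, G.Adj a u) ∧
      ∀ a ∈ A, ArtemisGraph.IsMaximalVertex G A B a ↔ ∀ u ∈ K, G.Adj a u) ∧
    -- likewise for `B` and `L`
    (∃ L, ArtemisGraph.IsSearchOutput G T B A L) ∧
    (∀ L, ArtemisGraph.IsSearchOutput G T B A L →
      (∃ b ∈ B, ∀ u ∈ L, G.Adj b u) ∧
      ∀ b ∈ B, ArtemisGraph.IsMaximalVertex G B A b ↔ ∀ u ∈ L, G.Adj b u) ∧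
    -- the algorithm returns a pair, and every pair that it can return is a special even pair
    (∃ a b, ArtemisGraph.Returns G T p a b) ∧
    (∀ a b, ArtemisGraph.Returns G T p a b → ArtemisGraph.IsSpecialEvenPair G a b) := by
  open ArtemisGraph in
  have hO := oddHoleFree_of_classA hG
  have hH := antiholeFree_of_classA hG
  have hP := prismFree_of_classA hG
  obtain ⟨m, hs, hm⟩ := hp.minOuter hT hO hP hH
  obtain ⟨t, ht⟩ := hT.1.1
  have hs' := support_reverse_eq hs
  have eA := algA_eq hm hs hO
  have eB : algB G T p = firstSet G T m.reverse := by
    rw [algB_eq_reverse, algA_eq hm.swap hs' hO]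
  have hF := hm.frame hO hP hH hT.connIn ht
  rw [← eA, ← eB, ← hA, ← hB] at hF
  obtain ⟨K, hK⟩ := exists_isSearchOutput G T A B
  obtain ⟨L, hL⟩ := exists_isSearchOutput G T B A
  have hAK := fun K => hF.search_correct (K := K)
  have hBL := fun L => hF.swap.search_correct (K := L)
  refine ⟨?_, ?_, ⟨K, hK⟩, hAK, ⟨L, hL⟩, hBL, ?_, ?_⟩
  · rw [hA, eA, orderA_eq hm hs]
  · rw [hB, eB, orderB_eq_reverse, orderA_eq hm.swap hs']
  · obtain ⟨a, ha, haK⟩ := (hAK K hK).1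
    obtain ⟨b, hb, hbL⟩ := (hBL L hL).1
    subst hA hB
    exact ⟨a, b, K, L, hK, hL, ⟨ha, haK⟩, hb, hbL⟩
  · rintro a b ⟨K, L, hK, hL, ⟨ha, haK⟩, hb, hbL⟩
    rw [← hA, ← hB] at hK hL
    rw [← hA] at ha
    rw [← hB] at hb
    obtain ⟨M, hM, rfl⟩ := hF.exists_reach hK
    obtain ⟨M', hM', rfl⟩ := hF.swap.exists_reach hL
    exact hF.isSpecialEvenPair hO hP hM hM' ha hb haK hbL
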